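/- Let $\Bbbk$ be an algebraically closed field of characteristic zero, let $q\in\Bbbk^\times$ be such that $q^2$ has finite multiplicative order $l>1$, and put $\delta=-q-q^{-1}$. Let $\mathbf T$ be the Temperley–Lieb category: its objects are the natural numbers, $\mathbf T(i,j)$ is the $\Bbbk$-vector space with basis the planar diagrams of non-intersecting lines joining in pairs $i$ dots on a lower line and $j$ dots on an upper line, composition is concatenation of diagrams with each closed loop evaluated at $\delta$, and the tensor product is $i\otimes j=i+j$ on objects and juxtaposition on diagrams. Write $TL_n(\delta)=\mathbf T(n,n)$. A *tensor ideal* is a family of subgroups $\mathcal J(i,j)\subseteq\mathbf T(i,j)$ closed under composition with arbitrary morphisms on both sides and under $1_k\otimes -$ for all objects $k$; it is *proper* if it is neither zero nor all of $\mathbf T$. A morphism $f\in\mathbf T(i,j)$ is *negligible* if $\mathrm{tr}(g\circ f)=0$ for all $g\in\mathbf T(j,i)$, where $\mathrm{tr}$ is the diagrammatic trace (close up the diagram and evaluate all loops at $\delta$). (i) The category $\mathbf T$ has exactly one proper tensor ideal $\mathcal J$, and $\mathcal J$ consists of the negligible morphisms. Moreover, for every braiding $\gamma$ on $\mathbf T$,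 the same ideal $\mathcal J$ is obtained when negligibility is defined with the trace $\mathbb 1\xrightarrow{\mathrm{co}_i} i\otimes i\xrightarrow{1\otimes f} i\otimes i\xrightarrow{\gamma_{i,i}} i\otimes i\xrightarrow{\mathrm{ev}_i}\mathbb 1$ of $f\in\mathbf T(i,i)$, where $\mathrm{co}_i$ and $\mathrm{ev}_i$ are given by $i$ nested cups and $i$ nested caps. The ideal $\mathcal J$ is generated, as a tensor ideal, by a quasi-idempotent $f\in TL_{l-1}(\delta)$, that is, an element with $f^2=\alpha f$ for some $\alpha\in\Bbbk^\times$. (ii) This $f$ satisfies $fd=0=df$ for every diagram $d\in TL_{l-1}(\delta)$ that contains a cup or a cap (a line joining two dots on the same horizontal line), and $f$ is central in $TL_{l-1}(\delta)$. Thus $\alpha^{-1}f$ is the Jones–Wenzl idempotent, i.e. the nonzero idempotent of $TL_{l-1}(\delta)$ annihilated on both sides by all such diagrams. -/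

import Mathlib

open CategoryTheory MonoidalCategory

namespace TemperleyLieb

/-! ### Planar diagrams -/

/-- Position of a dot on the boundary of the strip, read counterclockwise: the `i` dots on the
lower line from left to right, then the `j` dots on the upper line from right to left. -/
def pos {i j : ℕ} : Fin i ⊕ Fin j → ℕ
  | .inl a => a
  | .inr b => i + (j - 1 - b)

/-- A planar `(i, j)`-diagram: `i` dots on the lower line, `j` dots on the upper line, joined in
pairs by non-intersecting lines. -/
@[ext] structure Diagram (i j : ℕ) where
  /-- the dot at the other end of the line -/
  partner : Fin i ⊕ Fin j → Fin i ⊕ Fin j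
  partner_partner : ∀ p, partner (partner p) = p
  partner_ne : ∀ p, partner p ≠ p
  planar : ∀ p q, ¬ (pos p < pos q ∧ pos q < pos (partner p) ∧ pos (partner p) < pos (partner q))

/-- The diagram contains a cup: a line joining two dots on the upper line. -/
def Diagram.HasCup {i j : ℕ} (d : Diagram i j) : Prop :=
  ∃ a b : Fin j, d.partner (.inr a) = .inr b

/-- The diagram contains a cap: a line joining two dots on the lower line. -/
def Diagram.HasCap {i j : ℕ} (d : Diagram i j) : Prop :=
  ∃ a b : Fin i, d.partner (.inl a) = .inl b

/-! ### Concatenation -/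

section Concat

variable {i j k : ℕ}

/-- The dots of the lower diagram among all dots of two stacked diagrams. -/
def lowerDot : Fin i ⊕ Fin j → Fin i ⊕ (Fin j ⊕ Fin k) := Sum.map id Sum.inl

/-- The dots of the upper diagram among all dots of two stacked diagrams. -/
def upperDot : Fin j ⊕ Fin k → Fin i ⊕ (Fin j ⊕ Fin k) := Sum.inr

/-- The dots of the concatenation among all dots of two stacked diagrams. -/
def outerDot : Fin i ⊕ Fin k → Fin i ⊕ (Fin j ⊕ Fin k) := Sum.map id Sum.inr

/-- The lines of the picture obtained by putting `e` on top of `d`. -/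
inductive Line (d : Diagram i j) (e : Diagram j k) :
    Fin i ⊕ (Fin j ⊕ Fin k) → Fin i ⊕ (Fin j ⊕ Fin k) → Prop
  | lower (p : Fin i ⊕ Fin j) : Line d e (lowerDot p) (lowerDot (d.partner p))
  | upper (p : Fin j ⊕ Fin k) : Line d e (upperDot p) (upperDot (e.partner p))

/-- Two dots are equivalent if they are connected in the picture obtained by putting
`e` on top of `d`. -/
def connected (d : Diagram i j) (e : Diagram j k) : Setoid (Fin i ⊕ (Fin j ⊕ Fin k)) :=
  Relation.EqvGen.setoid (Line d e)

/-- The number of closed loops in the picture obtained by putting `e` on top of `d`: the number of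
connected components that contain no dot of the concatenation. -/
noncomputable def loops (d : Diagram i j) (e : Diagram j k) : ℕ :=
  Nat.card {c : Quotient (connected d e) // ∀ p, c ≠ Quotient.mk _ (outerDot p)}

end Concat

/-- Two involutions `a`, `b` without common fixed point: a point fixed by `b` is connected to
exactly one other point fixed by `a` or `b`. -/
theorem existsUnique_end {V : Type*} [Finite V] (a b : Equiv.Perm V) (ha : ∀ v, a (a v) = v)
    (hb : ∀ v, b (b v) = v) (hab : ∀ v, a v = v → b v ≠ v) (s : Setoid V)
    (hs : s = Relation.EqvGen.setoid (fun v w => w = a v ∨ w = b v)) (x : V) (hx : b x = x) :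
    ∃! y, y ≠ x ∧ (a y = y ∨ b y = y) ∧ s x y := by
  set r : Equiv.Perm V := b * a with hr
  have hbr : ∀ n : ℤ, b ((r ^ n) x) = (r ^ (-n)) x := by
    intro n
    have hbi : b⁻¹ = b := by ext v; rw [Equiv.Perm.inv_eq_iff_eq, hb]
    have hai : a⁻¹ = a := by ext v; rw [Equiv.Perm.inv_eq_iff_eq, ha]
    have h1 : b * r * b⁻¹ = r⁻¹ := by
      have : b * b = 1 := by ext v; simp [hb]
      rw [hr, mul_inv_rev, hbi, hai, ← mul_assoc, this, one_mul]
    have h2 : b * r ^ n * b⁻¹ = r ^ (-n) := by rw [← conj_zpow, h1, inv_zpow']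
    rw [← h2]; simp [hbi, hx]
  have har : ∀ n : ℤ, a ((r ^ n) x) = (r ^ (-n - 1)) x := by
    intro n
    have : a ((r ^ n) x) = b ((r ^ (n + 1)) x) := by
      rw [add_comm, zpow_add, zpow_one, hr]; simp [hb]
    rw [this, hbr]; congr 2; ring
  have hm : ∀ n n' : ℤ, (r ^ n) x = (r ^ n') x ↔ (Function.minimalPeriod r x : ℤ) ∣ n - n' := by
    intro n n'
    have := MulAction.zpow_smul_eq_iff_minimalPeriod_dvd (a := r) (b := x) (n := n - n')
    rw [show (fun y => r • y) = ⇑r from rfl] at this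
    rw [← this]
    simp only [Equiv.Perm.smul_def]
    rw [sub_eq_neg_add, zpow_add, Equiv.Perm.mul_apply, zpow_neg, Equiv.Perm.inv_eq_iff_eq]
  have hpos : 0 < Function.minimalPeriod r x := by
    apply Function.minimalPeriod_pos_of_mem_periodicPts
    exact Function.Injective.mem_periodicPts r.injective x
  have horb : ∀ y, s x y ↔ ∃ n : ℤ, y = (r ^ n) x := by
    intro y
    constructor
    · intro h
      rw [hs] at h
      have key : ∀ u v, Relation.EqvGen (fun v w => w = a v ∨ w = b v) u v →
          ((∃ n : ℤ, u = (r ^ n) x) ↔ (∃ n : ℤ, v = (r ^ n) x)) := by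
        intro u v huv
        induction huv with
        | rel u v h =>
          have ha' : (∃ n : ℤ, u = (r ^ n) x) → (∃ n : ℤ, a u = (r ^ n) x) := by
            rintro ⟨n, rfl⟩; exact ⟨_, har n⟩
          have hb' : (∃ n : ℤ, u = (r ^ n) x) → (∃ n : ℤ, b u = (r ^ n) x) := by
            rintro ⟨n, rfl⟩; exact ⟨_, hbr n⟩
          have ha'' : (∃ n : ℤ, a u = (r ^ n) x) → (∃ n : ℤ, u = (r ^ n) x) := by
            rintro ⟨n, h⟩; exact ⟨_, by rw [← har n, ← h, ha]⟩
          have hb'' : (∃ n : ℤ, b u = (r ^ n) x) → (∃ n : ℤ, u = (r ^ n) x) := by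
            rintro ⟨n, h⟩; exact ⟨_, by rw [← hbr n, ← h, hb]⟩
          rcases h with rfl | rfl
          · exact ⟨ha', ha''⟩
          · exact ⟨hb', hb''⟩
        | refl u => exact Iff.rfl
        | symm u v _ ih => exact ih.symm
        | trans u v w _ _ ih1 ih2 => exact ih1.trans ih2
      exact (key x y h).1 ⟨0, by simp⟩
    · have sa : ∀ v, s v (a v) := fun v => by rw [hs]; exact Relation.EqvGen.rel _ _ (Or.inl rfl)
      have sb : ∀ v, s v (b v) := fun v => by rw [hs]; exact Relation.EqvGen.rel _ _ (Or.inr rfl)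
      have sr : ∀ v, s v (r v) := fun v => s.trans (sa v) (sb (a v))
      rintro ⟨n, rfl⟩
      induction n using Int.induction_on with
      | zero => exact s.refl x
      | succ n ih => rw [add_comm, zpow_add, zpow_one]; exact s.trans ih (sr _)
      | pred n ih =>
        refine s.trans ih (s.symm ?_)
        have := sr ((r ^ (-(n : ℤ) - 1)) x)
        rwa [← Equiv.Perm.mul_apply, ← zpow_one_add, show (1 + (-(n : ℤ) - 1)) = -n by ring] at this
  set m := Function.minimalPeriod r x
  have hx0 : ∀ n : ℤ, (r ^ n) x = x ↔ (m : ℤ) ∣ n := by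
    intro n; simpa using hm n 0
  rcases Nat.even_or_odd' m with ⟨t, ht | ht⟩
  · refine ⟨(r ^ (t : ℤ)) x, ⟨?_, Or.inr ?_, (horb _).2 ⟨_, rfl⟩⟩, ?_⟩
    · rw [Ne, hx0]; intro h
      have := Int.le_of_dvd (by omega) h
      omega
    · rw [hbr, hm]; exact ⟨-1, by rw [ht]; push_cast; ring⟩
    · rintro y ⟨h1, h2, h3⟩
      obtain ⟨n, rfl⟩ := (horb y).1 h3
      rw [Ne, hx0] at h1
      rcases h2 with h2 | h2
      · rw [har, hm] at h2
        obtain ⟨c, hc⟩ := h2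
        rw [ht] at hc; push_cast at hc
        have : 2 * (-n - t * c) = 1 := by linarith
        omega
      · rw [hbr, hm] at h2
        obtain ⟨c, hc⟩ := h2
        rw [ht] at hc; push_cast at hc
        have hc' : n = -(t * c) := by linarith
        rw [hm]
        rcases Int.even_or_odd' c with ⟨u, rfl | rfl⟩
        · exact absurd ⟨-u, by rw [hc', ht]; push_cast; ring⟩ h1
        · exact ⟨-u - 1, by rw [hc', ht]; push_cast; ring⟩
  · have h2t : ∀ n : ℤ, (m : ℤ) ∣ 2 * n → (m : ℤ) ∣ n := by
      rintro n ⟨c, hc⟩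
      refine ⟨c * (t + 1) - n, ?_⟩
      have : (m : ℤ) = 2 * t + 1 := by rw [ht]; push_cast; ring
      rw [this] at hc ⊢
      linear_combination ((t : ℤ) + 1) * hc
    refine ⟨(r ^ (t : ℤ)) x, ⟨?_, Or.inl ?_, (horb _).2 ⟨_, rfl⟩⟩, ?_⟩
    · intro h
      have h1 : a ((r ^ (t : ℤ)) x) = (r ^ (t : ℤ)) x := by
        rw [har, hm]; exact ⟨-1, by rw [ht]; push_cast; ring⟩
      rw [h] at h1
      exact hab x h1 hx
    · rw [har, hm]; exact ⟨-1, by rw [ht]; push_cast; ring⟩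
    · rintro y ⟨h1, h2, h3⟩
      obtain ⟨n, rfl⟩ := (horb y).1 h3
      rw [Ne, hx0] at h1
      rcases h2 with h2 | h2
      · rw [har, hm] at h2
        rw [hm]
        apply h2t
        obtain ⟨c, hc⟩ := h2
        refine ⟨-c - 1, ?_⟩
        rw [ht] at hc ⊢; push_cast at hc ⊢
        linear_combination -hc
      · rw [hbr, hm] at h2
        exact absurd (h2t n (by obtain ⟨c, hc⟩ := h2; exact ⟨-c, by linarith⟩)) h1

section Concat

variable {i j k : ℕ}

/-- The lines of the lower diagram as a permutation of all dots. -/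
def lowerPerm (d : Diagram i j) : Equiv.Perm (Fin i ⊕ (Fin j ⊕ Fin k)) where
  toFun := fun
    | .inl a => lowerDot (d.partner (.inl a))
    | .inr (.inl b) => lowerDot (d.partner (.inr b))
    | .inr (.inr c) => .inr (.inr c)
  invFun := fun
    | .inl a => lowerDot (d.partner (.inl a))
    | .inr (.inl b) => lowerDot (d.partner (.inr b))
    | .inr (.inr c) => .inr (.inr c)
  left_inv := by
    have h : ∀ p, (match (lowerDot p : Fin i ⊕ (Fin j ⊕ Fin k)) with
      | .inl a => lowerDot (d.partner (.inl a))
      | .inr (.inl b) => lowerDot (d.partner (.inr b))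
      | .inr (.inr c) => .inr (.inr c)) = (lowerDot (d.partner p) : Fin i ⊕ (Fin j ⊕ Fin k)) := by
      rintro (a | b) <;> rfl
    rintro (a | b | c)
    · exact (h _).trans (by rw [d.partner_partner]; rfl)
    · exact (h _).trans (by rw [d.partner_partner]; rfl)
    · rfl
  right_inv := by
    have h : ∀ p, (match (lowerDot p : Fin i ⊕ (Fin j ⊕ Fin k)) with
      | .inl a => lowerDot (d.partner (.inl a))
      | .inr (.inl b) => lowerDot (d.partner (.inr b))
      | .inr (.inr c) => .inr (.inr c)) = (lowerDot (d.partner p) : Fin i ⊕ (Fin j ⊕ Fin k)) := by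
      rintro (a | b) <;> rfl
    rintro (a | b | c)
    · exact (h _).trans (by rw [d.partner_partner]; rfl)
    · exact (h _).trans (by rw [d.partner_partner]; rfl)
    · rfl

/-- The lines of the upper diagram as a permutation of all dots. -/
def upperPerm (e : Diagram j k) : Equiv.Perm (Fin i ⊕ (Fin j ⊕ Fin k)) where
  toFun := Sum.map id e.partner
  invFun := Sum.map id e.partner
  left_inv := by rintro (a | p) <;> simp [e.partner_partner]
  right_inv := by rintro (a | p) <;> simp [e.partner_partner]

theorem lowerPerm_lowerDot (d : Diagram i j) (p : Fin i ⊕ Fin j) :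
    lowerPerm (k := k) d (lowerDot p) = lowerDot (d.partner p) := by
  rcases p with a | b <;> rfl

theorem upperPerm_upperDot (e : Diagram j k) (p : Fin j ⊕ Fin k) :
    upperPerm (i := i) e (upperDot p) = upperDot (e.partner p) := rfl

theorem lowerPerm_eq_self (d : Diagram i j) (v : Fin i ⊕ (Fin j ⊕ Fin k)) :
    lowerPerm d v = v ↔ ∃ c, v = .inr (.inr c) := by
  have h : Function.Injective (lowerDot (i := i) (j := j) (k := k)) :=
    Function.Injective.sumMap Function.injective_id Sum.inl_injective
  rcases v with a | b | c
  · simp only [reduceCtorEq, exists_false, iff_false]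
    exact fun e => d.partner_ne (.inl a) (h e)
  · simp only [reduceCtorEq, Sum.inr.injEq, exists_false, iff_false]
    exact fun e => d.partner_ne (.inr b) (h e)
  · exact ⟨fun _ => ⟨c, rfl⟩, fun _ => rfl⟩

theorem upperPerm_eq_self (e : Diagram j k) (v : Fin i ⊕ (Fin j ⊕ Fin k)) :
    upperPerm e v = v ↔ ∃ a, v = .inl a := by
  rcases v with a | p
  · exact ⟨fun _ => ⟨a, rfl⟩, fun _ => rfl⟩
  · simp only [reduceCtorEq, exists_false, iff_false]
    exact fun h => e.partner_ne p (Sum.inr_injective h)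

theorem connected_eq (d : Diagram i j) (e : Diagram j k) :
    connected d e = Relation.EqvGen.setoid (fun v w => w = lowerPerm d v ∨ w = upperPerm e v) := by
  apply le_antisymm
  · intro v w h
    change Relation.EqvGen _ v w at h
    induction h with
    | rel v w h =>
      apply Relation.EqvGen.rel
      cases h with
      | lower p => exact Or.inl (lowerPerm_lowerDot d p).symm
      | upper p => exact Or.inr rfl
    | refl v => exact Setoid.refl' _ v
    | symm v w _ ih => exact Setoid.symm' _ ih
    | trans u v w _ _ ih1 ih2 => exact Setoid.trans' _ ih1 ih2
  · intro v w h
    change Relation.EqvGen _ v w at h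
    induction h with
    | rel v w h =>
      rcases h with rfl | rfl
      · rcases v with a | b | c
        · exact Relation.EqvGen.rel _ _ (Line.lower (.inl a))
        · exact Relation.EqvGen.rel _ _ (Line.lower (.inr b))
        · exact Setoid.refl' _ _
      · rcases v with a | p
        · exact Setoid.refl' _ _
        · exact Relation.EqvGen.rel _ _ (Line.upper p)
    | refl v => exact Setoid.refl' _ v
    | symm v w _ ih => exact Setoid.symm' _ ih
    | trans u v w _ _ ih1 ih2 => exact Setoid.trans' _ ih1 ih2

theorem outerDot_injective : Function.Injective (outerDot (i := i) (j := j) (k := k)) :=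
  Function.Injective.sumMap Function.injective_id Sum.inr_injective

theorem exists_outerDot (d : Diagram i j) (e : Diagram j k) (v : Fin i ⊕ (Fin j ⊕ Fin k)) :
    (lowerPerm d v = v ∨ upperPerm e v = v) ↔ ∃ p, v = outerDot p := by
  rw [lowerPerm_eq_self, upperPerm_eq_self]
  constructor
  · rintro (⟨c, rfl⟩ | ⟨a, rfl⟩)
    exacts [⟨.inr c, rfl⟩, ⟨.inl a, rfl⟩]
  · rintro ⟨a | c, rfl⟩
    exacts [Or.inr ⟨a, rfl⟩, Or.inl ⟨c, rfl⟩]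

/-- Every dot of the concatenation is connected to exactly one other such dot. -/
theorem existsUnique_partner (d : Diagram i j) (e : Diagram j k) (p : Fin i ⊕ Fin k) :
    ∃! q : Fin i ⊕ Fin k, q ≠ p ∧ connected d e (outerDot p) (outerDot q) := by
  have hl : ∀ v : Fin i ⊕ (Fin j ⊕ Fin k), lowerPerm d (lowerPerm d v) = v :=
    fun v => (lowerPerm d).left_inv v
  have hu : ∀ v : Fin i ⊕ (Fin j ⊕ Fin k), upperPerm e (upperPerm e v) = v :=
    fun v => (upperPerm e).left_inv v
  have hlu : ∀ v : Fin i ⊕ (Fin j ⊕ Fin k), lowerPerm d v = v → upperPerm e v ≠ v := by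
    intro v h1 h2
    obtain ⟨c, rfl⟩ := (lowerPerm_eq_self d v).1 h1
    obtain ⟨a, h⟩ := (upperPerm_eq_self e _).1 h2
    simp at h
  have key : ∃! v : Fin i ⊕ (Fin j ⊕ Fin k), v ≠ outerDot p ∧
      (lowerPerm d v = v ∨ upperPerm e v = v) ∧ connected d e (outerDot p) v := by
    rcases p with a | c
    · exact existsUnique_end _ _ hl hu hlu _ (connected_eq d e) _ rfl
    · have := existsUnique_end _ _ hu hl (fun v h1 h2 => hlu v h2 h1) (connected d e)
        ((connected_eq d e).trans (by congr 1; ext v w; exact or_comm)) (outerDot (.inr c)) rfl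
      simpa only [or_comm] using this
  obtain ⟨v, ⟨h1, h2, h3⟩, h4⟩ := key
  obtain ⟨q, rfl⟩ := (exists_outerDot d e v).1 h2
  refine ⟨q, ⟨fun h => h1 (by rw [h]), h3⟩, ?_⟩
  rintro q' ⟨h5, h6⟩
  exact outerDot_injective (h4 _ ⟨fun h => h5 (outerDot_injective h),
    (exists_outerDot d e _).2 ⟨_, rfl⟩, h6⟩)

/-- The dot connected to `p` in the concatenation. -/
noncomputable def concatPartner (d : Diagram i j) (e : Diagram j k) (p : Fin i ⊕ Fin k) :
    Fin i ⊕ Fin k :=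
  (existsUnique_partner d e p).choose

theorem concatPartner_ne (d : Diagram i j) (e : Diagram j k) (p : Fin i ⊕ Fin k) :
    concatPartner d e p ≠ p :=
  (existsUnique_partner d e p).choose_spec.1.1

theorem connected_concatPartner (d : Diagram i j) (e : Diagram j k) (p : Fin i ⊕ Fin k) :
    connected d e (outerDot p) (outerDot (concatPartner d e p)) :=
  (existsUnique_partner d e p).choose_spec.1.2

theorem eq_concatPartner {d : Diagram i j} {e : Diagram j k} {p q : Fin i ⊕ Fin k}
    (h1 : q ≠ p) (h2 : connected d e (outerDot p) (outerDot q)) : q = concatPartner d e p :=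
  (existsUnique_partner d e p).choose_spec.2 q ⟨h1, h2⟩

theorem connected_lower (d : Diagram i j) (e : Diagram j k) (p : Fin i ⊕ Fin j) :
    connected d e (lowerDot p) (lowerDot (d.partner p)) :=
  Relation.EqvGen.rel _ _ (Line.lower p)

theorem connected_upper (d : Diagram i j) (e : Diagram j k) (p : Fin j ⊕ Fin k) :
    connected d e (upperDot p) (upperDot (e.partner p)) :=
  Relation.EqvGen.rel _ _ (Line.upper p)

theorem pos_injective {i j : ℕ} : Function.Injective (pos : Fin i ⊕ Fin j → ℕ) := by
  rintro (a | a) (b | b) h <;> simp only [pos] at h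
  · exact congrArg Sum.inl (Fin.ext h)
  · omega
  · omega
  · exact congrArg Sum.inr (Fin.ext (by omega))

/-- `1` if the dot `p` comes before the dot `q`, and `0` otherwise. -/
def before {i j : ℕ} (p q : Fin i ⊕ Fin j) : ZMod 2 := if pos p < pos q then 1 else 0

theorem zmod_two_add_self (a : ZMod 2) : a + a = 0 := CharTwo.add_self_eq_zero a

/-- In a planar diagram, two disjoint sets of lines cross an even number of times. -/
theorem sum_before (d : Diagram i j) (f g : Fin i ⊕ Fin j → ZMod 2)
    (hf : ∀ p, f (d.partner p) = f p) (hg : ∀ p, g (d.partner p) = g p)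
    (hfg : ∀ p, f p * g p = 0) : ∑ p, ∑ q, f p * g q * before p q = 0 := by
  have inner : ∀ p, f p * ∑ q, g q * (before p q + before (d.partner p) q) = 0 := by
    intro p
    by_cases hp : f p = 0
    · rw [hp, zero_mul]
    have hgp : g p = 0 := (mul_eq_zero.1 (hfg p)).resolve_left hp
    rw [Finset.sum_involution (fun q _ => d.partner q), mul_zero]
    · intro q _
      rw [hg]
      by_cases hq : g q = 0
      · simp [hq]
      have h1 : q ≠ p := fun h => hq (h ▸ hgp)
      have h2 : q ≠ d.partner p := fun h => hq (by rw [h, hg, hgp])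
      have h3 : d.partner q ≠ p := fun h => hq (by rw [← hg, h, hgp])
      have h4 : d.partner q ≠ d.partner p := fun h => hq (by rw [← hg, h, hg, hgp])
      have c1 := d.planar p q
      have c2 := d.planar (d.partner p) q
      have c3 := d.planar p (d.partner q)
      have c4 := d.planar (d.partner p) (d.partner q)
      have c5 := d.planar q p
      have c6 := d.planar (d.partner q) p
      have c7 := d.planar q (d.partner p)
      have c8 := d.planar (d.partner q) (d.partner p)
      simp only [d.partner_partner] at c1 c2 c3 c4 c5 c6 c7 c8
      rw [← pos_injective.ne_iff] at h1 h2 h3 h4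
      rw [← mul_add]
      convert mul_zero _
      simp only [before]
      have e2 : (1 + 1 : ZMod 2) = 0 := rfl
      split_ifs <;> simp [e2] <;> omega
    · exact fun q _ _ => d.partner_ne q
    · exact fun q _ => Finset.mem_univ _
    · exact fun q _ => d.partner_partner q
  simp only [mul_assoc, ← Finset.mul_sum]
  refine Finset.sum_involution (fun p _ => d.partner p) ?_ (fun q _ _ => d.partner_ne q)
    (fun q _ => Finset.mem_univ _) (fun q _ => d.partner_partner q)
  intro p _
  rw [hf, ← mul_add, ← Finset.sum_add_distrib]
  simpa only [mul_add] using inner p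

theorem sum_invariant (d : Diagram i j) (f : Fin i ⊕ Fin j → ZMod 2)
    (hf : ∀ p, f (d.partner p) = f p) : ∑ p, f p = 0 :=
  Finset.sum_involution (fun p _ => d.partner p)
    (fun p _ => by rw [hf, zmod_two_add_self]) (fun q _ _ => d.partner_ne q)
    (fun q _ => Finset.mem_univ _) (fun q _ => d.partner_partner q)

theorem sum_sum_before (f g : Fin i ⊕ Fin j → ZMod 2) :
    ∑ p, ∑ q, f p * g q * before p q =
      (∑ a, ∑ b, f (.inl a) * g (.inl b) * (if a < b then 1 else 0)) +
      (∑ a, f (.inl a)) * (∑ b, g (.inr b)) +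
      ∑ a, ∑ b, f (.inr a) * g (.inr b) * (if b < a then 1 else 0) := by
  have h1 : ∀ a b : Fin i, before (j := j) (.inl a) (.inl b) = if a < b then 1 else 0 :=
    fun a b => by simp [before, pos]
  have h2 : ∀ (a : Fin i) (b : Fin j), before (.inl a) (.inr b) = 1 :=
    fun a b => if_pos (show (a : ℕ) < i + (j - 1 - b) by omega)
  have h3 : ∀ (a : Fin j) (b : Fin i), before (.inr a) (.inl b) = 0 :=
    fun a b => if_neg (show ¬ i + (j - 1 - (a : ℕ)) < b by omega)
  have h4 : ∀ a b : Fin j, before (i := i) (.inr a) (.inr b) = if b < a then 1 else 0 :=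
    fun a b => by simp only [before, pos]; congr 1; rw [Fin.lt_def, eq_iff_iff]; omega
  simp only [Fintype.sum_sum_type, h1, h2, h3, h4, mul_one, mul_zero, Finset.sum_const_zero,
    add_zero, Finset.sum_add_distrib, Finset.sum_mul_sum, add_assoc]

theorem concat_planar (d : Diagram i j) (e : Diagram j k) (p q : Fin i ⊕ Fin k) :
    ¬ (pos p < pos q ∧ pos q < pos (concatPartner d e p) ∧
      pos (concatPartner d e p) < pos (concatPartner d e q)) := by
  classical
  rintro ⟨h1, h2, h3⟩
  set p' := concatPartner d e p with hp'
  set q' := concatPartner d e q with hq'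
  let f : Fin i ⊕ (Fin j ⊕ Fin k) → ZMod 2 :=
    fun v => if connected d e (outerDot p) v then 1 else 0
  let g : Fin i ⊕ (Fin j ⊕ Fin k) → ZMod 2 :=
    fun v => if connected d e (outerDot q) v then 1 else 0
  have hinv : ∀ x v w, connected d e v w → ((connected d e x v) ↔ connected d e x w) :=
    fun x v w h => ⟨fun h' => Setoid.trans' _ h' h, fun h' => Setoid.trans' _ h' (Setoid.symm' _ h)⟩
  have hpq : ¬ connected d e (outerDot p) (outerDot q) := by
    intro h
    have := eq_concatPartner (p := p) (q := q) (fun h => by rw [h] at h1; omega) h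
    rw [← hp'] at this
    rw [this] at h2; omega
  have hfg : ∀ v, f v * g v = 0 := by
    intro v
    simp only [f, g]
    split_ifs with a b
    · exact absurd (Setoid.trans' _ a (Setoid.symm' _ b)) hpq
    all_goals simp
  have hfl : ∀ s, f (lowerDot (d.partner s)) = f (lowerDot s) := fun s => by
    simp only [f, hinv _ _ _ (connected_lower d e s)]
  have hgl : ∀ s, g (lowerDot (d.partner s)) = g (lowerDot s) := fun s => by
    simp only [g, hinv _ _ _ (connected_lower d e s)]
  have hfu : ∀ s, f (upperDot (e.partner s)) = f (upperDot s) := fun s => by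
    simp only [f, hinv _ _ _ (connected_upper d e s)]
  have hgu : ∀ s, g (upperDot (e.partner s)) = g (upperDot s) := fun s => by
    simp only [g, hinv _ _ _ (connected_upper d e s)]
  have E1 := sum_before d (fun s => f (lowerDot s)) (fun s => g (lowerDot s)) hfl hgl
    (fun s => hfg _)
  have E2 := sum_before e (fun s => f (upperDot s)) (fun s => g (upperDot s)) hfu hgu
    (fun s => hfg _)
  have F1 := sum_invariant d (fun s => f (lowerDot s)) hfl
  have F2 := sum_invariant e (fun s => f (upperDot s)) hfu
  have G1 := sum_invariant d (fun s => g (lowerDot s)) hgl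
  have G2 := sum_invariant e (fun s => g (upperDot s)) hgu
  have E3 := sum_sum_before (fun s => f (outerDot s)) (fun s => g (outerDot s))
  have MM : (∑ a : Fin j, ∑ b : Fin j, f (.inr (.inl a)) * g (.inr (.inl b)) *
      (if a < b then 1 else 0)) + (∑ a : Fin j, ∑ b : Fin j, f (.inr (.inl a)) *
      g (.inr (.inl b)) * (if b < a then 1 else 0)) =
      (∑ a : Fin j, f (.inr (.inl a))) * ∑ b : Fin j, g (.inr (.inl b)) := by
    rw [Finset.sum_mul_sum, ← Finset.sum_add_distrib]
    refine Finset.sum_congr rfl fun a _ => ?_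
    rw [← Finset.sum_add_distrib]
    refine Finset.sum_congr rfl fun b _ => ?_
    rcases lt_trichotomy a b with h | h | h
    · simp [h, h.le]
    · simp [h, hfg]
    · simp [h, h.le]
  rw [sum_sum_before] at E1 E2
  simp only [Fintype.sum_sum_type] at F1 F2 G1 G2
  simp only [lowerDot, upperDot, outerDot, Sum.map_inl, Sum.map_inr, id] at E1 E2 E3 F1 F2 G1 G2
  have Z : ∑ s, ∑ t, f (outerDot s) * g (outerDot t) * before s t = 0 := by
    refine E3.trans ?_
    have two : (2 : ZMod 2) = 0 := rfl
    generalize (∑ a : Fin j, ∑ b : Fin j, f (.inr (.inl a)) * g (.inr (.inl b)) *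
      (if a < b then 1 else 0)) = m1 at *
    generalize (∑ a : Fin j, ∑ b : Fin j, f (.inr (.inl a)) * g (.inr (.inl b)) *
      (if b < a then 1 else 0)) = m2 at *
    generalize (∑ a : Fin j, f (.inr (.inl a))) = M at *
    generalize (∑ a : Fin j, g (.inr (.inl a))) = M' at *
    generalize (∑ a : Fin i, f (.inl a)) = B at *
    generalize (∑ a : Fin i, g (.inl a)) = B' at *
    generalize (∑ a : Fin k, f (.inr (.inr a))) = T at *
    generalize (∑ a : Fin k, g (.inr (.inr a))) = T' at *
    linear_combination E1 + E2 - MM - M' * F1 + T' * F1 - M * T' * two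
  have fne : ∀ s, s ≠ p ∧ s ≠ p' → f (outerDot s) = 0 := fun s hs =>
    if_neg fun h => hs.2 (eq_concatPartner hs.1 h)
  have gne : ∀ s, s ≠ q ∧ s ≠ q' → g (outerDot s) = 0 := fun s hs =>
    if_neg fun h => hs.2 (eq_concatPartner hs.1 h)
  have fp : f (outerDot p) = 1 := if_pos (Setoid.refl' _ _)
  have fp' : f (outerDot p') = 1 := if_pos (connected_concatPartner d e p)
  have gq : g (outerDot q) = 1 := if_pos (Setoid.refl' _ _)
  have gq' : g (outerDot q') = 1 := if_pos (connected_concatPartner d e q)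
  have hin : ∀ s, ∑ t, f (outerDot s) * g (outerDot t) * before s t =
      f (outerDot s) * (before s q + before s q') := by
    intro s
    rw [Fintype.sum_eq_add q q' (concatPartner_ne d e q).symm, gq, gq']
    · ring
    · intro t ht; rw [gne t ht]; ring
  simp only [hin] at Z
  rw [Fintype.sum_eq_add p p' (concatPartner_ne d e p).symm
    (fun s hs => by rw [fne s hs]; ring), fp, fp'] at Z
  simp only [before] at Z
  rw [if_pos h1, if_pos (h1.trans (h2.trans h3)), if_neg (by omega), if_pos h3] at Z
  exact absurd Z (by decide)

/-- The concatenation: `e` is put on top of `d` and closed loops are removed. -/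
noncomputable def Diagram.concat (d : Diagram i j) (e : Diagram j k) : Diagram i k where
  partner := concatPartner d e
  partner_partner p := (eq_concatPartner (concatPartner_ne d e p).symm
    (Setoid.symm' _ (connected_concatPartner d e p))).symm
  partner_ne := concatPartner_ne d e
  planar := concat_planar d e

end Concat

/-! ### Juxtaposition and some special diagrams -/

/-- All dots of two juxtaposed diagrams. -/
def juxtaposeDots (i j i' j' : ℕ) :
    (Fin i ⊕ Fin j) ⊕ (Fin i' ⊕ Fin j') ≃ Fin (i + i') ⊕ Fin (j + j') :=
  (Equiv.sumSumSumComm _ _ _ _).trans (Equiv.sumCongr finSumFinEquiv finSumFinEquiv)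

theorem pos_juxtaposeDots_inl {i j : ℕ} (i' j' : ℕ) (p : Fin i ⊕ Fin j) :
    pos (juxtaposeDots i j i' j' (.inl p)) = if pos p < i then pos p else pos p + i' + j' := by
  rcases p with a | b
  · simp [juxtaposeDots, pos]
  · simp [juxtaposeDots, pos]; omega

theorem pos_juxtaposeDots_inr {i' j' : ℕ} (i j : ℕ) (p : Fin i' ⊕ Fin j') :
    pos (juxtaposeDots i j i' j' (.inr p)) = pos p + i := by
  rcases p with a | b
  · simp [juxtaposeDots, pos]; omega
  · simp [juxtaposeDots, pos]; omega

theorem pos_lt {i j : ℕ} (p : Fin i ⊕ Fin j) : pos p < i + j := by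
  rcases p with a | b <;> simp only [pos] <;> omega

/-- The juxtaposition: `e` is put to the right of `d`. -/
def Diagram.juxtapose {i j i' j' : ℕ} (d : Diagram i j) (e : Diagram i' j') :
    Diagram (i + i') (j + j') where
  partner p := juxtaposeDots i j i' j'
    (Sum.map d.partner e.partner ((juxtaposeDots i j i' j').symm p))
  partner_partner p := by
    rw [Equiv.symm_apply_apply, Sum.map_map, ← Equiv.eq_symm_apply]
    generalize (juxtaposeDots i j i' j').symm p = s
    rcases s with s | s <;> simp [d.partner_partner, e.partner_partner]
  partner_ne p := by
    rw [Ne, ← Equiv.eq_symm_apply]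
    generalize (juxtaposeDots i j i' j').symm p = s
    rcases s with s | s <;> simp [d.partner_ne, e.partner_ne]
  planar p q := by
    obtain ⟨p, rfl⟩ := (juxtaposeDots i j i' j').surjective p
    obtain ⟨q, rfl⟩ := (juxtaposeDots i j i' j').surjective q
    simp only [Equiv.symm_apply_apply]
    rcases p with p | p <;> rcases q with q | q <;>
      simp only [Sum.map_inl, Sum.map_inr, pos_juxtaposeDots_inl, pos_juxtaposeDots_inr]
    · have := d.planar p q
      split_ifs <;> omega
    · have := pos_lt q
      have := pos_lt (e.partner q)
      split_ifs <;> omega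
    · have := pos_lt p
      have := pos_lt (e.partner p)
      split_ifs <;> omega
    · have := e.planar p q
      omega

/-- The diagram with only vertical lines, from `i` dots to `j = i` dots. -/
def Diagram.vertical {i j : ℕ} (h : i = j) : Diagram i j where
  partner
    | .inl a => .inr (Fin.cast h a)
    | .inr b => .inl (Fin.cast h.symm b)
  partner_partner := by rintro (a | b) <;> rfl
  partner_ne := by rintro (a | b) <;> simp
  planar := by
    rintro (a | b) (a' | b') <;> simp only [pos, Fin.val_cast] <;> omega

/-- The diagram of `n` nested cups. -/
def Diagram.cups (n : ℕ) : Diagram 0 (n + n) where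
  partner
    | .inl a => .inl a
    | .inr b => .inr b.rev
  partner_partner := by rintro (a | b) <;> simp
  partner_ne := by
    rintro (a | b)
    · exact a.elim0
    · simp only [ne_eq, Sum.inr.injEq, Fin.ext_iff, Fin.val_rev]; omega
  planar := by
    rintro (a | b) (a' | b')
    · exact a.elim0
    · exact a.elim0
    · exact a'.elim0
    · simp only [pos, Fin.val_rev]; omega

/-- The diagram of `n` nested caps. -/
def Diagram.caps (n : ℕ) : Diagram (n + n) 0 where
  partner
    | .inl a => .inl a.rev
    | .inr b => .inr b
  partner_partner := by rintro (a | b) <;> simp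
  partner_ne := by
    rintro (a | b)
    · simp only [ne_eq, Sum.inl.injEq, Fin.ext_iff, Fin.val_rev]; omega
    · exact b.elim0
  planar := by
    rintro (a | b) (a' | b')
    · simp only [pos, Fin.val_rev]; omega
    · exact b'.elim0
    · exact b.elim0
    · exact b.elim0

/-! ### Identities between diagrams

They are deduced from the corresponding identities between matrices, where a diagram acts by
counting the labelings of the dots that are constant along lines. -/

section Matrices

open Diagram

variable {i j k m : ℕ}

theorem indicator_mul (P Q : Prop) [Decidable P] [Decidable Q] :
    ((if P then 1 else 0) * (if Q then 1 else 0) : ℕ) = if P ∧ Q then 1 else 0 := by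
  split_ifs <;> simp_all

/-- The matrix of a diagram. -/
def mat (d : Diagram i j) : Matrix (Fin i → Bool) (Fin j → Bool) ℕ :=
  fun x y => if ∀ p, Sum.elim x y (d.partner p) = Sum.elim x y p then 1 else 0

theorem mat_concat (d : Diagram i j) (e : Diagram j k) :
    mat d * mat e = 2 ^ loops d e • mat (d.concat e) := by
  classical
  ext x z
  rw [Matrix.mul_apply, Matrix.smul_apply]
  have hAB : ∀ y : Fin j → Bool,
      ((∀ p, Sum.elim x y (d.partner p) = Sum.elim x y p) ∧
        (∀ p, Sum.elim y z (e.partner p) = Sum.elim y z p)) ↔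
      ∀ v w, connected d e v w →
        Sum.elim x (Sum.elim y z) v = Sum.elim x (Sum.elim y z) w := by
    intro y
    have hl : ∀ p, Sum.elim x (Sum.elim y z) (lowerDot p) = Sum.elim x y p := by
      rintro (a | b) <;> rfl
    constructor
    · rintro ⟨h1, h2⟩ v w h
      change Relation.EqvGen _ v w at h
      induction h with
      | rel v w h =>
        cases h with
        | lower p => rw [hl, hl, h1]
        | upper p => exact (h2 p).symm
      | refl v => rfl
      | symm v w _ ih => exact ih.symm
      | trans u v w _ _ ih1 ih2 => exact ih1.trans ih2
    · intro h
      refine ⟨fun p => ?_, fun p => ?_⟩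
      · rw [← hl, ← hl]; exact (h _ _ (connected_lower d e p)).symm
      · exact (h _ _ (connected_upper d e p)).symm
  have ho : ∀ (y : Fin j → Bool) p,
      Sum.elim x (Sum.elim y z) (outerDot p) = Sum.elim x z p := by
    rintro y (a | b) <;> rfl
  have hsum : ∑ y, mat d x y * mat e y z =
      Nat.card {y : Fin j → Bool // ∀ v w, connected d e v w →
        Sum.elim x (Sum.elim y z) v = Sum.elim x (Sum.elim y z) w} := by
    rw [Nat.card_eq_fintype_card, Fintype.card_subtype, Finset.card_filter]
    refine Finset.sum_congr rfl fun y _ => ?_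
    simp only [mat, ← hAB, ite_and, mul_ite, mul_one, mul_zero]
    split_ifs <;> rfl
  rw [hsum]
  by_cases hu : ∀ p, Sum.elim x z ((d.concat e).partner p) = Sum.elim x z p
  · rw [show mat (d.concat e) x z = 1 from if_pos hu, smul_eq_mul, mul_one]
    have hu' : ∀ p q, connected d e (outerDot p) (outerDot q) → Sum.elim x z p = Sum.elim x z q := by
      intro p q h
      by_cases hqp : q = p
      · rw [hqp]
      · rw [eq_concatPartner hqp h]; exact (hu p).symm
    let Φ : {y : Fin j → Bool // ∀ v w, connected d e v w →
        Sum.elim x (Sum.elim y z) v = Sum.elim x (Sum.elim y z) w} →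
        ({c : Quotient (connected d e) // ∀ p, c ≠ Quotient.mk _ (outerDot p)} → Bool) :=
      fun y c => Quotient.lift (Sum.elim x (Sum.elim y.1 z)) y.2 c.1
    have hΦ : Function.Bijective Φ := by
      constructor
      · intro y y' h
        apply Subtype.ext
        funext b
        by_cases hc : ∀ p, Quotient.mk (connected d e) (.inr (.inl b)) ≠ Quotient.mk _ (outerDot p)
        · exact congrFun h ⟨_, hc⟩
        · push Not at hc
          obtain ⟨p, hp⟩ := hc
          have hp := Quotient.exact hp
          have h1 := y.2 _ _ hp
          have h2 := y'.2 _ _ hp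
          rw [ho] at h1 h2
          exact h1.trans h2.symm
      · intro F
        let G : Quotient (connected d e) → Bool := fun c =>
          if h : ∀ p, c ≠ Quotient.mk _ (outerDot p) then F ⟨c, h⟩
          else Sum.elim x z (not_forall_not.1 h).choose
        have hG : ∀ p, G (Quotient.mk _ (outerDot p)) = Sum.elim x z p := by
          intro p
          have h : ¬ ∀ q, (Quotient.mk (connected d e) (outerDot p)) ≠ Quotient.mk _ (outerDot q) :=
            fun h => h p rfl
          simp only [G]
          rw [dif_neg h]
          exact (hu' _ _ (Quotient.exact (not_forall_not.1 h).choose_spec)).symm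
        have hw : ∀ v, Sum.elim x (Sum.elim (fun b => G (Quotient.mk _ (.inr (.inl b)))) z) v =
            G (Quotient.mk _ v) := by
          rintro (a | b | c)
          · exact (hG (.inl a)).symm
          · rfl
          · exact (hG (.inr c)).symm
        refine ⟨⟨fun b => G (Quotient.mk _ (.inr (.inl b))), fun v w h => ?_⟩, ?_⟩
        · rw [hw, hw, Quotient.sound h]
        · funext ⟨c, hc⟩
          induction c using Quotient.inductionOn with
          | h v =>
            refine (hw v).trans ?_
            simp only [G]
            rw [dif_pos hc]
    rw [Nat.card_congr (Equiv.ofBijective Φ hΦ), Nat.card_fun]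
    simp [loops]
  · rw [show mat (d.concat e) x z = 0 from if_neg hu, smul_zero]
    have : IsEmpty {y : Fin j → Bool // ∀ v w, connected d e v w →
        Sum.elim x (Sum.elim y z) v = Sum.elim x (Sum.elim y z) w} := by
      constructor
      rintro ⟨y, hy⟩
      apply hu
      intro p
      rw [← ho y, ← ho y]
      exact (hy _ _ (connected_concatPartner d e p)).symm
    exact Nat.card_of_isEmpty

theorem mat_injective : Function.Injective (mat : Diagram i j → _) := by
  classical
  intro d e h
  ext1
  funext p
  let v : Fin i ⊕ Fin j → Bool := fun q => decide (q = p ∨ q = d.partner p)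
  have hv : Sum.elim (fun a => v (.inl a)) (fun b => v (.inr b)) = v := by
    funext q; rcases q with a | b <;> rfl
  have h1 : mat d (fun a => v (.inl a)) (fun b => v (.inr b)) = 1 := by
    refine if_pos fun q => ?_
    rw [hv]
    simp only [v, decide_eq_decide]
    constructor
    · rintro (h | h)
      · exact Or.inr (by rw [← h, d.partner_partner])
      · exact Or.inl (by rw [← d.partner_partner q, h, d.partner_partner])
    · rintro (rfl | rfl)
      · exact Or.inr rfl
      · exact Or.inl (d.partner_partner _)
  rw [h] at h1
  have h2 : ∀ q, v (e.partner q) = v q := by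
    by_contra h3
    rw [← hv] at h3
    exact absurd (h1.symm.trans (if_neg h3)) one_ne_zero
  have h4 := h2 p
  simp only [v, true_or, decide_true, decide_eq_true_eq] at h4
  exact (h4.resolve_left (e.partner_ne p)).symm

theorem mat_true (d : Diagram i j) : mat d (fun _ => true) (fun _ => true) = 1 := by
  refine if_pos fun p => ?_
  have : ∀ q : Fin i ⊕ Fin j,
      Sum.elim (fun _ : Fin i => true) (fun _ : Fin j => true) q = true := by
    rintro (a | b) <;> rfl
  rw [this, this]

theorem eq_of_smul_mat {a b : ℕ} {d e : Diagram i j} (h : 2 ^ a • mat d = 2 ^ b • mat e) :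
    a = b ∧ d = e := by
  have h1 := congrFun (congrFun h (fun _ => true)) (fun _ => true)
  rw [Matrix.smul_apply, Matrix.smul_apply, mat_true, mat_true, smul_eq_mul, smul_eq_mul, mul_one,
    mul_one] at h1
  have hab : a = b := Nat.pow_right_injective le_rfl h1
  subst hab
  refine ⟨rfl, mat_injective ?_⟩
  ext x y
  have := congrFun (congrFun h x) y
  simpa using this

theorem concat_assoc' (d : Diagram i j) (e : Diagram j k) (f : Diagram k m) :
    loops d e + loops (d.concat e) f = loops e f + loops d (e.concat f) ∧
      (d.concat e).concat f = d.concat (e.concat f) := by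
  apply eq_of_smul_mat
  rw [pow_add, pow_add, mul_smul, mul_smul, ← mat_concat, ← mat_concat, ← Matrix.smul_mul,
    ← mat_concat, ← Matrix.mul_smul, ← mat_concat, Matrix.mul_assoc]

theorem mat_vertical (h : i = j) (x : Fin i → Bool) (y : Fin j → Bool) :
    mat (vertical h) x y = if x = y ∘ Fin.cast h then 1 else 0 := by
  unfold mat
  congr 1
  rw [eq_iff_iff, Sum.forall, funext_iff]
  subst h
  simp only [vertical, Sum.elim_inl, Sum.elim_inr, Function.comp, Fin.cast_eq_self]
  exact ⟨fun h => h.2, fun h => ⟨fun a => (h a).symm, h⟩⟩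

theorem mat_vertical_rfl : mat (vertical (rfl : i = i)) = 1 := by
  ext x y
  rw [mat_vertical, Matrix.one_apply]
  rfl

theorem mat_vertical_self (x y : Fin i → Bool) :
    mat (vertical rfl) x y = if x = y then 1 else 0 := by
  rw [mat_vertical]; rfl

theorem vertical_concat' (d : Diagram i j) :
    loops (vertical rfl) d = 0 ∧ (vertical rfl).concat d = d := by
  apply eq_of_smul_mat
  rw [← mat_concat, mat_vertical_rfl, Matrix.one_mul, pow_zero, one_smul]

theorem concat_vertical' (d : Diagram i j) :
    loops d (vertical rfl) = 0 ∧ d.concat (vertical rfl) = d := by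
  apply eq_of_smul_mat
  rw [← mat_concat, mat_vertical_rfl, Matrix.mul_one, pow_zero, one_smul]

theorem loops_vertical_left (h : i = j) (d : Diagram j k) : loops (vertical h) d = 0 := by
  subst h; exact (vertical_concat' d).1

theorem loops_vertical_right (h : j = k) (d : Diagram i j) : loops d (vertical h) = 0 := by
  subst h; exact (concat_vertical' d).1

theorem mat_vertical_concat (h : i = j) (d : Diagram j k) (x : Fin i → Bool) (z : Fin k → Bool) :
    mat ((vertical h).concat d) x z = mat d (x ∘ Fin.cast h.symm) z := by
  subst h; rw [(vertical_concat' d).2]; rfl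

theorem mat_concat_vertical (h : j = k) (d : Diagram i j) (x : Fin i → Bool) (z : Fin k → Bool) :
    mat (d.concat (vertical h)) x z = mat d x (z ∘ Fin.cast h) := by
  subst h; rw [(concat_vertical' d).2]; rfl

theorem vertical_concat_vertical (h : i = j) (h' : j = k) :
    (vertical h).concat (vertical h') = vertical (h.trans h') := by
  subst h; exact (vertical_concat' _).2

variable {i' j' k' i'' j'' : ℕ}

theorem mat_juxtapose (d : Diagram i j) (e : Diagram i' j') (x : Fin (i + i') → Bool)
    (y : Fin (j + j') → Bool) :
    mat (d.juxtapose e) x y = mat d (x ∘ Fin.castAdd i') (y ∘ Fin.castAdd j') *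
      mat e (x ∘ Fin.natAdd i) (y ∘ Fin.natAdd j) := by
  have h1 : ∀ p, Sum.elim x y (juxtaposeDots i j i' j' (.inl p)) =
      Sum.elim (x ∘ Fin.castAdd i') (y ∘ Fin.castAdd j') p := by rintro (a | b) <;> rfl
  have h2 : ∀ p, Sum.elim x y (juxtaposeDots i j i' j' (.inr p)) =
      Sum.elim (x ∘ Fin.natAdd i) (y ∘ Fin.natAdd j) p := by rintro (a | b) <;> rfl
  simp only [mat]
  rw [indicator_mul]
  congr 1
  rw [eq_iff_iff, ← (juxtaposeDots i j i' j').forall_congr_right, Sum.forall]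
  simp only [juxtapose, Equiv.symm_apply_apply, Sum.map_inl, Sum.map_inr, h1, h2]

theorem juxtapose_concat' (d : Diagram i j) (d' : Diagram i' j') (e : Diagram j k)
    (e' : Diagram j' k') :
    loops (d.juxtapose d') (e.juxtapose e') = loops d e + loops d' e' ∧
      (d.juxtapose d').concat (e.juxtapose e') = (d.concat e).juxtapose (d'.concat e') := by
  apply eq_of_smul_mat
  rw [← mat_concat]
  ext x z
  rw [Matrix.mul_apply, Matrix.smul_apply, mat_juxtapose, ← (Fin.appendEquiv j j').sum_comp,
    Fintype.sum_prod_type]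
  have e1 := congrFun (congrFun (mat_concat d e) (x ∘ Fin.castAdd i')) (z ∘ Fin.castAdd k')
  have e2 := congrFun (congrFun (mat_concat d' e') (x ∘ Fin.natAdd i)) (z ∘ Fin.natAdd k)
  rw [Matrix.mul_apply, Matrix.smul_apply, smul_eq_mul] at e1 e2
  rw [smul_eq_mul, pow_add, mul_mul_mul_comm, ← e1, ← e2, Finset.sum_mul_sum]
  refine Finset.sum_congr rfl fun y _ => Finset.sum_congr rfl fun y' _ => ?_
  have a1 : Fin.append y y' ∘ Fin.castAdd j' = y := by funext a; simp
  have a2 : Fin.append y y' ∘ Fin.natAdd j = y' := by funext a; simp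
  rw [mat_juxtapose, mat_juxtapose]
  simp only [Fin.appendEquiv, Equiv.coe_fn_mk, a1, a2]
  ring

theorem vertical_juxtapose_vertical (h : i = j) (h' : i' = j') :
    (vertical h).juxtapose (vertical h') = vertical (by rw [h, h']) := by
  subst h h'
  apply mat_injective
  ext x y
  rw [mat_juxtapose, mat_vertical_self, mat_vertical_self, mat_vertical_self]
  rw [indicator_mul]
  congr 1
  rw [eq_iff_iff]
  constructor
  · rintro ⟨h1, h2⟩
    funext a
    induction a using Fin.addCases with
    | left a => exact congrFun h1 a
    | right a => exact congrFun h2 a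
  · rintro rfl; exact ⟨rfl, rfl⟩

theorem juxtapose_assoc' (d : Diagram i j) (d' : Diagram i' j') (d'' : Diagram i'' j'') :
    ((d.juxtapose d').juxtapose d'').concat (vertical (Nat.add_assoc j j' j'')) =
      (vertical (Nat.add_assoc i i' i'')).concat (d.juxtapose (d'.juxtapose d'')) := by
  apply mat_injective
  ext x y
  rw [mat_concat_vertical, mat_vertical_concat]
  simp only [mat_juxtapose, mul_assoc]
  congr 2
  congr 1
  · funext a; simp only [Function.comp]; congr 1; ext; simp; omega
  · funext a; simp only [Function.comp]; congr 1; ext; simp; omega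

theorem vertical_zero_juxtapose (d : Diagram i j) :
    ((vertical (rfl : 0 = 0)).juxtapose d).concat (vertical (Nat.zero_add j)) =
      (vertical (Nat.zero_add i)).concat d := by
  apply mat_injective
  ext x y
  rw [mat_concat_vertical, mat_vertical_concat, mat_juxtapose, mat_vertical_self,
    Subsingleton.elim (x ∘ Fin.castAdd i) ((y ∘ Fin.cast (Nat.zero_add j)) ∘ Fin.castAdd j),
    if_pos rfl, one_mul]
  congr 1
  · funext a; simp only [Function.comp]; congr 1; ext; simp
  · funext a; simp only [Function.comp]; congr 1; ext; simp

theorem juxtapose_vertical_zero (d : Diagram i j) :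
    (d.juxtapose (vertical (rfl : 0 = 0))).concat (vertical (Nat.add_zero j)) =
      (vertical (Nat.add_zero i)).concat d := by
  apply mat_injective
  ext x y
  rw [mat_concat_vertical, mat_vertical_concat, mat_juxtapose, mat_vertical_self,
    Subsingleton.elim (x ∘ Fin.natAdd i) ((y ∘ Fin.cast (Nat.add_zero j)) ∘ Fin.natAdd j),
    if_pos rfl, mul_one]
  rfl

theorem mat_cups (n : ℕ) (x : Fin 0 → Bool) (y y' : Fin n → Bool) :
    mat (cups n) x (Fin.append y y') = if y = y' ∘ Fin.rev then 1 else 0 := by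
  unfold mat
  congr 1
  rw [eq_iff_iff, Sum.forall, funext_iff]
  have h1 : ∀ a : Fin n, (Fin.castAdd n a).rev = Fin.natAdd n a.rev := by
    intro a; ext; simp; omega
  have h2 : ∀ a : Fin n, (Fin.natAdd n a).rev = Fin.castAdd n a.rev := by
    intro a; ext; simp; omega
  simp only [IsEmpty.forall_iff, true_and, cups, Sum.elim_inr, Fin.forall_fin_add, h1, h2,
    Fin.append_left, Fin.append_right, Function.comp]
  exact ⟨fun h a => (h.1 a).symm, fun h => ⟨fun a => (h a).symm, fun a => by rw [h, Fin.rev_rev]⟩⟩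

theorem mat_caps (n : ℕ) (x x' : Fin n → Bool) (y : Fin 0 → Bool) :
    mat (caps n) (Fin.append x x') y = if x = x' ∘ Fin.rev then 1 else 0 := by
  unfold mat
  congr 1
  rw [eq_iff_iff, Sum.forall, funext_iff]
  have h1 : ∀ a : Fin n, (Fin.castAdd n a).rev = Fin.natAdd n a.rev := by
    intro a; ext; simp; omega
  have h2 : ∀ a : Fin n, (Fin.natAdd n a).rev = Fin.castAdd n a.rev := by
    intro a; ext; simp; omega
  simp only [IsEmpty.forall_iff, and_true, caps, Sum.elim_inl, Fin.forall_fin_add, h1, h2,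
    Fin.append_left, Fin.append_right, Function.comp]
  exact ⟨fun h a => (h.1 a).symm, fun h => ⟨fun a => (h a).symm, fun a => by rw [h, Fin.rev_rev]⟩⟩

theorem zigzag' (n : ℕ) :
    loops ((vertical rfl).juxtapose (cups n))
        ((vertical (Nat.add_assoc n n n).symm).concat ((caps n).juxtapose (vertical rfl))) = 0 ∧
      ((vertical rfl).juxtapose (cups n)).concat
        ((vertical (Nat.add_assoc n n n).symm).concat ((caps n).juxtapose (vertical rfl))) =
      vertical ((Nat.add_zero n).trans (Nat.zero_add n).symm) := by
  apply eq_of_smul_mat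
  rw [← mat_concat, pow_zero, one_smul]
  ext x z
  rw [Matrix.mul_apply, mat_vertical, ← (Fin.appendEquiv n (n + n)).sum_comp,
    Fintype.sum_prod_type]
  have step : ∀ y1 : Fin n → Bool, ∑ y, mat ((vertical rfl).juxtapose (cups n)) x
        (Fin.append y1 y) * mat ((vertical (Nat.add_assoc n n n).symm).concat
        ((caps n).juxtapose (vertical rfl))) (Fin.append y1 y) z =
      if x ∘ Fin.castAdd 0 = y1 then (if y1 = z ∘ Fin.natAdd 0 then 1 else 0) else 0 := by
    intro y1
    rw [← (Fin.appendEquiv n n).sum_comp, Fintype.sum_prod_type]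
    have : ∀ y2 y3 : Fin n → Bool, mat ((vertical rfl).juxtapose (cups n)) x
        (Fin.append y1 (Fin.append y2 y3)) * mat ((vertical (Nat.add_assoc n n n).symm).concat
        ((caps n).juxtapose (vertical rfl))) (Fin.append y1 (Fin.append y2 y3)) z =
        if x ∘ Fin.castAdd 0 = y1 then (if y2 = y3 ∘ Fin.rev then (if y1 = y2 ∘ Fin.rev then
          (if y3 = z ∘ Fin.natAdd 0 then 1 else 0) else 0) else 0) else 0 := by
      intro y2 y3
      have a1 : Fin.append y1 (Fin.append y2 y3) ∘ Fin.castAdd (n + n) = y1 := by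
        funext a; simp
      have a2 : Fin.append y1 (Fin.append y2 y3) ∘ Fin.natAdd n = Fin.append y2 y3 := by
        funext a; simp
      have a3 : Fin.append y1 (Fin.append y2 y3) ∘ Fin.cast (Nat.add_assoc n n n) =
          Fin.append (Fin.append y1 y2) y3 := (Fin.append_assoc y1 y2 y3).symm
      have a4 : Fin.append (Fin.append y1 y2) y3 ∘ Fin.castAdd n = Fin.append y1 y2 := by
        funext a; simp
      have a5 : Fin.append (Fin.append y1 y2) y3 ∘ Fin.natAdd (n + n) = y3 := by
        funext a; simp
      rw [mat_vertical_concat, mat_juxtapose, mat_juxtapose, a1, a2, a3, a4, a5, mat_cups, mat_caps,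
        mat_vertical_self, mat_vertical_self]
      split_ifs <;> rfl
    simp only [Fin.appendEquiv, Equiv.coe_fn_mk, this]
    split_ifs with h1 h2
    · rw [Finset.sum_eq_single (y1 ∘ Fin.rev)]
      · rw [Finset.sum_eq_single y1]
        · rw [if_pos rfl, if_pos (by funext a; simp), if_pos h2]
        · intro y3 _ h
          rw [if_neg]
          intro h'
          apply h
          funext a
          simpa using (congrFun h' a.rev).symm
        · simp
      · intro y2 _ h
        apply Finset.sum_eq_zero
        intro y3 _
        rw [if_neg (c := y1 = y2 ∘ Fin.rev), ite_self]
        rintro rfl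
        exact h (by funext a; simp)
      · simp
    · apply Finset.sum_eq_zero; intro y2 _
      apply Finset.sum_eq_zero; intro y3 _
      split_ifs with h3 h4 h5
      · exact absurd (by rw [h4, h3, ← h5]; funext a; simp) h2
      all_goals rfl
    · simp
  simp only [Fin.appendEquiv, Equiv.coe_fn_mk, step]
  rw [Finset.sum_ite_eq, if_pos (Finset.mem_univ _)]
  congr 1
  rw [eq_iff_iff]
  constructor
  · intro h
    funext a
    have := congrFun h a
    simp only [Function.comp] at this ⊢
    refine this.trans (congrArg z ?_)
    ext; simp
  · rintro rfl
    funext a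
    simp only [Function.comp]
    congr 1
    ext; simp

theorem zigzag'' (n : ℕ) :
    loops ((cups n).juxtapose (vertical rfl))
        ((vertical (Nat.add_assoc n n n)).concat ((vertical rfl).juxtapose (caps n))) = 0 ∧
      ((cups n).juxtapose (vertical rfl)).concat
        ((vertical (Nat.add_assoc n n n)).concat ((vertical rfl).juxtapose (caps n))) =
      vertical ((Nat.zero_add n).trans (Nat.add_zero n).symm) := by
  apply eq_of_smul_mat
  rw [← mat_concat, pow_zero, one_smul]
  ext x z
  rw [Matrix.mul_apply, mat_vertical, ← (Fin.appendEquiv (n + n) n).sum_comp,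
    Fintype.sum_prod_type_right]
  have step : ∀ y3 : Fin n → Bool, ∑ y, mat ((cups n).juxtapose (vertical rfl)) x
        (Fin.append y y3) * mat ((vertical (Nat.add_assoc n n n)).concat
        ((vertical rfl).juxtapose (caps n))) (Fin.append y y3) z =
      if x ∘ Fin.natAdd 0 = y3 then (if y3 = z ∘ Fin.castAdd 0 then 1 else 0) else 0 := by
    intro y3
    rw [← (Fin.appendEquiv n n).sum_comp, Fintype.sum_prod_type_right]
    have : ∀ y1 y2 : Fin n → Bool, mat ((cups n).juxtapose (vertical rfl)) x
        (Fin.append (Fin.append y1 y2) y3) * mat ((vertical (Nat.add_assoc n n n)).concat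
        ((vertical rfl).juxtapose (caps n))) (Fin.append (Fin.append y1 y2) y3) z =
        if x ∘ Fin.natAdd 0 = y3 then (if y2 = y3 ∘ Fin.rev then (if y1 = y2 ∘ Fin.rev then
          (if y1 = z ∘ Fin.castAdd 0 then 1 else 0) else 0) else 0) else 0 := by
      intro y1 y2
      have a1 : Fin.append y1 (Fin.append y2 y3) ∘ Fin.castAdd (n + n) = y1 := by
        funext a; simp
      have a2 : Fin.append y1 (Fin.append y2 y3) ∘ Fin.natAdd n = Fin.append y2 y3 := by
        funext a; simp
      have a3 : Fin.append (Fin.append y1 y2) y3 ∘ Fin.cast (Nat.add_assoc n n n).symm =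
          Fin.append y1 (Fin.append y2 y3) := by
        rw [Fin.append_assoc]; funext a; simp [Function.comp]
      have a4 : Fin.append (Fin.append y1 y2) y3 ∘ Fin.castAdd n = Fin.append y1 y2 := by
        funext a; simp
      have a5 : Fin.append (Fin.append y1 y2) y3 ∘ Fin.natAdd (n + n) = y3 := by
        funext a; simp
      rw [mat_vertical_concat, mat_juxtapose, mat_juxtapose, a3, a1, a2, a4, a5, mat_cups, mat_caps,
        mat_vertical_self, mat_vertical_self]
      split_ifs <;> rfl
    simp only [Fin.appendEquiv, Equiv.coe_fn_mk, this]
    split_ifs with h1 h2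
    · rw [Finset.sum_eq_single (y3 ∘ Fin.rev)]
      · rw [Finset.sum_eq_single y3]
        · rw [if_pos rfl, if_pos (by funext a; simp), if_pos h2]
        · intro y1 _ h
          rw [if_pos rfl, if_neg]
          rintro rfl
          exact h (by funext a; simp)
        · simp
      · intro y2 _ h
        apply Finset.sum_eq_zero
        intro y1 _
        rw [if_neg h]
      · simp
    · apply Finset.sum_eq_zero; intro y2 _
      apply Finset.sum_eq_zero; intro y1 _
      split_ifs with h3 h4 h5
      · exact absurd (by rw [← h5, h4, h3]; funext a; simp) h2
      all_goals rfl
    · simp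
  simp only [Fin.appendEquiv, Equiv.coe_fn_mk, step]
  rw [Finset.sum_ite_eq, if_pos (Finset.mem_univ _)]
  congr 1
  rw [eq_iff_iff]
  constructor
  · intro h
    funext a
    have := congrFun h (Fin.cast (Nat.zero_add n) a)
    simp only [Function.comp] at this ⊢
    refine (congrArg x ?_).trans (this.trans (congrArg z ?_)) <;> ext <;> simp
  · rintro rfl
    funext a
    simp only [Function.comp]
    congr 1
    ext; simp

end Matrices

/-! ### The Temperley–Lieb category -/

section Linear

variable {R : Type*} [CommRing R] {i j k i' j' k' : ℕ}

/-- Composition of linear combinations of diagrams: the composite of two diagrams is their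
concatenation multiplied with `δ` for every closed loop. -/
noncomputable def comp (δ : R) :
    (Diagram i j →₀ R) →ₗ[R] (Diagram j k →₀ R) →ₗ[R] (Diagram i k →₀ R) :=
  Finsupp.linearCombination R fun d => Finsupp.linearCombination R fun e =>
    Finsupp.single (d.concat e) (δ ^ loops d e)

/-- Tensor product of linear combinations of diagrams, extending the juxtaposition. -/
noncomputable def tensor (R : Type*) [CommRing R] {i j i' j' : ℕ} : (Diagram i j →₀ R) →ₗ[R]
    (Diagram i' j' →₀ R) →ₗ[R] (Diagram (i + i') (j + j') →₀ R) :=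
  Finsupp.linearCombination R fun d => Finsupp.linearCombination R fun e =>
    Finsupp.single (d.juxtapose e) 1

theorem comp_single (δ : R) (d : Diagram i j) (e : Diagram j k) (a b : R) :
    comp δ (Finsupp.single d a) (Finsupp.single e b) =
      Finsupp.single (d.concat e) (a * b * δ ^ loops d e) := by
  rw [comp, Finsupp.linearCombination_single, LinearMap.smul_apply,
    Finsupp.linearCombination_single, Finsupp.smul_single, Finsupp.smul_single, smul_eq_mul,
    smul_eq_mul, mul_assoc]

theorem tensor_single (d : Diagram i j) (e : Diagram i' j') (a b : R) :
    tensor R (Finsupp.single d a) (Finsupp.single e b) =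
      Finsupp.single (d.juxtapose e) (a * b) := by
  rw [tensor, Finsupp.linearCombination_single, LinearMap.smul_apply,
    Finsupp.linearCombination_single, Finsupp.smul_single, Finsupp.smul_single, smul_eq_mul,
    smul_eq_mul, mul_one]

theorem comp_assoc {m : ℕ} (δ : R) (f : Diagram i j →₀ R) (g : Diagram j k →₀ R)
    (h : Diagram k m →₀ R) : comp δ (comp δ f g) h = comp δ f (comp δ g h) := by
  induction f using Finsupp.induction_linear with
  | zero => simp
  | add f f' h1 h2 => simp [h1, h2]
  | single d a =>
  induction g using Finsupp.induction_linear with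
  | zero => simp
  | add f f' h1 h2 => simp [h1, h2]
  | single e b =>
  induction h using Finsupp.induction_linear with
  | zero => simp
  | add f f' h1 h2 => simp [h1, h2]
  | single f c =>
  obtain ⟨h1, h2⟩ := concat_assoc' d e f
  rw [comp_single, comp_single, comp_single, comp_single, h2]
  congr 1
  have := congrArg (δ ^ ·) h1
  simp only [pow_add] at this
  linear_combination a * b * c * this

theorem id_comp (δ : R) (f : Diagram i j →₀ R) :
    comp δ (Finsupp.single (.vertical rfl) 1) f = f := by
  induction f using Finsupp.induction_linear with
  | zero => simp
  | add f f' h1 h2 => simp [h1, h2]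
  | single d a => simp [comp_single, vertical_concat']

theorem comp_id (δ : R) (f : Diagram i j →₀ R) :
    comp δ f (Finsupp.single (.vertical rfl) 1) = f := by
  induction f using Finsupp.induction_linear with
  | zero => simp
  | add f f' h1 h2 => simp [h1, h2]
  | single d a => simp [comp_single, concat_vertical']

theorem vertical_comp_vertical (δ : R) (h : i = j) (h' : j = k) :
    comp δ (Finsupp.single (.vertical h) 1) (Finsupp.single (.vertical h') 1) =
      Finsupp.single (.vertical (h.trans h')) 1 := by
  simp [comp_single, loops_vertical_left, vertical_concat_vertical]

theorem vertical_tensor_vertical (h : i = j) (h' : i' = j') :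
    tensor R (Finsupp.single (.vertical h) 1) (Finsupp.single (.vertical h') 1) =
      Finsupp.single (.vertical (by rw [h, h'])) 1 := by
  simp [tensor_single, vertical_juxtapose_vertical]

theorem tensor_comp (δ : R) (f : Diagram i j →₀ R) (f' : Diagram i' j' →₀ R)
    (g : Diagram j k →₀ R) (g' : Diagram j' k' →₀ R) :
    comp δ (tensor R f f') (tensor R g g') = tensor R (comp δ f g) (comp δ f' g') := by
  induction f using Finsupp.induction_linear with
  | zero => simp
  | add f f' h1 h2 => simp [h1, h2]
  | single d a =>
  induction f' using Finsupp.induction_linear with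
  | zero => simp
  | add f f' h1 h2 => simp [h1, h2]
  | single d' a' =>
  induction g using Finsupp.induction_linear with
  | zero => simp
  | add f f' h1 h2 => simp [h1, h2]
  | single e b =>
  induction g' using Finsupp.induction_linear with
  | zero => simp
  | add f f' h1 h2 => simp [h1, h2]
  | single e' b' =>
  obtain ⟨h1, h2⟩ := juxtapose_concat' d d' e e'
  rw [tensor_single, tensor_single, comp_single, comp_single, comp_single, tensor_single, h1, h2]
  congr 1
  ring

theorem tensor_assoc {i'' j'' : ℕ} (δ : R) (f : Diagram i j →₀ R) (g : Diagram i' j' →₀ R)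
    (h : Diagram i'' j'' →₀ R) :
    comp δ (tensor R (tensor R f g) h) (Finsupp.single (.vertical (Nat.add_assoc j j' j'')) 1) =
      comp δ (Finsupp.single (.vertical (Nat.add_assoc i i' i'')) 1)
        (tensor R f (tensor R g h)) := by
  induction f using Finsupp.induction_linear with
  | zero => simp
  | add f f' h1 h2 => simp [h1, h2]
  | single d a =>
  induction g using Finsupp.induction_linear with
  | zero => simp
  | add f f' h1 h2 => simp [h1, h2]
  | single e b =>
  induction h using Finsupp.induction_linear with
  | zero => simp
  | add f f' h1 h2 => simp [h1, h2]
  | single f c =>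
  simp only [tensor_single, comp_single, juxtapose_assoc', loops_vertical_left,
    loops_vertical_right]
  congr 1
  ring

theorem unit_tensor (δ : R) (f : Diagram i j →₀ R) :
    comp δ (tensor R (Finsupp.single (.vertical (rfl : 0 = 0)) 1) f)
        (Finsupp.single (.vertical (Nat.zero_add j)) 1) =
      comp δ (Finsupp.single (.vertical (Nat.zero_add i)) 1) f := by
  induction f using Finsupp.induction_linear with
  | zero => simp
  | add f f' h1 h2 => simp [h1, h2]
  | single d a =>
  simp [tensor_single, comp_single, vertical_zero_juxtapose, loops_vertical_left,
    loops_vertical_right]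

theorem tensor_unit (δ : R) (f : Diagram i j →₀ R) :
    comp δ (tensor R f (Finsupp.single (.vertical (rfl : 0 = 0)) 1))
        (Finsupp.single (.vertical (Nat.add_zero j)) 1) =
      comp δ (Finsupp.single (.vertical (Nat.add_zero i)) 1) f := by
  induction f using Finsupp.induction_linear with
  | zero => simp
  | add f f' h1 h2 => simp [h1, h2]
  | single d a =>
  rw [tensor_single, comp_single, comp_single, juxtapose_vertical_zero, loops_vertical_left,
    loops_vertical_right, mul_one, mul_one, one_mul]

theorem zigzag_left (δ : R) (n : ℕ) :
    comp δ (tensor R (Finsupp.single (.vertical rfl) 1) (Finsupp.single (.cups n) 1))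
        (comp δ (Finsupp.single (.vertical (Nat.add_assoc n n n).symm) 1)
          (tensor R (Finsupp.single (.caps n) 1) (Finsupp.single (.vertical rfl) 1))) =
      comp δ (Finsupp.single (.vertical (Nat.add_zero n)) 1)
        (Finsupp.single (.vertical (Nat.zero_add n).symm) 1) := by
  rw [vertical_comp_vertical, tensor_single, tensor_single, comp_single, comp_single,
    (zigzag' n).1, (zigzag' n).2, loops_vertical_left]
  simp only [pow_zero, mul_one]

theorem zigzag_right (δ : R) (n : ℕ) :
    comp δ (tensor R (Finsupp.single (.cups n) 1) (Finsupp.single (.vertical rfl) 1))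
        (comp δ (Finsupp.single (.vertical (Nat.add_assoc n n n)) 1)
          (tensor R (Finsupp.single (.vertical rfl) 1) (Finsupp.single (.caps n) 1))) =
      comp δ (Finsupp.single (.vertical (Nat.zero_add n)) 1)
        (Finsupp.single (.vertical (Nat.add_zero n).symm) 1) := by
  rw [vertical_comp_vertical, tensor_single, tensor_single, comp_single, comp_single,
    (zigzag'' n).1, (zigzag'' n).2, loops_vertical_left]
  simp only [pow_zero, mul_one]

end Linear

/-- The Temperley–Lieb category with loop parameter `δ`. Its objects are the natural numbers. -/
@[ext] structure TLCat {R : Type*} (δ : R) where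
  /-- the number of dots -/
  dots : ℕ

namespace TLCat

universe u

variable {R : Type u} [CommRing R] {δ : R}

/-- Morphisms `i ⟶ j` are linear combinations of planar `(i, j)`-diagrams. The composite `f ≫ g`
puts `g` on top of `f`. -/
noncomputable instance : Category.{u} (TLCat δ) where
  Hom X Y := Diagram X.dots Y.dots →₀ R
  id _ := Finsupp.single (.vertical rfl) 1
  comp f g := TemperleyLieb.comp δ f g
  id_comp f := TemperleyLieb.id_comp δ f
  comp_id f := TemperleyLieb.comp_id δ f
  assoc f g h := TemperleyLieb.comp_assoc δ f g h

noncomputable instance : Preadditive (TLCat δ) where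
  homGroup X Y := inferInstanceAs (AddCommGroup (Diagram X.dots Y.dots →₀ R))
  add_comp _ _ _ f f' g := LinearMap.map_add₂ (TemperleyLieb.comp δ) f f' g
  comp_add _ _ _ f := LinearMap.map_add (TemperleyLieb.comp δ f)

noncomputable instance : Linear R (TLCat δ) where
  homModule X Y := inferInstanceAs (Module R (Diagram X.dots Y.dots →₀ R))
  smul_comp _ _ _ r f g := LinearMap.map_smul₂ (TemperleyLieb.comp δ) r f g
  comp_smul _ _ _ f r := LinearMap.map_smul (TemperleyLieb.comp δ f) r

/-- A diagram, as a morphism. -/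
noncomputable def ofDiagram {X Y : TLCat δ} (d : Diagram X.dots Y.dots) : X ⟶ Y :=
  (Finsupp.single d 1 : Diagram X.dots Y.dots →₀ R)

/-- Objects with equally many dots are equal; the identity morphism between them. -/
noncomputable def eqIso {X Y : TLCat δ} (h : X.dots = Y.dots) : X ≅ Y where
  hom := ofDiagram (.vertical h)
  inv := ofDiagram (.vertical h.symm)
  hom_inv_id := vertical_comp_vertical δ h h.symm
  inv_hom_id := vertical_comp_vertical δ h.symm h

noncomputable instance : MonoidalCategoryStruct (TLCat δ) where
  tensorObj X Y := ⟨X.dots + Y.dots⟩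
  tensorUnit := ⟨0⟩
  tensorHom f g := TemperleyLieb.tensor R f g
  whiskerLeft X _ _ f := TemperleyLieb.tensor R (Finsupp.single (.vertical (rfl : X.dots = _)) 1) f
  whiskerRight f X := TemperleyLieb.tensor R f (Finsupp.single (.vertical (rfl : X.dots = _)) 1)
  associator X Y Z := eqIso (Nat.add_assoc X.dots Y.dots Z.dots)
  leftUnitor X := eqIso (Nat.zero_add X.dots)
  rightUnitor X := eqIso (Nat.add_zero X.dots)

noncomputable instance : MonoidalCategory (TLCat δ) :=
  MonoidalCategory.ofTensorHom
    (id_tensorHom_id := fun _ _ => vertical_tensor_vertical rfl rfl)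
    (id_tensorHom := fun _ _ _ _ => rfl)
    (tensorHom_id := fun _ _ => rfl)
    (tensorHom_comp_tensorHom := fun f₁ f₂ g₁ g₂ => TemperleyLieb.tensor_comp δ f₁ f₂ g₁ g₂)
    (associator_naturality := fun f g h => TemperleyLieb.tensor_assoc δ f g h)
    (leftUnitor_naturality := fun f => TemperleyLieb.unit_tensor δ f)
    (rightUnitor_naturality := fun f => TemperleyLieb.tensor_unit δ f)
    (pentagon := fun W X Y Z => by
      refine (congrArg₂ (fun f g => TemperleyLieb.comp δ f (TemperleyLieb.comp δ _ g))
        (vertical_tensor_vertical _ _) (vertical_tensor_vertical _ _)).trans ?_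
      exact ((congrArg (fun f => TemperleyLieb.comp δ _ f)
        (vertical_comp_vertical δ _ _)).trans (vertical_comp_vertical δ _ _)).trans
        (vertical_comp_vertical δ _ _).symm)
    (triangle := fun X Y =>
      ((congrArg (fun f => TemperleyLieb.comp δ _ f) (vertical_tensor_vertical _ _)).trans
        (vertical_comp_vertical δ _ _)).trans (vertical_tensor_vertical _ _).symm)

noncomputable instance : MonoidalPreadditive (TLCat δ) where
  whiskerLeft_zero := map_zero (TemperleyLieb.tensor R (Finsupp.single (.vertical rfl) 1))
  zero_whiskerRight := LinearMap.map_zero₂ (TemperleyLieb.tensor R) _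
  whiskerLeft_add f g :=
    map_add (TemperleyLieb.tensor R (Finsupp.single (.vertical rfl) 1)) f g
  add_whiskerRight f g := LinearMap.map_add₂ (TemperleyLieb.tensor R) f g _

noncomputable instance : MonoidalLinear R (TLCat δ) where
  whiskerLeft_smul _ _ _ r f :=
    map_smul (TemperleyLieb.tensor R (Finsupp.single (.vertical rfl) 1)) r f
  smul_whiskerRight r _ _ f _ := LinearMap.map_smul₂ (TemperleyLieb.tensor R) r f _

/-- Every object is its own dual, with coevaluation the nested cups and evaluation the
nested caps. -/
noncomputable instance (X : TLCat δ) : ExactPairing X X where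
  coevaluation' := ofDiagram (Diagram.cups X.dots)
  evaluation' := ofDiagram (Diagram.caps X.dots)
  coevaluation_evaluation' := zigzag_left δ X.dots
  evaluation_coevaluation' := zigzag_right δ X.dots

noncomputable instance : LeftRigidCategory (TLCat δ) where
  leftDual X := { leftDual := X }

end TLCat

/-! ### Tensor ideals and negligible morphisms -/

section Ideals

universe v u

variable (C : Type u) [Category.{v} C] [Preadditive C] [MonoidalCategory C]

/-- A left tensor ideal: subgroups of all groups of morphisms, closed under composition with
arbitrary morphisms on both sides and under tensoring with identities from the left. -/
@[ext] structure LeftTensorIdeal where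
  /-- the morphisms `X ⟶ Y` in the ideal -/
  mor : ∀ X Y : C, AddSubgroup (X ⟶ Y)
  comp_mem_right : ∀ {X Y Z : C} (g : X ⟶ Y) (f : Y ⟶ Z), f ∈ mor Y Z → g ≫ f ∈ mor X Z
  comp_mem_left : ∀ {X Y Z : C} (f : X ⟶ Y) (h : Y ⟶ Z), f ∈ mor X Y → f ≫ h ∈ mor X Z
  whiskerLeft_mem : ∀ (Z : C) {X Y : C} (f : X ⟶ Y), f ∈ mor X Y → Z ◁ f ∈ mor (Z ⊗ X) (Z ⊗ Y)

variable {C}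

/-- A tensor ideal is proper if it is neither zero nor the ideal of all morphisms. -/
def LeftTensorIdeal.IsProper (I : LeftTensorIdeal C) : Prop :=
  (∃ (X Y : C) (f : X ⟶ Y), f ∈ I.mor X Y ∧ f ≠ 0) ∧ ∃ (X Y : C) (f : X ⟶ Y), f ∉ I.mor X Y

/-- `I` is the smallest tensor ideal that contains `f`. -/
def LeftTensorIdeal.IsGeneratedBy (I : LeftTensorIdeal C) {X Y : C} (f : X ⟶ Y) : Prop :=
  f ∈ I.mor X Y ∧
    ∀ I' : LeftTensorIdeal C, f ∈ I'.mor X Y → ∀ Z W : C, I.mor Z W ≤ I'.mor Z W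

/-- The trace with respect to a braiding:
`𝟙 ⟶ X* ⊗ X ⟶ X* ⊗ X ⟶ X ⊗ X* ⟶ 𝟙`, by coevaluation, `f`, the braiding, and evaluation. -/
def braidedTrace [BraidedCategory C] [LeftRigidCategory C] {X : C} (f : X ⟶ X) :
    𝟙_ C ⟶ 𝟙_ C :=
  η_ (ᘁX) X ≫ (ᘁX) ◁ f ≫ (β_ (ᘁX) X).hom ≫ ε_ (ᘁX) X

/-- Negligible morphisms with respect to a braiding. -/
def IsBraidedNegligible [BraidedCategory C] [LeftRigidCategory C] {X Y : C} (f : X ⟶ Y) : Prop :=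
  ∀ g : Y ⟶ X, braidedTrace (f ≫ g) = 0

end Ideals

namespace TLCat

universe u

variable {R : Type u} [CommRing R] {δ : R}

/-- The diagrammatic trace: connect the upper dots with the lower dots by lines around the
diagram and evaluate all loops at `δ`. -/
noncomputable def closedTrace {X : TLCat δ} (f : X ⟶ X) : 𝟙_ (TLCat δ) ⟶ 𝟙_ (TLCat δ) :=
  η_ X X ≫ X ◁ f ≫ ε_ X X

/-- Negligible morphisms with respect to the diagrammatic trace. -/
def IsNegligible {X Y : TLCat δ} (f : X ⟶ Y) : Prop :=
  ∀ g : Y ⟶ X, closedTrace (f ≫ g) = 0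

/-- `f` is annihilated on both sides by all diagrams that contain a cup or a cap. -/
def IsAnnihilatedByCupsAndCaps {X : TLCat δ} (f : X ⟶ X) : Prop :=
  ∀ d : Diagram X.dots X.dots, d.HasCup ∨ d.HasCap →
    f ≫ (ofDiagram d : X ⟶ X) = 0 ∧ (ofDiagram d : X ⟶ X) ≫ f = 0

/-- The Jones–Wenzl idempotent: the nonzero idempotent that is annihilated by all diagrams that
contain a cup or a cap. -/
def IsJonesWenzl {X : TLCat δ} (e : X ⟶ X) : Prop :=
  e ≠ 0 ∧ e ≫ e = e ∧ IsAnnihilatedByCupsAndCaps e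

end TLCat

end TemperleyLieb

/-!
The unique proper ideal is the ideal of negligible morphisms, and its generator is the Jones–Wenzl
idempotent `p` on `l - 1` strands.

*Negligible morphisms.* In a monoidal category, the morphisms `f` for which every endomorphism of the
unit that factors through some `Z ◁ f` vanishes form a left tensor ideal `negligibleIdeal`. If `X`
has duals, membership can be tested by a trace built from any left and any right duality of `X`, and
the two need not be related (`mem_negligibleIdeal_iff_trace`). The diagrammatic trace and the trace
of any braiding are both of this kind. Since endomorphisms of the unit are scalars, this ideal
contains every ideal that does not contain all morphisms (`le_negligibleIdeal`).

*Jones–Wenzl idempotents.* Wenzl's recursion yields idempotents `jonesWenzl δ n` annihilated by cups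
and caps as long as the trace ratios `-[m + 1] / [m]` with `0 < m < n` do not vanish, that is, for
`n < l` (`jonesWenzl_aux`). The trace ratio at `l - 1` vanishes, so `p` is negligible, and the
idempotents on fewer strands are not. Modulo an ideal that contains `p`, every identity is a sum of
morphisms that factor through Jones–Wenzl idempotents on fewer strands. As there are only scalar
morphisms between these, such an ideal contains all negligible morphisms (`negligibleIdeal_le`).

*Nonzero ideals contain `p`.* A nonzero ideal contains a nonzero morphism `u` from the unit to `m`
strands; for the smallest `m`, it is annihilated by all caps. The representation of diagrams by
tensors in powers of a two-dimensional space sends a line to `-q • (true ⊗ false) + false ⊗ true`.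
It is faithful on morphisms from the unit, since a diagram is determined by the right ends of its
lines (`exists_wordCoeff_ne_zero`), and compatible with caps (`tensorCoeff_comp_capAt`). So the tensor
of `u` is `q`-symmetric. This determines it up to a scalar: `m = 2 * a`, and the coefficient of `u` at
a word with `a` letters `true` is a nonzero multiple of a power of `q`.

If `l ≤ a`, consider the sum `wordSum` of coefficients, with powers of `q` as weights, over the words
that begin with `a - l` letters `true`. It vanishes on every diagram, as two adjacent dots among the
last `a + l` dots are joined. On `u` it is a nonzero multiple of the Gaussian binomial coefficient
`[a + l, l]` at the primitive `l`-th root of unity `q ^ 2`, which is `⌊a / l⌋ + 1`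
(`gaussBinomial_order`) and not zero in characteristic zero. So `a < l`. The word that consists of `a`
letters `true` followed by `a` letters `false` occurs only in the tensor of the nested cups, so these
occur in `u` (`KillsCaps.exists_coeff_cups_ne_zero`). Bending `u` to an endomorphism of `a` strands and
composing with the Jones–Wenzl idempotent shows that this idempotent lies in the ideal, and by the
recursion so does `p` (`jonesWenzl_mem_of_ne_zero`).

Identities between diagrams are verified on the matrices `mat` of the diagrams, whose entries
record which labelings of the dots are constant along lines.
-/

namespace TemperleyLieb

/-! ### The ideal of negligible morphisms in a monoidal category -/

section Abstract

universe v u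

variable {C : Type u} [Category.{v} C] [Preadditive C] [MonoidalCategory C]

/-- A morphism from the unit that lies in an ideal is bent back to a morphism in the ideal. -/
theorem LeftTensorIdeal.exists_of_unit_hom {X A Y : C} [ExactPairing A X] (I : LeftTensorIdeal C)
    (u : 𝟙_ C ⟶ A ⊗ Y) (hu : u ∈ I.mor _ _) :
    ∃ v : X ⟶ Y, v ∈ I.mor X Y ∧ u = η_ A X ≫ A ◁ v := by
  refine ⟨(ρ_ X).inv ≫ (tensorLeftHomEquiv (𝟙_ C) A X Y).symm u, ?_, ?_⟩
  · exact I.comp_mem_right _ _ (I.comp_mem_left _ _ (I.whiskerLeft_mem _ _ hu))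
  · have e : ∀ w : X ⊗ 𝟙_ C ⟶ Y, tensorLeftHomEquiv (𝟙_ C) A X Y w =
        η_ A X ≫ A ◁ ((ρ_ X).inv ≫ w) := by
      intro w
      change (λ_ _).inv ≫ η_ _ _ ▷ _ ≫ (α_ _ _ _).hom ≫ _ ◁ w = _
      rw [unitors_inv_equal, ← rightUnitor_inv_naturality_assoc]
      simp
    rw [← e, Equiv.apply_symm_apply]

/-- An ideal that contains the identity of the unit contains all morphisms. -/
theorem LeftTensorIdeal.mem_of_unit_mem (I : LeftTensorIdeal C)
    (h : 𝟙 (𝟙_ C) ∈ I.mor (𝟙_ C) (𝟙_ C)) {X Y : C} (f : X ⟶ Y) : f ∈ I.mor X Y := by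
  have h1 := I.comp_mem_right (ρ_ X).inv _ (I.comp_mem_left _ ((ρ_ X).hom ≫ f)
    (I.whiskerLeft_mem X _ h))
  simpa using h1

variable (C) [MonoidalPreadditive C]

/-- The largest left tensor ideal without nonzero endomorphisms of the unit: `f` belongs to it if
every endomorphism of the unit that factors through some `Z ◁ f` vanishes. -/
def negligibleIdeal : LeftTensorIdeal C where
  mor X Y :=
    { carrier := {f | ∀ (Z : C) (g : 𝟙_ C ⟶ Z ⊗ X) (h : Z ⊗ Y ⟶ 𝟙_ C), g ≫ Z ◁ f ≫ h = 0}
      add_mem' := fun ha hb Z g h => by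
        rw [MonoidalPreadditive.whiskerLeft_add, Preadditive.add_comp, Preadditive.comp_add,
          ha Z g h, hb Z g h, add_zero]
      zero_mem' := fun Z g h => by simp
      neg_mem' := fun {f} ha Z g h => by
        have e : Z ◁ (-f) = -(Z ◁ f) := by
          rw [eq_neg_iff_add_eq_zero, ← MonoidalPreadditive.whiskerLeft_add, neg_add_cancel,
            MonoidalPreadditive.whiskerLeft_zero]
        rw [e, Preadditive.neg_comp, Preadditive.comp_neg, ha Z g h, neg_zero] }
  comp_mem_right g f hf Z a b := by
    have := hf Z (a ≫ Z ◁ g) b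
    simpa using this
  comp_mem_left f h hf Z a b := by
    have := hf Z a (Z ◁ h ≫ b)
    simpa using this
  whiskerLeft_mem W X Y f hf Z a b := by
    have := hf (Z ⊗ W) (a ≫ (α_ _ _ _).inv) ((α_ _ _ _).hom ≫ b)
    simpa using this

variable {C}

/-- Whether `f` is negligible can be tested by the traces `η ≫ A ◁ (f ≫ g) ≫ ε`, where `η` and `ε`
come from two unrelated dualities: `η` makes `A` a left dual of `X`, and `ε` a right dual. -/
theorem mem_negligibleIdeal_iff_trace {X A Y : C} (P : ExactPairing A X) (Q : ExactPairing X A)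
    (f : X ⟶ Y) :
    f ∈ (negligibleIdeal C).mor X Y ↔
      ∀ g : Y ⟶ X, P.coevaluation' ≫ A ◁ (f ≫ g) ≫ Q.evaluation' = 0 := by
  constructor
  · intro hf g
    have := hf A P.coevaluation' (A ◁ g ≫ Q.evaluation')
    simpa using this
  · intro hf Z g h
    obtain ⟨g', rfl⟩ := (tensorRightHomEquiv (𝟙_ C) A X Z).surjective g
    obtain ⟨h', hh⟩ := (tensorLeftHomEquiv Y X A (𝟙_ C)).symm.surjective
      ((λ_ A).inv ▷ Y ≫ g' ▷ Y ≫ h)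
    have e1 : (tensorRightHomEquiv (𝟙_ C) A X Z) g' =
        P.coevaluation' ≫ ((λ_ A).inv ≫ g') ▷ X := by
      change (ρ_ _).inv ≫ _ ◁ P.coevaluation' ≫ (α_ _ _ _).inv ≫ g' ▷ _ = _
      rw [← unitors_inv_equal, ← leftUnitor_inv_naturality_assoc]
      simp
    have e2 : (tensorLeftHomEquiv Y X A (𝟙_ C)).symm h' =
        A ◁ (h' ≫ (ρ_ X).hom) ≫ Q.evaluation' := by
      change A ◁ h' ≫ (α_ _ _ _).inv ≫ Q.evaluation' ▷ _ ≫ (λ_ _).hom = _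
      rw [unitors_equal, rightUnitor_naturality]
      simp
    rw [e1, Category.assoc, ← whisker_exchange_assoc]
    have := hf (h' ≫ (ρ_ X).hom)
    rw [MonoidalCategory.whiskerLeft_comp, Category.assoc, ← e2, hh] at this
    simpa using this

/-- A nonzero ideal contains a nonzero morphism from the unit. -/
theorem LeftTensorIdeal.exists_unit_hom {X A Y : C} [ExactPairing A X] (I : LeftTensorIdeal C)
    (f : X ⟶ Y) (hf : f ∈ I.mor X Y) (h0 : f ≠ 0) :
    ∃ u : 𝟙_ C ⟶ A ⊗ Y, u ∈ I.mor _ _ ∧ u ≠ 0 := by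
  refine ⟨tensorLeftHomEquiv (𝟙_ C) A X Y ((ρ_ X).hom ≫ f), ?_, fun h => h0 ?_⟩
  · exact I.comp_mem_right _ _ (I.comp_mem_right _ _ (I.comp_mem_right _ _
      (I.whiskerLeft_mem _ _ (I.comp_mem_right _ _ hf))))
  · have e : tensorLeftHomEquiv (𝟙_ C) A X Y 0 = 0 := by simp [tensorLeftHomEquiv]
    rw [← e] at h
    have := (tensorLeftHomEquiv (𝟙_ C) A X Y).injective h
    simpa using this

theorem unit_notMem_negligibleIdeal (h : 𝟙 (𝟙_ C) ≠ 0) :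
    𝟙 (𝟙_ C) ∉ (negligibleIdeal C).mor (𝟙_ C) (𝟙_ C) := by
  intro h'
  have := h' (𝟙_ C) (λ_ _).inv (λ_ _).hom
  exact h (by simpa using this)

end Abstract

/-! ### Reflection and strands added on the left -/

namespace Diagram

variable {i j k : ℕ}

theorem pos_swap (p : Fin i ⊕ Fin j) : pos p.swap + pos p + 1 = i + j := by
  rcases p with a | b <;> simp only [pos, Sum.swap_inl, Sum.swap_inr] <;> omega

/-- The reflection of a diagram in a horizontal line. -/
def flip (d : Diagram i j) : Diagram j i where
  partner p := (d.partner p.swap).swap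
  partner_partner p := by simp [d.partner_partner]
  partner_ne p h := d.partner_ne p.swap (by rw [← Sum.swap_swap (d.partner p.swap), h])
  planar p q h := by
    have h1 := pos_swap p
    have h2 := pos_swap q
    have h3 := pos_swap (d.partner p.swap)
    have h4 := pos_swap (d.partner q.swap)
    have := d.planar (d.partner q.swap) (d.partner p.swap)
    rw [d.partner_partner, d.partner_partner] at this
    omega

theorem flip_flip (d : Diagram i j) : d.flip.flip = d := by
  ext1; funext p; simp [flip]

theorem flip_partner (d : Diagram i j) (p : Fin j ⊕ Fin i) :
    d.flip.partner p = (d.partner p.swap).swap := rfl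

theorem mat_flip (d : Diagram i j) : mat d.flip = (mat d).transpose := by
  ext x y
  simp only [mat, Matrix.transpose_apply]
  congr 1
  rw [eq_iff_iff]
  have h : ∀ p : Fin j ⊕ Fin i, Sum.elim x y p = Sum.elim y x p.swap := by
    rintro (a | b) <;> rfl
  refine ((Equiv.sumComm (Fin j) (Fin i)).forall_congr fun {p} => ?_)
  rw [h, h p, flip_partner, Sum.swap_swap]
  rfl

/-- Reflection reverses the order of a concatenation and preserves the number of loops. Since the
matrix of a diagram determines the diagram, this is an identity of matrices. -/
theorem flip_concat' (d : Diagram i j) (e : Diagram j k) :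
    loops e.flip d.flip = loops d e ∧ e.flip.concat d.flip = (d.concat e).flip := by
  apply eq_of_smul_mat
  rw [← mat_concat, mat_flip, mat_flip, mat_flip, ← Matrix.transpose_mul, mat_concat,
    Matrix.transpose_smul]

theorem flip_hasCap {d : Diagram i j} : d.flip.HasCap ↔ d.HasCup := by
  refine exists_congr fun a => exists_congr fun b => ?_
  rw [flip_partner, Sum.swap_inl]
  generalize d.partner (.inr a) = s
  rcases s with s | s <;> simp

/-- The dots of a diagram among the dots of the diagram with a strand added on the left. -/
def liftDot : Fin i ⊕ Fin j → Fin (i + 1) ⊕ Fin (j + 1) := Sum.map Fin.succ Fin.succ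

theorem liftDot_injective : Function.Injective (liftDot (i := i) (j := j)) :=
  Function.Injective.sumMap (Fin.succ_injective _) (Fin.succ_injective _)

theorem pos_liftDot (p : Fin i ⊕ Fin j) : pos (liftDot p) = pos p + 1 := by
  rcases p with a | b
  · simp [liftDot, pos]
  · simp [liftDot, pos]; omega

theorem liftDot_cases {P : Fin (i + 1) ⊕ Fin (j + 1) → Prop} (hl : P (.inl 0)) (hr : P (.inr 0))
    (h : ∀ p, P (liftDot p)) (p : Fin (i + 1) ⊕ Fin (j + 1)) : P p := by
  rcases p with a | a <;> cases a using Fin.cases with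
  | zero => assumption
  | succ a => first | exact h (.inl a) | exact h (.inr a)

/-- The diagram with a vertical strand added on the left. -/
def addStrand (d : Diagram i j) : Diagram (i + 1) (j + 1) where
  partner := Sum.elim (Fin.cases (.inr 0) fun a => liftDot (d.partner (.inl a)))
    (Fin.cases (.inl 0) fun b => liftDot (d.partner (.inr b)))
  partner_partner := by
    have h : ∀ p, Sum.elim (Fin.cases (.inr 0) fun a => liftDot (d.partner (.inl a)))
      (Fin.cases (.inl 0) fun b => liftDot (d.partner (.inr b))) (liftDot p) =
        liftDot (d.partner p) := by rintro (a | a) <;> rfl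
    refine liftDot_cases rfl rfl fun p => ?_
    rw [h, h, d.partner_partner]
  partner_ne := by
    have h : ∀ p, Sum.elim (Fin.cases (.inr 0) fun a => liftDot (d.partner (.inl a)))
      (Fin.cases (.inl 0) fun b => liftDot (d.partner (.inr b))) (liftDot p) =
        liftDot (d.partner p) := by rintro (a | a) <;> rfl
    refine liftDot_cases (by simp) (by simp) fun p => ?_
    rw [h]
    exact fun e => d.partner_ne p (liftDot_injective e)
  planar := by
    have h : ∀ p, Sum.elim (Fin.cases (.inr 0) fun a => liftDot (d.partner (.inl a)))
      (Fin.cases (.inl 0) fun b => liftDot (d.partner (.inr b))) (liftDot p) =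
        liftDot (d.partner p) := by rintro (a | a) <;> rfl
    have hl : pos (.inl 0 : Fin (i + 1) ⊕ Fin (j + 1)) = 0 := rfl
    have hr : pos (.inr 0 : Fin (i + 1) ⊕ Fin (j + 1)) = i + j + 1 := by simp [pos]; omega
    refine liftDot_cases ?_ ?_ fun p => ?_ <;> refine liftDot_cases ?_ ?_ fun q => ?_ <;>
      simp only [h, pos_liftDot, Sum.elim_inl, Sum.elim_inr, Fin.cases_zero, hl, hr] <;>
      try omega
    · have := pos_lt q
      have := pos_lt (d.partner q)
      omega
    · have := d.planar p q
      omega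

@[simp] theorem addStrand_partner_liftDot (d : Diagram i j) (p : Fin i ⊕ Fin j) :
    d.addStrand.partner (liftDot p) = liftDot (d.partner p) := by rcases p with a | a <;> rfl

theorem addStrand_injective : Function.Injective (addStrand (i := i) (j := j)) := by
  intro d e h
  ext1; funext p
  apply liftDot_injective
  rw [← addStrand_partner_liftDot, ← addStrand_partner_liftDot, h]

/-- A sum over all labelings of dots splits off the label of the first dot. -/
theorem sum_cons {n : ℕ} {M : Type*} [AddCommMonoid M] (f : (Fin (n + 1) → Bool) → M) :
    ∑ x, f x = ∑ a, ∑ x : Fin n → Bool, f (Fin.cons a x) := by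
  rw [← (Fin.consEquiv fun _ => Bool).sum_comp, Fintype.sum_prod_type]
  rfl

theorem mat_addStrand (d : Diagram i j) (a b : Bool) (x : Fin i → Bool) (y : Fin j → Bool) :
    mat d.addStrand (Fin.cons a x : Fin (i + 1) → Bool) (Fin.cons b y : Fin (j + 1) → Bool) =
      (if a = b then 1 else 0) * mat d x y := by
  have h : ∀ p, Sum.elim (Fin.cons a x : Fin (i + 1) → Bool) (Fin.cons b y : Fin (j + 1) → Bool)
      (liftDot p) = Sum.elim x y p := by rintro (p | p) <;> simp [liftDot]
  simp only [mat]
  rw [indicator_mul]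
  congr 1
  rw [eq_iff_iff]
  constructor
  · intro H
    refine ⟨(H (.inr 0)), fun p => ?_⟩
    have := H (liftDot p)
    rwa [addStrand_partner_liftDot, h, h] at this
  · rintro ⟨rfl, H⟩
    refine liftDot_cases rfl rfl fun p => ?_
    rw [addStrand_partner_liftDot, h, h, H]

theorem ext_cons {m n : ℕ} {A B : Matrix (Fin (m + 1) → Bool) (Fin (n + 1) → Bool) ℕ}
    (h : ∀ a b x y, A (Fin.cons a x) (Fin.cons b y) = B (Fin.cons a x) (Fin.cons b y)) :
    A = B := by
  ext x y
  rw [← Fin.cons_self_tail x, ← Fin.cons_self_tail y]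
  exact h _ _ _ _

theorem addStrand_concat' (d : Diagram i j) (e : Diagram j k) :
    loops d.addStrand e.addStrand = loops d e ∧
      d.addStrand.concat e.addStrand = (d.concat e).addStrand := by
  apply eq_of_smul_mat
  rw [← mat_concat]
  apply ext_cons
  intro a b x y
  have := congrFun (congrFun (mat_concat d e) x) y
  rw [Matrix.mul_apply, Matrix.smul_apply, smul_eq_mul] at this
  rw [Matrix.mul_apply, sum_cons, Matrix.smul_apply, smul_eq_mul, mat_addStrand, mul_left_comm,
    ← this]
  simp only [mat_addStrand]
  cases a <;> cases b <;> simp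

theorem addStrand_flip (d : Diagram i j) : d.addStrand.flip = d.flip.addStrand := by
  apply mat_injective
  rw [mat_flip]
  apply ext_cons
  intro a b x y
  rw [Matrix.transpose_apply, mat_addStrand, mat_addStrand, mat_flip, Matrix.transpose_apply]
  simp only [eq_comm]

theorem addStrand_vertical (h : i = j) : (vertical h).addStrand = vertical (congrArg (· + 1) h) := by
  subst h
  ext1; funext p
  refine liftDot_cases (P := fun p => (vertical rfl).addStrand.partner p = (vertical _).partner p)
    rfl rfl (fun p => ?_) p
  rw [addStrand_partner_liftDot]
  rcases p with a | a <;> rfl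

theorem vertical_juxtapose_concat (d : Diagram i j) :
    ((vertical (rfl : 1 = 1)).juxtapose d).concat (vertical (Nat.add_comm 1 j)) =
      (vertical (Nat.add_comm 1 i)).concat d.addStrand := by
  apply mat_injective
  ext x y
  rw [mat_concat_vertical, mat_vertical_concat, mat_juxtapose, mat_vertical_self]
  have hx : x ∘ Fin.cast (Nat.add_comm 1 i).symm =
      (Fin.cons (x 0) (x ∘ Fin.natAdd 1) : Fin (i + 1) → Bool) := by
    funext a
    cases a using Fin.cases with
    | zero => exact congrArg x (Fin.ext rfl)
    | succ a => exact congrArg x (Fin.ext (by simp [Nat.add_comm]))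
  rw [hx, ← Fin.cons_self_tail y, mat_addStrand]
  congr 1
  · congr 1
    rw [eq_iff_iff, funext_iff]
    simp only [Fin.forall_fin_one, Function.comp]
    rfl
  · congr 1
    funext a
    simp only [Function.comp]
    have : Fin.cast (Nat.add_comm 1 j) (Fin.natAdd 1 a) = a.succ :=
      Fin.ext (by simp)
    rw [this, Fin.cons_succ]

/-! ### Caps -/

/-- The diagram with a cap joining the first two lower dots. -/
def cap (n : ℕ) : Diagram (n + 2) n where
  partner := Sum.elim (Fin.cases (.inl 1) (Fin.cases (.inl 0) .inr)) fun a => .inl a.succ.succ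
  partner_partner := by
    rintro (a | a)
    · cases a using Fin.cases with
      | zero => rfl
      | succ a =>
        cases a using Fin.cases with
        | zero => rfl
        | succ a => rfl
    · rfl
  partner_ne := by
    rintro (a | a)
    · cases a using Fin.cases with
      | zero => simp
      | succ a =>
        cases a using Fin.cases with
        | zero => exact fun h => absurd (Sum.inl_injective h) (by simp)
        | succ a => simp
    · simp
  planar := by
    have e : ∀ p : Fin (n + 2) ⊕ Fin n,
        let p' := Sum.elim (Fin.cases (.inl 1) (Fin.cases (.inl 0) .inr))
          (fun a => .inl a.succ.succ) p
        (pos p = 0 ∧ pos p' = 1) ∨ (pos p = 1 ∧ pos p' = 0) ∨ pos p + pos p' = n + n + 3 := by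
      rintro (a | a)
      · cases a using Fin.cases with
        | zero => exact Or.inl ⟨rfl, rfl⟩
        | succ a => cases a using Fin.cases with
          | zero => exact Or.inr (Or.inl ⟨rfl, rfl⟩)
          | succ a => right; right; simp [pos]; omega
      · right; right; simp [pos]; omega
    intro p q
    have := e p
    have := e q
    have := pos_lt p
    have := pos_lt q
    simp only at *
    omega

theorem mat_cap (n : ℕ) (a b : Bool) (x y : Fin n → Bool) :
    mat (cap n) (Fin.cons a (Fin.cons b x) : Fin (n + 2) → Bool) y =
      if a = b ∧ x = y then 1 else 0 := by
  unfold mat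
  congr 1
  rw [eq_iff_iff, Sum.forall, Fin.forall_fin_succ, Fin.forall_fin_succ, funext_iff]
  simp only [cap, Sum.elim_inl, Sum.elim_inr, Fin.cases_zero, Fin.cases_succ, Fin.cons_zero,
    Fin.cons_succ, show (1 : Fin (n + 2)) = Fin.succ 0 from rfl]
  exact ⟨fun h => ⟨h.1.2.1, h.2⟩, fun h => ⟨⟨h.1.symm, h.1, fun a => (h.2 a).symm⟩, h.2⟩⟩

theorem cup_concat_cap' (n : ℕ) :
    loops (cap n).flip (cap n) = 1 ∧ (cap n).flip.concat (cap n) = vertical rfl := by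
  apply eq_of_smul_mat
  rw [← mat_concat, mat_flip]
  ext x y
  rw [Matrix.mul_apply, sum_cons]
  simp only [sum_cons, Matrix.transpose_apply, mat_cap, Matrix.smul_apply, mat_vertical_self,
    indicator_mul, Fintype.sum_bool]
  by_cases h : x = y
  · subst h
    simp
  · have : ∀ z, ¬ (z = x ∧ z = y) := fun z hz => h (hz.1.symm.trans hz.2)
    simp [h, this]

/-- A cap on the first two of three strands straightens a cup on the last two. -/
theorem zigzag_cap' (n : ℕ) :
    loops (cap n).flip.addStrand (cap (n + 1)) = 0 ∧
      (cap n).flip.addStrand.concat (cap (n + 1)) = vertical rfl := by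
  apply eq_of_smul_mat
  rw [← mat_concat, pow_zero, one_smul]
  apply ext_cons
  intro a b x y
  rw [Matrix.mul_apply]
  simp only [sum_cons, mat_addStrand, mat_flip, Matrix.transpose_apply, mat_cap,
    mat_vertical_self, indicator_mul, Fintype.sum_bool]
  cases a <;> cases b <;> simp [Fin.cons_inj, ite_and, eq_comm]

theorem zigzag_cup' (n : ℕ) :
    loops (cap (n + 1)).flip (cap n).addStrand = 0 ∧
      (cap (n + 1)).flip.concat (cap n).addStrand = vertical rfl := by
  have h := flip_concat' (cap n).flip.addStrand (cap (n + 1))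
  rw [addStrand_flip, flip_flip, (zigzag_cap' n).1, (zigzag_cap' n).2] at h
  refine ⟨h.1, h.2.trans ?_⟩
  ext1; funext p; rcases p with a | a <;> rfl

/-- A cap on two further strands slides past a diagram. -/
theorem cap_concat' (d : Diagram i j) :
    (loops (cap i) d = 0 ∧ loops d.addStrand.addStrand (cap j) = 0) ∧
      (cap i).concat d = d.addStrand.addStrand.concat (cap j) := by
  have key : mat (cap i) * mat d = mat d.addStrand.addStrand * mat (cap j) := by
    ext x z
    rw [← Fin.cons_self_tail x, ← Fin.cons_self_tail (Fin.tail x)]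
    rw [Matrix.mul_apply, Matrix.mul_apply]
    simp only [sum_cons, mat_addStrand, mat_cap, Fintype.sum_bool]
    cases x 0 <;> cases Fin.tail x 0 <;> simp
  have h1 : loops (cap i) d = 0 := by
    have := congrFun (congrFun (mat_concat (cap i) d) (Fin.cons true (Fin.cons true fun _ => true)))
      (fun _ => true)
    have e : (Fin.cons true (Fin.cons true fun _ => true) : Fin (i + 2) → Bool) = fun _ => true := by
      funext a
      cases a using Fin.cases with
      | zero => rfl
      | succ a => cases a using Fin.cases <;> rfl
    rw [Matrix.mul_apply] at this
    simp only [mat_cap, true_and] at this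
    rw [e, Matrix.smul_apply, mat_true] at this
    simp only [ite_mul, one_mul, zero_mul, Finset.sum_ite_eq, Finset.mem_univ, if_true, mat_true,
      smul_eq_mul, mul_one] at this
    exact (Nat.pow_right_injective le_rfl (this.symm.trans (pow_zero 2).symm))
  rw [mat_concat, mat_concat] at key
  obtain ⟨h2, h3⟩ := eq_of_smul_mat key
  exact ⟨⟨h1, h2.symm.trans h1⟩, h3⟩

theorem concat_cup' (d : Diagram i j) :
    (loops d (cap j).flip = 0 ∧ loops (cap i).flip d.addStrand.addStrand = 0) ∧
      d.concat (cap j).flip = (cap i).flip.concat d.addStrand.addStrand := by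
  obtain ⟨⟨h1, h2⟩, h3⟩ := cap_concat' d.flip
  have e1 := flip_concat' (cap j) d.flip
  have e2 := flip_concat' d.flip.addStrand.addStrand (cap i)
  rw [addStrand_flip, addStrand_flip, flip_flip] at e2
  rw [flip_flip] at e1
  exact ⟨⟨e1.1.trans h1, e2.1.trans h2⟩, e1.2.trans (by rw [h3, e2.2])⟩

end Diagram

/-! ### Factoring a diagram through an innermost cap -/

namespace Diagram

variable {i j k : ℕ}

theorem concat_hasCap {d : Diagram i j} (e : Diagram j k) (h : d.HasCap) :
    (d.concat e).HasCap := by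
  obtain ⟨a, b, hab⟩ := h
  refine ⟨a, b, (eq_concatPartner (d := d) (e := e) ?_ ?_).symm⟩
  · rintro e
    cases e
    exact d.partner_ne _ hab
  · have := connected_lower d e (.inl a)
    rwa [hab] at this

theorem not_hasCap_vertical (h : i = j) : ¬ (vertical h).HasCap := by
  rintro ⟨a, b, h⟩
  simp [vertical] at h

theorem not_hasCup_vertical (h : i = j) : ¬ (vertical h).HasCup := by
  rintro ⟨a, b, h⟩
  simp [vertical] at h

theorem exists_partner_of_not_hasCap {d : Diagram i j} (h : ¬ d.HasCap) :
    ∃ f : Fin i → Fin j, ∀ a, d.partner (.inl a) = .inr (f a) := by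
  have : ∀ a, ∃ b, d.partner (.inl a) = .inr b := by
    intro a
    rcases e : d.partner (.inl a) with b | b
    · exact absurd ⟨a, b, e⟩ h
    · exact ⟨b, rfl⟩
  choose f hf using this
  exact ⟨f, hf⟩

theorem injective_of_partner {d : Diagram i j} {f : Fin i → Fin j}
    (hf : ∀ a, d.partner (.inl a) = .inr (f a)) : Function.Injective f := by
  intro a b h
  have := d.partner_partner (.inl a)
  rw [hf, h, ← hf, d.partner_partner] at this
  exact (Sum.inl_injective this).symm

theorem hasCap_of_lt (d : Diagram i j) (h : j < i) : d.HasCap := by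
  by_contra hc
  obtain ⟨f, hf⟩ := exists_partner_of_not_hasCap hc
  have := Fintype.card_le_of_injective f (injective_of_partner hf)
  simp at this
  omega

theorem hasCup_of_lt (d : Diagram i j) (h : i < j) : d.HasCup :=
  flip_hasCap.1 (hasCap_of_lt _ h)

/-- Planarity forces the lines of a diagram without caps to be vertical. -/
theorem eq_vertical_of_not_hasCap {d : Diagram i i} (h : ¬ d.HasCap) : d = vertical rfl := by
  obtain ⟨f, hf⟩ := exists_partner_of_not_hasCap h
  have hm : StrictMono f := by
    refine Monotone.strictMono_of_injective (fun a b hab => ?_) (injective_of_partner hf)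
    rcases hab.eq_or_lt with rfl | hab
    · exact le_rfl
    have := d.planar (.inl a) (.inl b)
    rw [hf, hf] at this
    simp only [pos] at this
    rw [Fin.lt_def] at hab
    rw [Fin.le_def]
    omega
  have hid : f = id := by
    have hs : Function.Surjective f := Finite.injective_iff_surjective.1 hm.injective
    exact (hm.range_inj strictMono_id).1 (by rw [hs.range_eq]; simp)
  subst hid
  ext1; funext p
  rcases p with a | b
  · exact hf a
  · have := d.partner_partner (.inl b)
    rwa [hf] at this

theorem eq_vertical_of_not_hasCup {d : Diagram i i} (h : ¬ d.HasCup) : d = vertical rfl := by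
  have : d.flip = vertical rfl := eq_vertical_of_not_hasCap (fun h' => h (flip_hasCap.1 h'))
  rw [← d.flip_flip, this]
  ext1; funext p; rcases p with a | a <;> rfl

theorem hasCap_iff_hasCup {d : Diagram i i} : d.HasCap ↔ d.HasCup := by
  constructor
  · intro h; by_contra h'
    rw [eq_vertical_of_not_hasCup h'] at h
    exact not_hasCap_vertical _ h
  · intro h; by_contra h'
    rw [eq_vertical_of_not_hasCap h'] at h
    exact not_hasCup_vertical _ h

/-- Below every cap there is a cap that joins two adjacent dots. -/
theorem exists_adjacent (d : Diagram i j) (a b : Fin i) (hab : a < b)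
    (h : d.partner (.inl a) = .inl b) :
    ∃ (c : ℕ) (hc : c + 1 < i), (a : ℕ) ≤ c ∧ c + 1 ≤ b ∧
      d.partner (.inl ⟨c, by omega⟩) = .inl ⟨c + 1, hc⟩ := by
  obtain ⟨n, hn⟩ : ∃ n, n = (b : ℕ) - a := ⟨_, rfl⟩
  induction n using Nat.strong_induction_on generalizing a b with
  | _ n ih =>
  rw [Fin.lt_def] at hab
  by_cases h1 : (a : ℕ) + 1 = b
  · have e : b = ⟨a + 1, by omega⟩ := Fin.ext h1.symm
    exact ⟨a, by omega, le_rfl, by omega, e ▸ h⟩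
  -- the line that starts next to `a` stays below the cap
  let a' : Fin i := ⟨a + 1, by omega⟩
  have hb : d.partner (.inl b) = .inl a := by rw [← h, d.partner_partner]
  have p1 := d.planar (.inl a) (.inl a')
  have p2 := d.planar (d.partner (.inl a')) (.inl a)
  rw [d.partner_partner] at p2
  have n1 : d.partner (.inl a') ≠ .inl a := fun e => by
    have := d.partner_partner (.inl a')
    rw [e, h] at this
    have := congrArg Fin.val (Sum.inl_injective this)
    simp only [a'] at this; omega
  have n2 : d.partner (.inl a') ≠ .inl b := fun e => by
    have := d.partner_partner (.inl a')
    rw [e, hb] at this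
    have := congrArg Fin.val (Sum.inl_injective this)
    simp only [a'] at this; omega
  have n3 := d.partner_ne (.inl a')
  rw [← pos_injective.ne_iff] at n1 n2 n3
  rw [h] at p1 p2
  rcases e : d.partner (.inl a') with c | c
  · rw [e] at p1 p2 n1 n2 n3
    simp only [pos, a'] at p1 p2 n1 n2 n3
    obtain ⟨x, hx, y1, y2, y3⟩ := ih ((c : ℕ) - a') (by simp only [a']; omega) a' c
      (by rw [Fin.lt_def]; simp only [a']; omega) e rfl
    exact ⟨x, hx, by simp only [a'] at y1; omega, by omega, y3⟩
  · rw [e] at p1 p2 n1 n2 n3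
    simp only [pos, a'] at p1 p2 n1 n2 n3
    omega

theorem HasCap.exists_adjacent {d : Diagram i j} (h : d.HasCap) :
    ∃ (c : ℕ) (hc : c + 1 < i), d.partner (.inl ⟨c, by omega⟩) = .inl ⟨c + 1, hc⟩ := by
  obtain ⟨a, b, h⟩ := h
  rcases lt_trichotomy a b with hab | rfl | hab
  · obtain ⟨c, hc, _, _, h'⟩ := Diagram.exists_adjacent d a b hab h
    exact ⟨c, hc, h'⟩
  · exact absurd h (d.partner_ne _)
  · obtain ⟨c, hc, _, _, h'⟩ := Diagram.exists_adjacent d b a hab (by rw [← h, d.partner_partner])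
    exact ⟨c, hc, h'⟩

/-- The diagram whose only cap joins the lower dots `b` and `b + 1`. -/
def capAt : ∀ b n : ℕ, Diagram (n + 2 + b) (n + b)
  | 0, n => cap n
  | b + 1, n => (capAt b n).addStrand

/-- The embedding of the dots into a line with two more dots in the places `b` and `b + 1`. -/
def skip (b n : ℕ) (a : Fin (n + b)) : Fin (n + 2 + b) :=
  ⟨if (a : ℕ) < b then a else a + 2, by split_ifs <;> omega⟩

theorem capAt_partner_inr (b n : ℕ) (a : Fin (n + b)) :
    (capAt b n).partner (.inr a) = .inl (skip b n a) := by
  induction b with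
  | zero => exact congrArg Sum.inl (Fin.ext (by simp [skip]))
  | succ b ih =>
    cases a using Fin.cases with
    | zero => exact congrArg Sum.inl (Fin.ext (by simp [skip]))
    | succ a =>
      refine (addStrand_partner_liftDot _ (.inr a)).trans ?_
      rw [ih]
      refine congrArg Sum.inl (Fin.ext ?_)
      simp only [skip, Fin.val_succ]
      split_ifs <;> omega

theorem capAt_partner_skip (b n : ℕ) (a : Fin (n + b)) :
    (capAt b n).partner (.inl (skip b n a)) = .inr a := by
  rw [← capAt_partner_inr, partner_partner]

theorem capAt_partner_left (b n : ℕ) (h : b < n + 2 + b) (h' : b + 1 < n + 2 + b) :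
    (capAt b n).partner (.inl ⟨b, h⟩) = .inl ⟨b + 1, h'⟩ := by
  induction b with
  | zero => rfl
  | succ b ih =>
    refine (addStrand_partner_liftDot _ (.inl ⟨b, by omega⟩)).trans ?_
    rw [ih (by omega) (by omega)]
    rfl

theorem capAt_partner_right (b n : ℕ) (h : b < n + 2 + b) (h' : b + 1 < n + 2 + b) :
    (capAt b n).partner (.inl ⟨b + 1, h'⟩) = .inl ⟨b, h⟩ := by
  rw [← capAt_partner_left b n h h', partner_partner]

theorem capAt_hasCap (b n : ℕ) : (capAt b n).HasCap :=
  ⟨_, _, capAt_partner_left b n (by omega) (by omega)⟩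

theorem skip_injective (b n : ℕ) : Function.Injective (skip b n) := by
  intro a a' h
  have := congrArg Fin.val h
  simp only [skip] at this
  ext
  split_ifs at this <;> omega

theorem skip_cases {b n : ℕ} {P : Fin (n + 2 + b) → Prop} (h0 : P ⟨b, by omega⟩)
    (h1 : P ⟨b + 1, by omega⟩) (h : ∀ a, P (skip b n a)) (a : Fin (n + 2 + b)) : P a := by
  rcases lt_trichotomy (a : ℕ) b with ha | ha | ha
  · have := h ⟨a, by omega⟩
    simpa [skip, ha] using this
  · rwa [show a = ⟨b, by omega⟩ from Fin.ext ha]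
  · by_cases ha' : (a : ℕ) = b + 1
    · rwa [show a = ⟨b + 1, by omega⟩ from Fin.ext ha']
    · have := h ⟨a - 2, by omega⟩
      rwa [show skip b n ⟨a - 2, by omega⟩ = a from Fin.ext (by
        simp only [skip]; split_ifs <;> omega)] at this

/-- A diagram in which the lower dots `b` and `b + 1` are joined factors through this cap. The
other factor is the restriction of the diagram to the remaining dots. -/
theorem exists_capAt_concat {b n : ℕ} (d : Diagram (n + 2 + b) j)
    (h : d.partner (.inl ⟨b, by omega⟩) = .inl ⟨b + 1, by omega⟩) :
    ∃ d' : Diagram (n + b) j, (∀ p, d.partner (Sum.map (skip b n) id p) =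
        Sum.map (skip b n) id (d'.partner p)) ∧
      d = (capAt b n).concat d' ∧ loops (capAt b n) d' = 0 := by
  have h' : d.partner (.inl ⟨b + 1, by omega⟩) = .inl ⟨b, by omega⟩ := by
    rw [← h, d.partner_partner]
  have hinj : Function.Injective (Sum.map (skip b n) (id : Fin j → Fin j)) :=
    (skip_injective b n).sumMap Function.injective_id
  have hs : ∀ a, (skip b n a : ℕ) ≠ b ∧ (skip b n a : ℕ) ≠ b + 1 := by
    intro a; simp only [skip]; split_ifs <;> omega
  have hpos : ∀ p q : Fin (n + b) ⊕ Fin j, pos p < pos q ↔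
      pos (Sum.map (skip b n) (id : Fin j → Fin j) p) <
        pos (Sum.map (skip b n) (id : Fin j → Fin j) q) := by
    rintro (p | p) (q | q) <;> simp only [pos, Sum.map_inl, Sum.map_inr, id, skip] <;>
      (try split_ifs) <;> omega
  have hex : ∀ p : Fin (n + b) ⊕ Fin j, ∃ p',
      d.partner (Sum.map (skip b n) id p) = Sum.map (skip b n) id p' := by
    intro p
    rcases e : d.partner (Sum.map (skip b n) id p) with a | a
    · revert e
      refine skip_cases (P := fun a => d.partner (Sum.map (skip b n) id p) = Sum.inl a →
        ∃ p', Sum.inl a = Sum.map (skip b n) id p') ?_ ?_ ?_ a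
      · intro e
        exfalso
        have := d.partner_partner (Sum.map (skip b n) id p)
        rw [e, h] at this
        rcases p with p | p
        · exact absurd (congrArg Fin.val (Sum.inl_injective this)).symm (hs p).2
        · simp at this
      · intro e
        exfalso
        have := d.partner_partner (Sum.map (skip b n) id p)
        rw [e, h'] at this
        rcases p with p | p
        · exact absurd (congrArg Fin.val (Sum.inl_injective this)).symm (hs p).1
        · simp at this
      · exact fun a e => ⟨.inl a, rfl⟩
    · exact ⟨.inr a, rfl⟩
  choose f hf using hex
  let d' : Diagram (n + b) j :=
    { partner := f
      partner_partner := fun p => hinj (by rw [← hf, ← hf, d.partner_partner])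
      partner_ne := fun p e => d.partner_ne (Sum.map (skip b n) id p) (by rw [hf, e])
      planar := fun p q => by
        rw [hpos, hpos, hpos, ← hf, ← hf]
        exact d.planar _ _ }
  have hc : ∀ p : Fin (n + b) ⊕ Fin j, connected (capAt b n) d'
      (outerDot (Sum.map (skip b n) id p)) (upperDot p) := by
    rintro (a | a)
    · have := connected_lower (capAt b n) d' (.inl (skip b n a))
      rwa [capAt_partner_skip] at this
    · exact Setoid.refl' _ _
  refine ⟨d', hf, ?_, ?_⟩
  · ext1; funext p
    refine eq_concatPartner (d.partner_ne p) ?_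
    have key : ∀ p : Fin (n + b) ⊕ Fin j, connected (capAt b n) d'
        (outerDot (Sum.map (skip b n) id p))
        (outerDot (d.partner (Sum.map (skip b n) id p))) := by
      intro p
      rw [hf]
      exact Setoid.trans' _ (hc p) (Setoid.trans' _ (connected_upper (capAt b n) d' p)
        (Setoid.symm' _ (hc (f p))))
    rcases p with a | a
    · refine skip_cases (P := fun a => connected (capAt b n) d' (outerDot (.inl a))
        (outerDot (d.partner (.inl a)))) ?_ ?_ (fun a => key (.inl a)) a
      · have := connected_lower (capAt b n) d' (.inl ⟨b, by omega⟩)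
        rw [capAt_partner_left b n (by omega) (by omega)] at this
        rwa [h]
      · have := connected_lower (capAt b n) d' (.inl ⟨b + 1, by omega⟩)
        rw [capAt_partner_right b n (by omega) (by omega)] at this
        rwa [h']
    · exact key (.inr a)
  · refine Nat.card_eq_zero.2 (Or.inl ⟨fun c => ?_⟩)
    obtain ⟨c, hc'⟩ := c
    induction c using Quotient.inductionOn with
    | h v =>
      rcases v with a | p
      · exact hc' (.inl a) rfl
      · exact hc' _ (Quotient.sound (Setoid.symm' _ (hc p)))

end Diagram

namespace Diagram

variable {i j : ℕ}

theorem exists_addStrand_concat {b : ℕ} (d : Diagram (i + 1) j) (hb : b + 2 < i + 1)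
    (h : d.partner (.inl ⟨b + 1, by omega⟩) = .inl ⟨b + 2, hb⟩) :
    ∃ (m : ℕ) (e : Diagram i m) (d' : Diagram (m + 1) j), e.HasCap ∧
      d = e.addStrand.concat d' ∧ loops e.addStrand d' = 0 := by
  obtain ⟨n, rfl⟩ : ∃ n, i = n + 2 + b := ⟨i - 2 - b, by omega⟩
  obtain ⟨d', -, h1, h2⟩ := exists_capAt_concat (b := b + 1) (n := n) d h
  exact ⟨_, capAt b n, d', capAt_hasCap b n, h1, h2⟩

/-- A diagram with a cap factors either through the cap that joins the first two dots or through a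
diagram with a cap that avoids the first strand. -/
theorem HasCap.exists_concat {d : Diagram (i + 2) j} (h : d.HasCap) :
    (∃ d' : Diagram i j, d = (cap i).concat d' ∧ loops (cap i) d' = 0) ∨
      ∃ (m : ℕ) (e : Diagram (i + 1) m) (d' : Diagram (m + 1) j), e.HasCap ∧
        d = e.addStrand.concat d' ∧ loops e.addStrand d' = 0 := by
  obtain ⟨c, hc, h⟩ := h.exists_adjacent
  cases c with
  | zero =>
    obtain ⟨d', -, h1, h2⟩ := exists_capAt_concat (b := 0) (n := i) d h
    exact Or.inl ⟨d', h1, h2⟩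
  | succ b => exact Or.inr (exists_addStrand_concat d hc h)

theorem HasCup.exists_concat {d : Diagram j (i + 2)} (h : d.HasCup) :
    (∃ d' : Diagram j i, d = d'.concat (cap i).flip ∧ loops d' (cap i).flip = 0) ∨
      ∃ (m : ℕ) (e : Diagram m (i + 1)) (d' : Diagram j (m + 1)), e.HasCup ∧
        d = d'.concat e.addStrand ∧ loops d' e.addStrand = 0 := by
  rcases (flip_hasCap.2 h).exists_concat with ⟨d', h1, h2⟩ | ⟨m, e, d', h0, h1, h2⟩
  · obtain ⟨e1, e2⟩ := flip_concat' (cap i) d'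
    exact Or.inl ⟨d'.flip, by rw [e2, ← h1, flip_flip], e1.trans h2⟩
  · obtain ⟨e1, e2⟩ := flip_concat' e.addStrand d'
    rw [addStrand_flip] at e1 e2
    exact Or.inr ⟨m, e.flip, d'.flip, flip_hasCap.1 (by rwa [flip_flip]),
      by rw [e2, ← h1, flip_flip], e1.trans h2⟩

theorem not_hasCap_of_le_one (d : Diagram i j) (h : i ≤ 1) : ¬ d.HasCap := by
  rintro ⟨a, b, hab⟩
  have : a = b := Fin.ext (by omega)
  subst this
  exact d.partner_ne _ hab

theorem not_hasCup_of_le_one (d : Diagram j i) (h : i ≤ 1) : ¬ d.HasCup :=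
  fun h' => not_hasCap_of_le_one d.flip h (flip_hasCap.2 h')

end Diagram

/-! ### Strands, cups and caps as morphisms -/

namespace TLCat

universe u

variable {R : Type u} [CommRing R] {δ : R} {i j k : ℕ}

theorem hom_induction {X Y : TLCat δ} {P : (X ⟶ Y) → Prop} (f : X ⟶ Y) (zero : P 0)
    (add : ∀ f g, P f → P g → P (f + g))
    (smul : ∀ (r : R) (d : Diagram X.dots Y.dots), P (r • (ofDiagram d : X ⟶ Y))) : P f := by
  refine Finsupp.induction_linear (motive := P) f zero add fun d r => ?_
  have : r • (ofDiagram d : X ⟶ Y) = (Finsupp.single d r : Diagram X.dots Y.dots →₀ R) :=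
    (Finsupp.smul_single r d 1).trans (by rw [smul_eq_mul, mul_one])
  exact this ▸ smul r d

theorem ofDiagram_comp {X Y Z : TLCat δ} (d : Diagram X.dots Y.dots) (e : Diagram Y.dots Z.dots) :
    (ofDiagram d : X ⟶ Y) ≫ (ofDiagram e : Y ⟶ Z) =
      δ ^ loops d e • (ofDiagram (d.concat e) : X ⟶ Z) := by
  refine (comp_single δ d e 1 1).trans ?_
  rw [one_mul, one_mul]
  exact ((Finsupp.smul_single _ _ _).trans (by rw [smul_eq_mul, mul_one])).symm

theorem ofDiagram_comp_of_loops {X Y Z : TLCat δ} {d : Diagram X.dots Y.dots}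
    {e : Diagram Y.dots Z.dots} (h : loops d e = 0) :
    (ofDiagram d : X ⟶ Y) ≫ (ofDiagram e : Y ⟶ Z) = ofDiagram (d.concat e) := by
  rw [ofDiagram_comp, h, pow_zero, one_smul]

theorem ofDiagram_vertical (X : TLCat δ) : (ofDiagram (.vertical rfl) : X ⟶ X) = 𝟙 X := rfl

/-- The coefficient of a diagram in a morphism. -/
noncomputable def coeff {X Y : TLCat δ} (d : Diagram X.dots Y.dots) : (X ⟶ Y) →ₗ[R] R :=
  Finsupp.lapply d

theorem coeff_ofDiagram {X Y : TLCat δ} [DecidableEq (Diagram X.dots Y.dots)]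
    (d e : Diagram X.dots Y.dots) :
    coeff d (ofDiagram e : X ⟶ Y) = if e = d then 1 else 0 :=
  Finsupp.single_apply

/-- A strand added on the left of a morphism. -/
noncomputable def strand (f : (⟨i⟩ : TLCat δ) ⟶ ⟨j⟩) : (⟨i + 1⟩ : TLCat δ) ⟶ ⟨j + 1⟩ :=
  Finsupp.lmapDomain R R Diagram.addStrand f

theorem strand_add (f g : (⟨i⟩ : TLCat δ) ⟶ ⟨j⟩) : strand (f + g) = strand f + strand g :=
  map_add (Finsupp.lmapDomain R R (Diagram.addStrand (i := i) (j := j))) f g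

theorem strand_smul (r : R) (f : (⟨i⟩ : TLCat δ) ⟶ ⟨j⟩) : strand (r • f) = r • strand f :=
  map_smul (Finsupp.lmapDomain R R (Diagram.addStrand (i := i) (j := j))) r f

theorem strand_zero : strand (0 : (⟨i⟩ : TLCat δ) ⟶ ⟨j⟩) = 0 :=
  map_zero (Finsupp.lmapDomain R R (Diagram.addStrand (i := i) (j := j)))

theorem strand_sub (f g : (⟨i⟩ : TLCat δ) ⟶ ⟨j⟩) : strand (f - g) = strand f - strand g :=
  map_sub (Finsupp.lmapDomain R R (Diagram.addStrand (i := i) (j := j))) f g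

theorem strand_ofDiagram (d : Diagram i j) :
    strand (ofDiagram d : (⟨i⟩ : TLCat δ) ⟶ ⟨j⟩) = ofDiagram d.addStrand :=
  Finsupp.mapDomain_single

theorem strand_id : strand (𝟙 (⟨i⟩ : TLCat δ)) = 𝟙 _ := by
  rw [← ofDiagram_vertical, strand_ofDiagram]
  exact congrArg _ (Diagram.addStrand_vertical rfl)

theorem strand_comp (f : (⟨i⟩ : TLCat δ) ⟶ ⟨j⟩) (g : (⟨j⟩ : TLCat δ) ⟶ ⟨k⟩) :
    strand (f ≫ g) = strand f ≫ strand g := by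
  induction f using hom_induction with
  | zero => rw [Limits.zero_comp, strand_zero, strand_zero, Limits.zero_comp]
  | add f f' h h' => rw [Preadditive.add_comp, strand_add, strand_add, h, h', Preadditive.add_comp]
  | smul r d =>
  induction g using hom_induction with
  | zero => rw [Limits.comp_zero, strand_zero, strand_zero, Limits.comp_zero]
  | add f f' h h' => rw [Preadditive.comp_add, strand_add, strand_add, h, h', Preadditive.comp_add]
  | smul s e =>
  obtain ⟨h1, h2⟩ := Diagram.addStrand_concat' d e
  rw [Linear.smul_comp, Linear.comp_smul, strand_smul, strand_smul, strand_smul, strand_smul,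
    Linear.smul_comp, Linear.comp_smul, ofDiagram_comp, strand_smul, strand_ofDiagram,
    strand_ofDiagram, strand_ofDiagram, ofDiagram_comp, h1, h2]

theorem coeff_strand (f : (⟨i⟩ : TLCat δ) ⟶ ⟨i⟩) :
    coeff (.vertical rfl) (strand f) = coeff (.vertical rfl) f := by
  refine Eq.trans ?_ (Finsupp.mapDomain_apply Diagram.addStrand_injective f _)
  rw [Diagram.addStrand_vertical]
  rfl

/-- The cap that joins the first two strands. -/
noncomputable def cap (n : ℕ) : (⟨n + 2⟩ : TLCat δ) ⟶ ⟨n⟩ := ofDiagram (Diagram.cap n)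

/-- The cup that joins the first two strands. -/
noncomputable def cup (n : ℕ) : (⟨n⟩ : TLCat δ) ⟶ ⟨n + 2⟩ := ofDiagram (Diagram.cap n).flip

theorem cup_cap (n : ℕ) : (cup n ≫ cap n : (⟨n⟩ : TLCat δ) ⟶ ⟨n⟩) = δ • 𝟙 _ := by
  obtain ⟨h1, h2⟩ := Diagram.cup_concat_cap' n
  rw [cup, cap, ofDiagram_comp, h1, h2, pow_one]
  rfl

theorem strand_cup_cap (n : ℕ) :
    (strand (cup n) ≫ cap (n + 1) : (⟨n + 1⟩ : TLCat δ) ⟶ ⟨n + 1⟩) = 𝟙 _ := by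
  obtain ⟨h1, h2⟩ := Diagram.zigzag_cap' n
  rw [cup, cap, strand_ofDiagram, ofDiagram_comp_of_loops h1, h2]
  rfl

theorem cup_strand_cap (n : ℕ) :
    (cup (n + 1) ≫ strand (cap n) : (⟨n + 1⟩ : TLCat δ) ⟶ ⟨n + 1⟩) = 𝟙 _ := by
  obtain ⟨h1, h2⟩ := Diagram.zigzag_cup' n
  rw [cup, cap, strand_ofDiagram, ofDiagram_comp_of_loops h1, h2]
  rfl

theorem strand_strand_cap (f : (⟨i⟩ : TLCat δ) ⟶ ⟨j⟩) :
    strand (strand f) ≫ cap j = cap i ≫ f := by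
  induction f using hom_induction with
  | zero => rw [strand_zero, strand_zero, Limits.zero_comp, Limits.comp_zero]
  | add f f' h h' => rw [Preadditive.comp_add, strand_add, strand_add, Preadditive.add_comp, h, h']
  | smul r d =>
  obtain ⟨⟨h1, h2⟩, h3⟩ := Diagram.cap_concat' d
  rw [strand_smul, strand_smul, Linear.smul_comp, Linear.comp_smul, strand_ofDiagram,
    strand_ofDiagram, cap, cap, ofDiagram_comp_of_loops h1, ofDiagram_comp_of_loops h2, h3]

theorem cup_strand_strand (f : (⟨i⟩ : TLCat δ) ⟶ ⟨j⟩) :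
    cup i ≫ strand (strand f) = f ≫ cup j := by
  induction f using hom_induction with
  | zero => rw [strand_zero, strand_zero, Limits.zero_comp, Limits.comp_zero]
  | add f f' h h' => rw [Preadditive.add_comp, strand_add, strand_add, Preadditive.comp_add, h, h']
  | smul r d =>
  obtain ⟨⟨h1, h2⟩, h3⟩ := Diagram.concat_cup' d
  rw [strand_smul, strand_smul, Linear.smul_comp, Linear.comp_smul, strand_ofDiagram,
    strand_ofDiagram, cup, cup, ofDiagram_comp_of_loops h1, ofDiagram_comp_of_loops h2, h3]

theorem strand_cup_cap_assoc (n : ℕ) {X : TLCat δ} (f : ⟨n + 1⟩ ⟶ X) :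
    strand (cup n) ≫ cap (n + 1) ≫ f = f := by
  rw [← Category.assoc, strand_cup_cap, Category.id_comp]

theorem cup_strand_cap_assoc (n : ℕ) {X : TLCat δ} (f : ⟨n + 1⟩ ⟶ X) :
    cup (n + 1) ≫ strand (cap n) ≫ f = f := by
  rw [← Category.assoc, cup_strand_cap, Category.id_comp]

theorem cup_strand_strand_assoc (f : (⟨i⟩ : TLCat δ) ⟶ ⟨j⟩) {X : TLCat δ} (g : ⟨j + 2⟩ ⟶ X) :
    cup i ≫ strand (strand f) ≫ g = f ≫ cup j ≫ g := by
  rw [← Category.assoc, cup_strand_strand, Category.assoc]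

/-- The trace over the first strand. -/
noncomputable def partialTrace (f : (⟨i + 1⟩ : TLCat δ) ⟶ ⟨j + 1⟩) : (⟨i⟩ : TLCat δ) ⟶ ⟨j⟩ :=
  cup i ≫ strand f ≫ cap j

/-- An endomorphism of `n` strands that factors through fewer strands has no vertical part. -/
theorem coeff_comp_of_lt (h : j < i) (f : (⟨i⟩ : TLCat δ) ⟶ ⟨j⟩) (g : (⟨j⟩ : TLCat δ) ⟶ ⟨i⟩) :
    coeff (.vertical rfl) (f ≫ g) = 0 := by
  classical
  induction f using hom_induction with
  | zero => rw [Limits.zero_comp, map_zero]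
  | add f f' h h' => rw [Preadditive.add_comp, map_add, h, h', add_zero]
  | smul r d =>
  induction g using hom_induction with
  | zero => rw [Limits.comp_zero, map_zero]
  | add f f' h h' => rw [Preadditive.comp_add, map_add, h, h', add_zero]
  | smul s e =>
  rw [Linear.smul_comp, Linear.comp_smul, ofDiagram_comp, map_smul, map_smul, map_smul,
    coeff_ofDiagram, if_neg, smul_zero, smul_zero, smul_zero]
  intro e'
  exact Diagram.not_hasCap_vertical _ (e' ▸ Diagram.concat_hasCap e (d.hasCap_of_lt h))

/-- If `f` is annihilated by all diagrams with a cap, then composition with `f` only sees the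
vertical part of a morphism. -/
theorem comp_eq_coeff_smul {X : TLCat δ} {f : X ⟶ ⟨i⟩}
    (h : ∀ d : Diagram i i, d.HasCap → f ≫ (ofDiagram d : (⟨i⟩ : TLCat δ) ⟶ ⟨i⟩) = 0)
    (g : (⟨i⟩ : TLCat δ) ⟶ ⟨i⟩) : f ≫ g = coeff (.vertical rfl) g • f := by
  classical
  induction g using hom_induction with
  | zero => rw [Limits.comp_zero, map_zero, zero_smul]
  | add f f' h h' => rw [Preadditive.comp_add, map_add, h, h', add_smul]
  | smul r d =>
  rw [Linear.comp_smul, map_smul, coeff_ofDiagram]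
  split_ifs with hd
  · subst hd
    rw [ofDiagram_vertical, Category.comp_id, smul_eq_mul, mul_one]
  · rw [h d (by by_contra h'; exact hd (Diagram.eq_vertical_of_not_hasCap h'))]
    simp

theorem comp_eq_coeff_smul' {X : TLCat δ} {f : ⟨i⟩ ⟶ X}
    (h : ∀ d : Diagram i i, d.HasCup → (ofDiagram d : (⟨i⟩ : TLCat δ) ⟶ ⟨i⟩) ≫ f = 0)
    (g : (⟨i⟩ : TLCat δ) ⟶ ⟨i⟩) : g ≫ f = coeff (.vertical rfl) g • f := by
  classical
  induction g using hom_induction with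
  | zero => rw [Limits.zero_comp, map_zero, zero_smul]
  | add f f' h h' => rw [Preadditive.add_comp, map_add, h, h', add_smul]
  | smul r d =>
  rw [Linear.smul_comp, map_smul, coeff_ofDiagram]
  split_ifs with hd
  · subst hd
    rw [ofDiagram_vertical, Category.id_comp, smul_eq_mul, mul_one]
  · rw [h d (by by_contra h'; exact hd (Diagram.eq_vertical_of_not_hasCup h'))]
    simp

/-! ### Jones–Wenzl idempotents -/

section JonesWenzl

variable {k : Type u} [Field k] {δ : k} {i j n : ℕ}

/-- The scalars by which the partial trace multiplies the Jones–Wenzl idempotents. The value `0` at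
`0` serves to start the recursion with `δ`, since `0⁻¹ = 0`. -/
def traceRatio (δ : k) : ℕ → k
  | 0 => 0
  | n + 1 => δ - (traceRatio δ n)⁻¹

/-- Wenzl's recursion for the Jones–Wenzl idempotents. It yields idempotents as long as the trace
ratios it divides by do not vanish. -/
noncomputable def jonesWenzl (δ : k) : ∀ n : ℕ, (⟨n⟩ : TLCat δ) ⟶ ⟨n⟩
  | 0 => 𝟙 _
  | 1 => 𝟙 _
  | n + 2 => strand (jonesWenzl δ (n + 1)) - (traceRatio δ (n + 1))⁻¹ •
      (strand (jonesWenzl δ (n + 1)) ≫ cap n ≫ cup n ≫ strand (jonesWenzl δ (n + 1)))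

theorem coeff_jonesWenzl (n : ℕ) : coeff (.vertical rfl) (jonesWenzl δ n) = 1 := by
  classical
  induction n with
  | zero =>
    rw [jonesWenzl, ← ofDiagram_vertical, coeff_ofDiagram, if_pos rfl]
  | succ n ih =>
  cases n with
  | zero => rw [jonesWenzl, ← ofDiagram_vertical, coeff_ofDiagram, if_pos rfl]
  | succ n =>
    rw [jonesWenzl, map_sub, map_smul, coeff_strand, ih, ← Category.assoc,
      coeff_comp_of_lt (by omega), smul_zero, sub_zero]

theorem jonesWenzl_ne_zero (n : ℕ) : jonesWenzl δ n ≠ 0 := by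
  intro h
  have := coeff_jonesWenzl (δ := δ) n
  rw [h, map_zero] at this
  exact zero_ne_one this

/-- `f` is annihilated by all diagrams with a cap. -/
def KillsCaps {X : TLCat δ} (f : X ⟶ ⟨i⟩) : Prop :=
  ∀ (j : ℕ) (d : Diagram i j), d.HasCap → f ≫ (ofDiagram d : (⟨i⟩ : TLCat δ) ⟶ ⟨j⟩) = 0

/-- `f` is annihilated by all diagrams with a cup. -/
def KillsCups {X : TLCat δ} (f : ⟨i⟩ ⟶ X) : Prop :=
  ∀ (j : ℕ) (d : Diagram j i), d.HasCup → (ofDiagram d : (⟨j⟩ : TLCat δ) ⟶ ⟨i⟩) ≫ f = 0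

theorem KillsCaps.comp_eq {X : TLCat δ} {f : X ⟶ ⟨i⟩} (h : KillsCaps f)
    (g : (⟨i⟩ : TLCat δ) ⟶ ⟨i⟩) : f ≫ g = coeff (.vertical rfl) g • f :=
  comp_eq_coeff_smul (h i) g

theorem KillsCups.comp_eq {X : TLCat δ} {f : ⟨i⟩ ⟶ X} (h : KillsCups f)
    (g : (⟨i⟩ : TLCat δ) ⟶ ⟨i⟩) : g ≫ f = coeff (.vertical rfl) g • f :=
  comp_eq_coeff_smul' (h i) g

/-- It suffices to test caps on the first two strands and caps that avoid the first strand. -/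
theorem killsCaps_of_cap {X : TLCat δ} {f : X ⟶ ⟨i + 2⟩} (h0 : f ≫ cap i = 0)
    (h1 : ∀ (m : ℕ) (e : Diagram (i + 1) m), e.HasCap →
      f ≫ strand (ofDiagram e : (⟨i + 1⟩ : TLCat δ) ⟶ ⟨m⟩) = 0) : KillsCaps f := by
  intro j d hd
  rcases hd.exists_concat with ⟨d', rfl, h2⟩ | ⟨m, e, d', he, rfl, h2⟩
  · rw [← ofDiagram_comp_of_loops (Y := ⟨i⟩) h2, ← Category.assoc]
    exact (congrArg (· ≫ _) h0).trans Limits.zero_comp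
  · rw [← ofDiagram_comp_of_loops (Y := ⟨m + 1⟩) h2, ← Category.assoc, ← strand_ofDiagram, h1 m e he,
      Limits.zero_comp]

theorem killsCups_of_cup {X : TLCat δ} {f : ⟨i + 2⟩ ⟶ X} (h0 : cup i ≫ f = 0)
    (h1 : ∀ (m : ℕ) (e : Diagram m (i + 1)), e.HasCup →
      strand (ofDiagram e : (⟨m⟩ : TLCat δ) ⟶ ⟨i + 1⟩) ≫ f = 0) : KillsCups f := by
  intro j d hd
  rcases hd.exists_concat with ⟨d', rfl, h2⟩ | ⟨m, e, d', he, rfl, h2⟩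
  · rw [← ofDiagram_comp_of_loops (Y := ⟨i⟩) h2, Category.assoc]
    exact (congrArg (_ ≫ ·) h0).trans Limits.comp_zero
  · rw [← ofDiagram_comp_of_loops (Y := ⟨m + 1⟩) h2, Category.assoc, ← strand_ofDiagram, h1 m e he,
      Limits.comp_zero]

theorem partialTrace_jonesWenzl (h1 : KillsCaps (jonesWenzl δ (n + 1))) :
    partialTrace (jonesWenzl δ (n + 2)) = traceRatio δ (n + 2) • jonesWenzl δ (n + 1) := by
  have e1 : cup (n + 1) ≫ strand (strand (jonesWenzl δ (n + 1))) ≫ cap (n + 1) =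
      δ • jonesWenzl δ (n + 1) := by
    rw [cup_strand_strand_assoc, cup_cap, Linear.comp_smul, Category.comp_id]
  have e2 : cup (n + 1) ≫ strand (strand (jonesWenzl δ (n + 1)) ≫ cap n ≫ cup n ≫
      strand (jonesWenzl δ (n + 1))) ≫ cap (n + 1) = jonesWenzl δ (n + 1) := by
    simp only [strand_comp, Category.assoc]
    rw [strand_strand_cap, cup_strand_strand_assoc, cup_strand_cap_assoc, strand_cup_cap_assoc,
      h1.comp_eq, coeff_jonesWenzl, one_smul]
  rw [partialTrace, jonesWenzl, strand_sub, strand_smul, Preadditive.sub_comp,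
    Preadditive.comp_sub, Linear.smul_comp, Linear.comp_smul, e1, e2,
    show traceRatio δ (n + 2) = δ - (traceRatio δ (n + 1))⁻¹ from rfl, sub_smul]

theorem strand_jonesWenzl_comp_cap (h1 : KillsCaps (jonesWenzl δ (n + 1))) :
    strand (jonesWenzl δ (n + 1)) ≫ cap n ≫ jonesWenzl δ n =
      strand (jonesWenzl δ (n + 1)) ≫ cap n := by
  rw [← strand_strand_cap, ← Category.assoc, ← strand_comp, h1.comp_eq, coeff_strand,
    coeff_jonesWenzl, one_smul]

/-- As long as the trace ratios do not vanish, Wenzl's recursion yields morphisms that are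
annihilated by caps and cups, and the partial trace multiplies them with the trace ratios. -/
theorem jonesWenzl_aux (n : ℕ) (hn : ∀ m, 0 < m → m ≤ n → traceRatio δ m ≠ 0) :
    (KillsCaps (jonesWenzl δ n) ∧ KillsCups (jonesWenzl δ n)) ∧
    (KillsCaps (jonesWenzl δ (n + 1)) ∧ KillsCups (jonesWenzl δ (n + 1))) ∧
    partialTrace (jonesWenzl δ (n + 1)) = traceRatio δ (n + 1) • jonesWenzl δ n := by
  induction n with
  | zero =>
    refine ⟨⟨?_, ?_⟩, ⟨?_, ?_⟩, ?_⟩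
    · exact fun j d h => absurd h (d.not_hasCap_of_le_one (by omega))
    · exact fun j d h => absurd h (d.not_hasCup_of_le_one (by omega))
    · exact fun j d h => absurd h (d.not_hasCap_of_le_one (by omega))
    · exact fun j d h => absurd h (d.not_hasCup_of_le_one (by omega))
    · rw [partialTrace, jonesWenzl, jonesWenzl, strand_id, Category.id_comp, cup_cap]
      simp [traceRatio]
  | succ n ih =>
    obtain ⟨⟨-, -⟩, ⟨h1, h2⟩, h3⟩ := ih fun m h h' => hn m h (by omega)
    have h0 := hn (n + 1) (by omega) le_rfl
    have a1 := strand_jonesWenzl_comp_cap h1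
    have a2 : jonesWenzl δ n ≫ cup n ≫ strand (jonesWenzl δ (n + 1)) =
        cup n ≫ strand (jonesWenzl δ (n + 1)) := by
      rw [← cup_strand_strand_assoc, ← strand_comp, h2.comp_eq, coeff_strand,
        coeff_jonesWenzl, one_smul]
    rw [partialTrace] at h3
    refine ⟨⟨h1, h2⟩, ⟨killsCaps_of_cap ?_ ?_, killsCups_of_cup ?_ ?_⟩,
      partialTrace_jonesWenzl h1⟩
    · rw [jonesWenzl, Preadditive.sub_comp, Linear.smul_comp]
      simp only [Category.assoc]
      rw [h3, Linear.comp_smul, Linear.comp_smul, a1, smul_smul, inv_mul_cancel₀ h0, one_smul,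
        sub_self]
    · intro m e he
      have : strand (jonesWenzl δ (n + 1)) ≫ strand (ofDiagram e : _ ⟶ ⟨m⟩) = 0 := by
        rw [← strand_comp, h1 _ _ he, strand_zero]
      rw [jonesWenzl, Preadditive.sub_comp, Linear.smul_comp]
      simp only [Category.assoc, this, Limits.comp_zero, smul_zero, sub_zero]
    · rw [jonesWenzl, Preadditive.comp_sub, Linear.comp_smul]
      have : cup n ≫ strand (jonesWenzl δ (n + 1)) ≫ cap n ≫ cup n ≫
          strand (jonesWenzl δ (n + 1)) =
          traceRatio δ (n + 1) • cup n ≫ strand (jonesWenzl δ (n + 1)) := by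
        rw [← a2, ← Linear.smul_comp, ← h3]
        simp only [Category.assoc]
        rw [a2]
      rw [this, smul_smul, inv_mul_cancel₀ h0, one_smul, sub_self]
    · intro m e he
      have : strand (ofDiagram e : (⟨m⟩ : TLCat δ) ⟶ _) ≫ strand (jonesWenzl δ (n + 1)) = 0 := by
        rw [← strand_comp, h2 _ _ he, strand_zero]
      rw [jonesWenzl, Preadditive.comp_sub, Linear.comp_smul, this,
        ← Category.assoc (strand (ofDiagram e)), this]
      simp

end JonesWenzl

end TLCat

namespace TLCat

universe u

section Trace

variable {R : Type u} [CommRing R] {δ : R} {i j n : ℕ}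

/-! ### Ideals and strands -/

/-- The strand added on the left is an identity tensored from the left. The vertical diagrams only
identify `i + 1` with `1 + i`. -/
theorem strand_eq_whiskerLeft (f : (⟨i⟩ : TLCat δ) ⟶ ⟨j⟩) :
    strand f = (ofDiagram (.vertical (Nat.add_comm i 1)) : (⟨i + 1⟩ : TLCat δ) ⟶ ⟨1⟩ ⊗ ⟨i⟩) ≫
      (⟨1⟩ : TLCat δ) ◁ f ≫
        (ofDiagram (.vertical (Nat.add_comm 1 j)) : ⟨1⟩ ⊗ ⟨j⟩ ⟶ (⟨j + 1⟩ : TLCat δ)) := by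
  induction f using hom_induction with
  | zero => rw [strand_zero, MonoidalPreadditive.whiskerLeft_zero, Limits.zero_comp,
      Limits.comp_zero]
  | add f f' h h' => rw [strand_add, MonoidalPreadditive.whiskerLeft_add, Preadditive.add_comp,
      Preadditive.comp_add, h, h']
  | smul r d =>
    rw [strand_smul, MonoidalLinear.whiskerLeft_smul, Linear.smul_comp, Linear.comp_smul,
      strand_ofDiagram]
    have e : (⟨1⟩ : TLCat δ) ◁ (ofDiagram d : (⟨i⟩ : TLCat δ) ⟶ ⟨j⟩) =
        ofDiagram ((Diagram.vertical rfl).juxtapose d) :=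
      (tensor_single _ _ _ _).trans (by rw [mul_one]; rfl)
    have h := Diagram.vertical_juxtapose_concat d
    have h' : (Diagram.vertical (Nat.add_comm i 1)).concat
        ((Diagram.vertical (Nat.add_comm 1 i)).concat d.addStrand) = d.addStrand := by
      rw [← (concat_assoc' _ _ _).2, vertical_concat_vertical]
      exact (vertical_concat' _).2
    rw [e, ofDiagram_comp_of_loops (loops_vertical_right _ _),
      ofDiagram_comp_of_loops (loops_vertical_left _ _)]
    congr 2
    exact (congrArg _ h |>.trans h').symm

theorem strand_mem {I : LeftTensorIdeal (TLCat δ)} {f : (⟨i⟩ : TLCat δ) ⟶ ⟨j⟩}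
    (hf : f ∈ I.mor _ _) : strand f ∈ I.mor _ _ := by
  rw [strand_eq_whiskerLeft]
  exact I.comp_mem_right _ _ (I.comp_mem_left _ _ (I.whiskerLeft_mem _ _ hf))

theorem partialTrace_mem {I : LeftTensorIdeal (TLCat δ)} {f : (⟨i + 1⟩ : TLCat δ) ⟶ ⟨j + 1⟩}
    (hf : f ∈ I.mor _ _) : partialTrace f ∈ I.mor _ _ :=
  I.comp_mem_right _ _ (I.comp_mem_left _ _ (strand_mem hf))

theorem smul_mem {I : LeftTensorIdeal (TLCat δ)} {X Y : TLCat δ} {f : X ⟶ Y}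
    (hf : f ∈ I.mor X Y) (r : R) : r • f ∈ I.mor X Y := by
  have := I.comp_mem_left f (r • 𝟙 Y) hf
  rwa [Linear.comp_smul, Category.comp_id] at this

/-- Endomorphisms of the unit are scalars. -/
theorem unit_end_eq (f : 𝟙_ (TLCat δ) ⟶ 𝟙_ (TLCat δ)) :
    f = coeff (X := 𝟙_ (TLCat δ)) (Y := 𝟙_ (TLCat δ)) (.vertical rfl) f • 𝟙 _ := by
  have := comp_eq_coeff_smul (i := 0) (f := 𝟙 (⟨0⟩ : TLCat δ))
    (fun d h => absurd h (d.not_hasCap_of_le_one (by omega))) f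
  rwa [Category.id_comp] at this

/-! ### The trace -/

theorem closedTrace_add {X : TLCat δ} (f g : X ⟶ X) :
    closedTrace (f + g) = closedTrace f + closedTrace g := by
  rw [closedTrace, MonoidalPreadditive.whiskerLeft_add, Preadditive.add_comp,
    Preadditive.comp_add]
  rfl

theorem closedTrace_smul {X : TLCat δ} (r : R) (f : X ⟶ X) :
    closedTrace (r • f) = r • closedTrace f := by
  rw [closedTrace, MonoidalLinear.whiskerLeft_smul, Linear.smul_comp, Linear.comp_smul]
  rfl

theorem closedTrace_zero {X : TLCat δ} : closedTrace (0 : X ⟶ X) = 0 := by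
  rw [closedTrace, MonoidalPreadditive.whiskerLeft_zero, Limits.zero_comp, Limits.comp_zero]

theorem mat_concat_concat {i j k m : ℕ} (d : Diagram i j) (e : Diagram j k) (f : Diagram k m) :
    mat d * (mat e * mat f) =
      2 ^ (loops e f + loops d (e.concat f)) • mat (d.concat (e.concat f)) := by
  rw [mat_concat, Matrix.mul_smul, mat_concat, smul_smul, ← pow_add]

/-- The number of loops in the closure of a diagram is determined by the trace of its matrix. -/
theorem closedTrace_ofDiagram (d : Diagram n n) :
    ∃ c : ℕ, closedTrace (ofDiagram d : (⟨n⟩ : TLCat δ) ⟶ ⟨n⟩) = δ ^ c • 𝟙 _ ∧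
      2 ^ c = ∑ x, mat d x x := by
  have e : (⟨n⟩ : TLCat δ) ◁ (ofDiagram d : (⟨n⟩ : TLCat δ) ⟶ ⟨n⟩) =
      ofDiagram ((Diagram.vertical rfl).juxtapose d) :=
    (tensor_single _ _ _ _).trans (by rw [mul_one]; rfl)
  have e1 : closedTrace (ofDiagram d : (⟨n⟩ : TLCat δ) ⟶ ⟨n⟩) =
      (ofDiagram (Diagram.cups n) : (⟨0⟩ : TLCat δ) ⟶ ⟨n + n⟩) ≫
        (ofDiagram ((Diagram.vertical rfl).juxtapose d) : (⟨n + n⟩ : TLCat δ) ⟶ ⟨n + n⟩) ≫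
          ofDiagram (Diagram.caps n) := by rw [← e]; rfl
  rw [ofDiagram_comp, Linear.comp_smul, ofDiagram_comp, smul_smul, ← pow_add] at e1
  have e2 : (ofDiagram ((Diagram.cups n).concat
      (((Diagram.vertical rfl).juxtapose d).concat (Diagram.caps n))) : 𝟙_ (TLCat δ) ⟶ _) =
      𝟙 _ := by
    rw [← ofDiagram_vertical]
    congr 1
    ext1; funext p
    rcases p with p | p <;> exact p.elim0
  refine ⟨_, e1.trans (congrArg _ e2), ?_⟩
  have := congrFun (congrFun (mat_concat_concat (Diagram.cups n)
    ((Diagram.vertical rfl).juxtapose d) (Diagram.caps n)) (fun _ => true)) (fun _ => true)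
  rw [Matrix.smul_apply, mat_true, smul_eq_mul, mul_one] at this
  rw [← this, Matrix.mul_apply, ← (Fin.appendEquiv n n).sum_comp, Fintype.sum_prod_type_right]
  have a1 : ∀ x y : Fin n → Bool, Fin.append x y ∘ Fin.castAdd n = x := by
    intro x y; funext a; exact Fin.append_left x y a
  have a2 : ∀ x y : Fin n → Bool, Fin.append x y ∘ Fin.natAdd n = y := by
    intro x y; funext a; exact Fin.append_right x y a
  have a3 : ∀ x y : Fin n → Bool, x ∘ Fin.rev = y ∘ Fin.rev ↔ x = y := fun x y =>
    Fin.rev_surjective.injective_comp_right.eq_iff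
  refine Finset.sum_congr rfl fun y _ => ?_
  simp only [Matrix.mul_apply, ← (Fin.appendEquiv n n).sum_comp, Fintype.sum_prod_type_right]
  simp [Fin.appendEquiv, mat_cups, mat_caps, mat_juxtapose, a1, a2, mat_vertical_self, a3]

/-- The closure of a diagram can be taken strand by strand. Both sides produce the same loops, which
are counted by traces of matrices. -/
theorem closedTrace_partialTrace (f : (⟨n + 1⟩ : TLCat δ) ⟶ ⟨n + 1⟩) :
    closedTrace (partialTrace f) = closedTrace f := by
  induction f using hom_induction with
  | zero => rw [partialTrace, strand_zero, Limits.zero_comp, Limits.comp_zero, closedTrace_zero,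
      closedTrace_zero]
  | add f f' h h' =>
    rw [closedTrace_add, ← h, ← h', ← closedTrace_add, partialTrace, strand_add,
      Preadditive.add_comp, Preadditive.comp_add]
    rfl
  | smul r d =>
    rw [closedTrace_smul, partialTrace, strand_smul, Linear.smul_comp, Linear.comp_smul,
      closedTrace_smul, strand_ofDiagram, cap, cup, ofDiagram_comp, Linear.comp_smul,
      ofDiagram_comp, smul_smul, ← pow_add, closedTrace_smul]
    congr 1
    obtain ⟨a, ha, ha'⟩ := closedTrace_ofDiagram (δ := δ) d
    obtain ⟨b, hb, hb'⟩ := closedTrace_ofDiagram (δ := δ)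
      ((Diagram.cap n).flip.concat (d.addStrand.concat (Diagram.cap n)))
    rw [ha, hb, smul_smul, ← pow_add]
    congr 2
    refine Nat.pow_right_injective le_rfl ?_
    change 2 ^ _ = 2 ^ _
    rw [ha', pow_add, hb', Finset.mul_sum]
    have h' : ∀ x, 2 ^ (loops d.addStrand (Diagram.cap n) +
        loops (Diagram.cap n).flip (d.addStrand.concat (Diagram.cap n))) *
        mat ((Diagram.cap n).flip.concat (d.addStrand.concat (Diagram.cap n))) x x =
        ∑ a, mat d (Fin.cons a x : Fin (n + 1) → Bool) (Fin.cons a x : Fin (n + 1) → Bool) := by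
      intro x
      have := congrFun (congrFun (mat_concat_concat (Diagram.cap n).flip d.addStrand
        (Diagram.cap n)) x) x
      rw [Matrix.smul_apply, smul_eq_mul] at this
      rw [← this, Matrix.mul_apply]
      simp only [Matrix.mul_apply, Diagram.sum_cons, Diagram.mat_flip, Matrix.transpose_apply,
        Diagram.mat_cap]
      have e : ∀ (a b c c' : Bool) (y z : Fin n → Bool), mat d.addStrand
          (Fin.cons a (Fin.cons b y) : Fin (n + 2) → Bool)
          (Fin.cons c (Fin.cons c' z) : Fin (n + 2) → Bool) = (if a = c then 1 else 0) *
          mat d (Fin.cons b y : Fin (n + 1) → Bool) (Fin.cons c' z : Fin (n + 1) → Bool) :=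
        fun a b c c' y z => Diagram.mat_addStrand d a c _ _
      simp [e, ite_and]
    rw [Finset.sum_congr rfl fun x _ => h' x, Finset.sum_comm, Diagram.sum_cons]

end Trace

section Negligible

variable {k : Type u} [Field k] {δ : k} {i j n : ℕ}

theorem mem_negligibleIdeal_iff_isNegligible {X Y : TLCat δ} (f : X ⟶ Y) :
    f ∈ (negligibleIdeal (TLCat δ)).mor X Y ↔ IsNegligible f :=
  mem_negligibleIdeal_iff_trace (A := X) inferInstance inferInstance f

theorem mem_negligibleIdeal_iff_isBraidedNegligible [BraidedCategory (TLCat δ)] {X Y : TLCat δ}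
    (f : X ⟶ Y) : f ∈ (negligibleIdeal (TLCat δ)).mor X Y ↔ IsBraidedNegligible f :=
  mem_negligibleIdeal_iff_trace (A := (ᘁX : TLCat δ)) inferInstance
    (BraidedCategory.exactPairing_swap (ᘁX : TLCat δ) X) f

/-- A Jones–Wenzl idempotent with vanishing partial trace is negligible: composites with it are
multiples of it, and their traces factor through the partial trace. -/
theorem jonesWenzl_mem_negligibleIdeal (h : KillsCaps (jonesWenzl δ (n + 1)))
    (h0 : partialTrace (jonesWenzl δ (n + 1)) = 0) :
    jonesWenzl δ (n + 1) ∈ (negligibleIdeal (TLCat δ)).mor _ _ := by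
  rw [mem_negligibleIdeal_iff_isNegligible]
  intro g
  rw [h.comp_eq, closedTrace_smul, ← closedTrace_partialTrace, h0, closedTrace_zero, smul_zero]

theorem unit_id_ne_zero : 𝟙 (𝟙_ (TLCat δ)) ≠ 0 := jonesWenzl_ne_zero (δ := δ) 0

/-- A proper ideal consists of negligible morphisms: otherwise it would contain a nonzero scalar. -/
theorem le_negligibleIdeal {I : LeftTensorIdeal (TLCat δ)} {X₀ Y₀ : TLCat δ} {f₀ : X₀ ⟶ Y₀}
    (hI : f₀ ∉ I.mor X₀ Y₀) (X Y : TLCat δ) : I.mor X Y ≤ (negligibleIdeal (TLCat δ)).mor X Y := by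
  intro f hf Z g h
  have h1 : g ≫ Z ◁ f ≫ h ∈ I.mor _ _ :=
    I.comp_mem_right _ _ (I.comp_mem_left _ _ (I.whiskerLeft_mem _ _ hf))
  by_contra h2
  rw [unit_end_eq (g ≫ Z ◁ f ≫ h)] at h1 h2
  have h3 := left_ne_zero_of_smul h2
  have := smul_mem h1 (coeff (X := 𝟙_ (TLCat δ)) (Y := 𝟙_ (TLCat δ)) (.vertical rfl)
    (g ≫ Z ◁ f ≫ h))⁻¹
  rw [smul_smul, inv_mul_cancel₀ h3, one_smul] at this
  exact hI (I.mem_of_unit_mem this f₀)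

/-- Iterated partial traces turn the Jones–Wenzl idempotent into a nonzero scalar, so it is not
negligible. -/
theorem jonesWenzl_notMem_negligibleIdeal (n : ℕ)
    (hn : ∀ m, 0 < m → m ≤ n → traceRatio δ m ≠ 0) :
    jonesWenzl δ n ∉ (negligibleIdeal (TLCat δ)).mor _ _ := by
  induction n with
  | zero => exact unit_notMem_negligibleIdeal unit_id_ne_zero
  | succ n ih =>
    intro h
    have h1 := partialTrace_mem h
    rw [(jonesWenzl_aux n fun m h1 h2 => hn m h1 (by omega)).2.2] at h1
    have := smul_mem h1 (traceRatio δ (n + 1))⁻¹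
    rw [smul_smul, inv_mul_cancel₀ (hn _ (by omega) le_rfl), one_smul] at this
    exact ih (fun m h1 h2 => hn m h1 (by omega)) this

/-- Between different Jones–Wenzl idempotents there are no morphisms. -/
theorem jonesWenzl_comp_comp (h : i ≠ j) {X Y : TLCat δ} {p : X ⟶ ⟨i⟩} {p' : ⟨j⟩ ⟶ Y}
    (h1 : KillsCaps p) (h2 : KillsCups p') (g : (⟨i⟩ : TLCat δ) ⟶ ⟨j⟩) :
    p ≫ g ≫ p' = 0 := by
  induction g using hom_induction with
  | zero => simp
  | add f f' h h' => rw [Preadditive.add_comp, Preadditive.comp_add, h, h', add_zero]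
  | smul r d =>
    rw [Linear.smul_comp, Linear.comp_smul]
    rcases lt_or_gt_of_ne h with h | h
    · rw [h2 _ _ (d.hasCup_of_lt h), Limits.comp_zero, smul_zero]
    · rw [← Category.assoc, h1 _ _ (d.hasCap_of_lt h), Limits.zero_comp, smul_zero]

/-- Morphisms that factor through a Jones–Wenzl idempotent on at most `n` strands, up to sums. -/
noncomputable def jonesWenzlSpan (δ : k) (n : ℕ) (X Y : TLCat δ) : AddSubgroup (X ⟶ Y) :=
  AddSubgroup.closure {f | ∃ i ≤ n, ∃ (a : X ⟶ ⟨i⟩) (b : ⟨i⟩ ⟶ Y), f = a ≫ jonesWenzl δ i ≫ b}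

theorem comp_mem_jonesWenzlSpan {X Y Z W : TLCat δ} (g : X ⟶ Y) {f : Y ⟶ Z}
    (hf : f ∈ jonesWenzlSpan δ n Y Z) (h : Z ⟶ W) : g ≫ f ≫ h ∈ jonesWenzlSpan δ n X W := by
  refine AddSubgroup.closure_induction ?_ ?_ ?_ ?_ hf
  · rintro _ ⟨i, hi, a, b, rfl⟩
    exact AddSubgroup.subset_closure ⟨i, hi, g ≫ a, b ≫ h, by simp⟩
  · rw [Limits.zero_comp, Limits.comp_zero]; exact zero_mem _
  · intro x y _ _ hx hy
    rw [Preadditive.add_comp, Preadditive.comp_add]; exact add_mem hx hy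
  · intro x _ hx
    rw [Preadditive.neg_comp, Preadditive.comp_neg]; exact neg_mem hx

/-- Modulo an ideal that contains the Jones–Wenzl idempotent on `n + 1` strands, every identity is
a sum of morphisms that factor through Jones–Wenzl idempotents on at most `n` strands. -/
theorem id_mem_sup {I : LeftTensorIdeal (TLCat δ)}
    (hn : ∀ m, 0 < m → m ≤ n → traceRatio δ m ≠ 0)
    (hI : jonesWenzl δ (n + 1) ∈ I.mor _ _) (m : ℕ) :
    𝟙 (⟨m⟩ : TLCat δ) ∈ I.mor ⟨m⟩ ⟨m⟩ ⊔ jonesWenzlSpan δ n ⟨m⟩ ⟨m⟩ := by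
  induction m with
  | zero =>
    refine AddSubgroup.mem_sup_right (AddSubgroup.subset_closure ⟨0, by omega, 𝟙 _, 𝟙 _, ?_⟩)
    rw [jonesWenzl]; simp
  | succ m ih =>
    obtain ⟨w, hw, s, hs, hws⟩ := AddSubgroup.mem_sup.1 ih
    rw [← strand_id, ← hws, strand_add]
    refine add_mem (AddSubgroup.mem_sup_left (strand_mem hw)) ?_
    clear hws
    refine AddSubgroup.closure_induction ?_ ?_ ?_ ?_ hs
    · rintro _ ⟨i, hi, a, b, rfl⟩
      rw [strand_comp, strand_comp]
      have key : strand (jonesWenzl δ i) ∈ I.mor ⟨i + 1⟩ ⟨i + 1⟩ ⊔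
          jonesWenzlSpan δ n ⟨i + 1⟩ ⟨i + 1⟩ := by
        have h1 : jonesWenzl δ (i + 1) ∈ I.mor ⟨i + 1⟩ ⟨i + 1⟩ ⊔
            jonesWenzlSpan δ n ⟨i + 1⟩ ⟨i + 1⟩ := by
          rcases hi.eq_or_lt with rfl | hi
          · exact AddSubgroup.mem_sup_left hI
          · refine AddSubgroup.mem_sup_right (AddSubgroup.subset_closure
              ⟨i + 1, by omega, 𝟙 _, 𝟙 _, by simp⟩)
        cases i with
        | zero => rwa [jonesWenzl, strand_id]
        | succ i =>
          have hk := (jonesWenzl_aux i fun m h h' => hn m h (by omega)).2.1.1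
          have e := sub_add_cancel (strand (jonesWenzl δ (i + 1))) ((traceRatio δ (i + 1))⁻¹ •
            (strand (jonesWenzl δ (i + 1)) ≫ cap i ≫ cup i ≫ strand (jonesWenzl δ (i + 1))))
          rw [← e]
          refine add_mem h1 (AddSubgroup.mem_sup_right (AddSubgroup.subset_closure
            ⟨i, by omega, (traceRatio δ (i + 1))⁻¹ • (strand (jonesWenzl δ (i + 1)) ≫ cap i),
              cup i ≫ strand (jonesWenzl δ (i + 1)), ?_⟩))
          rw [Linear.smul_comp, ← Category.assoc (strand _ ≫ cap i),
            Category.assoc (strand _) (cap i), strand_jonesWenzl_comp_cap hk, Category.assoc]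
      obtain ⟨w, hw, s, hs, hws⟩ := AddSubgroup.mem_sup.1 key
      rw [← hws, Preadditive.add_comp, Preadditive.comp_add]
      refine add_mem (AddSubgroup.mem_sup_left
        (I.comp_mem_right _ _ (I.comp_mem_left _ _ hw))) (AddSubgroup.mem_sup_right
          (comp_mem_jonesWenzlSpan _ hs _))
    · rw [strand_zero]; exact zero_mem _
    · intro x y _ _ hx hy
      rw [strand_add]; exact add_mem hx hy
    · intro x _ hx
      have : strand (-x) = - strand x := by
        rw [eq_neg_iff_add_eq_zero, ← strand_add, neg_add_cancel, strand_zero]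
      rw [this]; exact neg_mem hx

/-- An ideal that contains the Jones–Wenzl idempotent on `n + 1` strands contains all negligible
morphisms, since a negligible multiple of a Jones–Wenzl idempotent on fewer strands vanishes. -/
theorem negligibleIdeal_le {I : LeftTensorIdeal (TLCat δ)}
    (hn : ∀ m, 0 < m → m ≤ n → traceRatio δ m ≠ 0)
    (hI : jonesWenzl δ (n + 1) ∈ I.mor _ _) (X Y : TLCat δ) :
    (negligibleIdeal (TLCat δ)).mor X Y ≤ I.mor X Y := by
  -- composing with the identity, it suffices to treat a morphism that ends in an idempotent
  have red : ∀ (X Y : TLCat δ) (f : X ⟶ Y),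
      (∀ i ≤ n, ∀ a : Y ⟶ ⟨i⟩, f ≫ a ≫ jonesWenzl δ i ∈ I.mor X ⟨i⟩) → f ∈ I.mor X Y := by
    intro X Y f h
    obtain ⟨w, hw, s, hs, hws⟩ := AddSubgroup.mem_sup.1 (id_mem_sup hn hI Y.dots)
    rw [← Category.comp_id f]
    change f ≫ 𝟙 (⟨Y.dots⟩ : TLCat δ) ∈ _
    rw [← hws, Preadditive.comp_add]
    refine add_mem (I.comp_mem_right _ _ hw) ?_
    clear hws
    refine AddSubgroup.closure_induction ?_ ?_ ?_ ?_ hs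
    · rintro _ ⟨i, hi, a, b, rfl⟩
      have := I.comp_mem_left _ b (h i hi a)
      simpa using this
    · rw [Limits.comp_zero]; exact zero_mem _
    · intro x y _ _ hx hy
      rw [Preadditive.comp_add]; exact add_mem hx hy
    · intro x _ hx
      rw [Preadditive.comp_neg]; exact neg_mem hx
  have red' : ∀ (X Y : TLCat δ) (f : X ⟶ Y),
      (∀ i ≤ n, ∀ a : ⟨i⟩ ⟶ X, jonesWenzl δ i ≫ a ≫ f ∈ I.mor ⟨i⟩ Y) → f ∈ I.mor X Y := by
    intro X Y f h
    obtain ⟨w, hw, s, hs, hws⟩ := AddSubgroup.mem_sup.1 (id_mem_sup hn hI X.dots)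
    rw [← Category.id_comp f]
    change 𝟙 (⟨X.dots⟩ : TLCat δ) ≫ f ∈ _
    rw [← hws, Preadditive.add_comp]
    refine add_mem (I.comp_mem_left _ _ hw) ?_
    clear hws
    refine AddSubgroup.closure_induction ?_ ?_ ?_ ?_ hs
    · rintro _ ⟨i, hi, a, b, rfl⟩
      have := I.comp_mem_right a _ (h i hi b)
      simpa using this
    · rw [Limits.zero_comp]; exact zero_mem _
    · intro x y _ _ hx hy
      rw [Preadditive.add_comp]; exact add_mem hx hy
    · intro x _ hx
      rw [Preadditive.neg_comp]; exact neg_mem hx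
  intro f hf
  refine red X Y f fun i hi a => red' _ _ _ fun j hj b => ?_
  have hi' := jonesWenzl_aux i fun m h h' => hn m h (h'.trans hi)
  have hj' := jonesWenzl_aux j fun m h h' => hn m h (h'.trans hj)
  have hmem : jonesWenzl δ j ≫ (b ≫ f ≫ a) ≫ jonesWenzl δ i ∈
      (negligibleIdeal (TLCat δ)).mor ⟨j⟩ ⟨i⟩ := by
    have := (negligibleIdeal (TLCat δ)).comp_mem_right (jonesWenzl δ j ≫ b) _
      ((negligibleIdeal (TLCat δ)).comp_mem_left f (a ≫ jonesWenzl δ i) hf)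
    simpa using this
  suffices h : jonesWenzl δ j ≫ (b ≫ f ≫ a) ≫ jonesWenzl δ i = 0 by
    have e : jonesWenzl δ j ≫ b ≫ f ≫ a ≫ jonesWenzl δ i = 0 := by simpa using h
    rw [e]; exact zero_mem _
  by_cases hij : j = i
  · subst hij
    rw [hi'.1.2.comp_eq, Linear.comp_smul, hi'.1.1.comp_eq, coeff_jonesWenzl, one_smul] at hmem ⊢
    by_contra h0
    have h1 := left_ne_zero_of_smul h0
    have := smul_mem hmem (coeff (.vertical rfl) (b ≫ f ≫ a))⁻¹
    rw [smul_smul, inv_mul_cancel₀ h1, one_smul] at this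
    exact jonesWenzl_notMem_negligibleIdeal j (fun m h h' => hn m h (h'.trans hj)) this
  · exact jonesWenzl_comp_comp hij hj'.1.1 hi'.1.2 _

end Negligible

end TLCat

/-! ### Diagrams without lower dots -/

namespace Diagram

variable {m : ℕ}

/-- The other end of a line of a diagram without lower dots. -/
def mate (d : Diagram 0 m) (a : Fin m) : Fin m :=
  Sum.elim (fun x => x.elim0) id (d.partner (.inr a))

theorem partner_inr (d : Diagram 0 m) (a : Fin m) : d.partner (.inr a) = .inr (d.mate a) := by
  unfold mate
  rcases d.partner (.inr a) with x | x
  · exact x.elim0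
  · rfl

theorem mate_mate (d : Diagram 0 m) (a : Fin m) : d.mate (d.mate a) = a := by
  have := d.partner_partner (.inr a)
  rw [partner_inr, partner_inr] at this
  exact Sum.inr_injective this

theorem mate_ne (d : Diagram 0 m) (a : Fin m) : d.mate a ≠ a := fun h =>
  d.partner_ne (.inr a) (by rw [partner_inr, h])

theorem mate_planar (d : Diagram 0 m) (a b : Fin m) :
    ¬ (a < b ∧ b < d.mate a ∧ d.mate a < d.mate b) := by
  have := d.planar (.inr (d.mate b)) (.inr (d.mate a))
  rw [partner_inr, partner_inr, mate_mate, mate_mate] at this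
  simp only [pos, Fin.lt_def] at *
  omega

theorem ext_mate {d e : Diagram 0 m} (h : ∀ a, d.mate a = e.mate a) : d = e := by
  ext1; funext p
  rcases p with a | a
  · exact a.elim0
  · rw [partner_inr, partner_inr, h]

/-- A planar diagram is determined by the set of right ends of its lines. -/
theorem eq_of_closers {d e : Diagram 0 m} (h : ∀ a, d.mate a < a ↔ e.mate a < a) : d = e := by
  -- If the line of `d` that ends in `c` were longer than that of `e`, then `e.mate c` would be the
  -- left end of a line of `d` that ends before `c`, and by induction also of this line of `e`.
  have key : ∀ (d e : Diagram 0 m), (∀ a, d.mate a < a ↔ e.mate a < a) → ∀ c, d.mate c < c →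
      (∀ c' < c, d.mate c' < c' → d.mate c' = e.mate c') → ¬ d.mate c < e.mate c := by
    intro d e h c hc ih hlt
    have h1 : ¬ d.mate (e.mate c) < e.mate c := by
      rw [h, mate_mate]
      exact fun h' => lt_asymm h' ((h c).1 hc)
    have h2 := d.mate_planar (d.mate c) (e.mate c)
    rw [mate_mate] at h2
    have h3 : d.mate (e.mate c) ≠ c := fun h' => by
      rw [← h', mate_mate] at hlt
      exact lt_irrefl _ (h' ▸ hlt)
    have h4 := d.mate_ne (e.mate c)
    have h5 := (h c).1 hc
    have h6 : d.mate (e.mate c) < c :=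
      lt_of_le_of_ne (not_lt.1 fun h' => h2 ⟨hlt, h5, h'⟩) h3
    have h7 := ih _ h6 (by rw [mate_mate]; exact lt_of_le_of_ne (not_lt.1 h1) h4.symm)
    rw [mate_mate] at h7
    have := e.mate_mate (d.mate (e.mate c))
    rw [← h7, mate_mate] at this
    exact h3 this.symm
  have main : ∀ (n : ℕ) (c : Fin m), (c : ℕ) = n → d.mate c < c → d.mate c = e.mate c := by
    intro n
    induction n using Nat.strong_induction_on with
    | _ n ih =>
    rintro c rfl hc
    have ih' : ∀ c' < c, d.mate c' < c' → d.mate c' = e.mate c' :=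
      fun c' h1 h2 => ih c' h1 c' rfl h2
    refine le_antisymm (not_lt.1 ?_) (not_lt.1 (key d e h c hc ih'))
    exact key e d (fun a => (h a).symm) c ((h c).1 hc) fun c' h1 h2 => (ih' c' h1 ((h c').2 h2)).symm
  refine ext_mate fun a => ?_
  by_cases ha : d.mate a < a
  · exact main _ a rfl ha
  · have h1 : a < d.mate a := lt_of_le_of_ne (not_lt.1 ha) (d.mate_ne a).symm
    have := main _ (d.mate a) rfl (by rwa [mate_mate])
    rw [mate_mate] at this
    rw [this, mate_mate, ← this]

theorem mate_cups (n : ℕ) (a : Fin (n + n)) : (cups n).mate a = a.rev := rfl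

/-- Among the last dots, if they are the majority, two adjacent dots are joined. -/
theorem exists_mate_eq_succ (d : Diagram 0 m) {A : ℕ} (hA : A + A < m) :
    ∃ (c : ℕ) (hc : c + 1 < m), A ≤ c ∧ d.mate ⟨c, by omega⟩ = ⟨c + 1, hc⟩ := by
  -- otherwise the last dots are joined with the first `A` dots, which are too few
  have hex : ∃ a : Fin m, A ≤ a ∧ A ≤ d.mate a := by
    by_contra! h
    have hinj : Function.Injective (fun a : {a : Fin m // A ≤ a} =>
        (⟨d.mate a.1, h a.1 a.2⟩ : Fin A)) := by
      intro a b hab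
      have : d.mate a.1 = d.mate b.1 := Fin.ext (by simpa using hab)
      apply Subtype.ext
      rw [← d.mate_mate a.1, this, mate_mate]
    have h1 := Fintype.card_le_of_injective _ hinj
    have hinj' : Function.Injective (fun b : Fin (m - A) =>
        (⟨⟨A + b, by omega⟩, by simp⟩ : {a : Fin m // A ≤ a})) := by
      intro b b' hb
      simpa [Fin.ext_iff] using hb
    have h2 := Fintype.card_le_of_injective _ hinj'
    simp only [Fintype.card_fin] at h1 h2
    omega
  have main : ∀ a b : Fin m, a < b → A ≤ a → d.mate a = b →
      ∃ (c : ℕ) (hc : c + 1 < m), A ≤ c ∧ d.mate ⟨c, by omega⟩ = ⟨c + 1, hc⟩ := by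
    intro a b hab ha h
    obtain ⟨c, hc, h1, -, h2⟩ := exists_adjacent d.flip a b hab (by
      rw [flip_partner, Sum.swap_inl, partner_inr, h]; rfl)
    refine ⟨c, hc, ha.trans h1, ?_⟩
    rw [flip_partner, Sum.swap_inl, partner_inr] at h2
    exact Sum.inl_injective h2
  obtain ⟨a, h1, h2⟩ := hex
  rcases lt_or_gt_of_ne (d.mate_ne a) with h | h
  · exact main _ _ h h2 (d.mate_mate a)
  · exact main _ _ h h1 rfl

variable {b n : ℕ}

/-- If the dots `b` and `b + 1` are joined, the diagram arises from another one by insertion of a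
cup. -/
theorem exists_concat_capAt_flip (d : Diagram 0 (n + 2 + b))
    (h : d.mate ⟨b, by omega⟩ = ⟨b + 1, by omega⟩) :
    ∃ e : Diagram 0 (n + b), (∀ a, d.mate (skip b n a) = skip b n (e.mate a)) ∧
      d = e.concat (capAt b n).flip ∧ loops e (capAt b n).flip = 0 := by
  obtain ⟨d', h1, h2, h3⟩ := exists_capAt_concat d.flip (by
    rw [flip_partner, Sum.swap_inl, partner_inr, h]; rfl)
  obtain ⟨e1, e2⟩ := flip_concat' (capAt b n) d'
  refine ⟨d'.flip, fun a => ?_, ?_, e1.trans h3⟩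
  · have h4 := h1 (.inl a)
    rw [Sum.map_inl, flip_partner, Sum.swap_inl, partner_inr] at h4
    have h5 : d'.partner (.inl a) = .inl (d'.flip.mate a) := by
      have := partner_inr d'.flip a
      rw [flip_partner, Sum.swap_inr] at this
      rw [← Sum.swap_swap (d'.partner (.inl a)), this]
      rfl
    rw [h5] at h4
    exact Sum.inl_injective h4
  · rw [e2, ← h2, flip_flip]

/-- If the dots `b` and `b + 1` are not joined, then the cap at these dots joins their mates and
leaves the other lines untouched. -/
theorem mate_concat_capAt (d : Diagram 0 (n + 2 + b)) {c c' : Fin (n + b)}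
    (hc : d.mate ⟨b, by omega⟩ = skip b n c) (hc' : d.mate ⟨b + 1, by omega⟩ = skip b n c') :
    loops d (capAt b n) = 0 ∧ (d.concat (capAt b n)).mate c = c' ∧
      ∀ a, a ≠ c → a ≠ c' →
        d.mate (skip b n a) = skip b n ((d.concat (capAt b n)).mate a) := by
  have hl : ∀ a, connected d (capAt b n) (.inr (.inl a)) (.inr (.inl (d.mate a))) := by
    intro a
    have := connected_lower d (capAt b n) (.inr a)
    rwa [partner_inr] at this
  have ho : ∀ a, connected d (capAt b n) (.inr (.inl (skip b n a))) (outerDot (.inr a)) := by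
    intro a
    have := connected_upper d (capAt b n) (.inl (skip b n a))
    rwa [capAt_partner_skip] at this
  have hb : connected d (capAt b n) (.inr (.inl ⟨b, by omega⟩))
      (.inr (.inl ⟨b + 1, by omega⟩)) := by
    have := connected_upper d (capAt b n) (.inl ⟨b, by omega⟩)
    rwa [capAt_partner_left b n (by omega) (by omega)] at this
  have hm : ∀ a a', a' ≠ a → connected d (capAt b n) (outerDot (.inr a)) (outerDot (.inr a')) →
      (d.concat (capAt b n)).mate a = a' := by
    intro a a' hne h
    have := eq_concatPartner (fun e => hne (Sum.inr_injective e)) h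
    have h2 := partner_inr (d.concat (capAt b n)) a
    exact Sum.inr_injective (h2.symm.trans this.symm)
  have hbc := hl ⟨b, by omega⟩
  have hbc' := hl ⟨b + 1, by omega⟩
  rw [hc] at hbc
  rw [hc'] at hbc'
  have hcc : c' ≠ c := by
    rintro rfl
    have := congrArg d.mate (hc.trans hc'.symm)
    rw [mate_mate, mate_mate] at this
    simp at this
  refine ⟨?_, ?_, ?_⟩
  · refine Nat.card_eq_zero.2 (Or.inl ⟨fun x => ?_⟩)
    obtain ⟨x, hx⟩ := x
    induction x using Quotient.inductionOn with
    | h v =>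
      rcases v with a | a | a
      · exact a.elim0
      · revert hx
        refine skip_cases (P := fun a => (∀ p, Quotient.mk (connected d (capAt b n))
          (.inr (.inl a)) ≠ Quotient.mk _ (outerDot p)) → False) ?_ ?_ ?_ a
        · exact fun hx => hx _ (Quotient.sound (Setoid.trans' _ hbc (ho c)))
        · exact fun hx => hx _ (Quotient.sound (Setoid.trans' _ hbc' (ho c')))
        · exact fun a hx => hx _ (Quotient.sound (ho a))
      · exact hx (.inr a) rfl
  · refine hm c c' hcc ?_
    exact Setoid.trans' _ (Setoid.symm' _ (ho c)) (Setoid.trans' _ (Setoid.symm' _ hbc)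
      (Setoid.trans' _ hb (Setoid.trans' _ hbc' (ho c'))))
  · intro a h1 h2
    obtain ⟨a', ha'⟩ : ∃ a', d.mate (skip b n a) = skip b n a' := by
      have key : ∀ x, d.mate (skip b n a) = x → ∃ a', x = skip b n a' := by
        refine skip_cases (fun e => ?_) (fun e => ?_) fun a' _ => ⟨a', rfl⟩
        · rw [← e, mate_mate] at hc
          exact absurd (skip_injective b n hc) h1
        · rw [← e, mate_mate] at hc'
          exact absurd (skip_injective b n hc') h2
      exact key _ rfl
    rw [hm a a' ?_ ?_, ha']
    · rintro rfl
      exact d.mate_ne _ ha'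
    · have := hl (skip b n a)
      rw [ha'] at this
      exact Setoid.trans' _ (Setoid.symm' _ (ho a)) (Setoid.trans' _ this (ho a'))

/-- A product over all dots splits off the dots `b` and `b + 1`. -/
theorem prod_skip {M : Type*} [CommMonoid M] (f : Fin (n + 2 + b) → M) :
    ∏ a, f a = f ⟨b, by omega⟩ * f ⟨b + 1, by omega⟩ * ∏ a, f (skip b n a) := by
  classical
  have hs : ∀ a, (skip b n a : ℕ) ≠ b ∧ (skip b n a : ℕ) ≠ b + 1 := by
    intro a; simp only [skip]; split_ifs <;> omega
  have e : (Finset.univ : Finset (Fin (n + 2 + b))) =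
      insert ⟨b, by omega⟩ (insert ⟨b + 1, by omega⟩ (Finset.univ.image (skip b n))) := by
    ext a
    refine ⟨fun _ => ?_, fun _ => Finset.mem_univ _⟩
    refine skip_cases (P := fun a => a ∈ insert (⟨b, by omega⟩ : Fin (n + 2 + b))
      (insert ⟨b + 1, by omega⟩ (Finset.univ.image (skip b n)))) ?_ ?_ ?_ a
    · simp
    · simp
    · intro a; simp
  rw [e, Finset.prod_insert, Finset.prod_insert, Finset.prod_image, mul_assoc]
  · exact fun a _ a' _ h => skip_injective b n h
  · simp only [Finset.mem_image, Finset.mem_univ, true_and, not_exists]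
    exact fun a h => (hs a).2 (congrArg Fin.val h)
  · simp only [Finset.mem_insert, Finset.mem_image, Finset.mem_univ, true_and, not_or, not_exists]
    exact ⟨by simp, fun a h => (hs a).1 (congrArg Fin.val h)⟩

end Diagram

/-! ### The tensor of a diagram -/

namespace Diagram

variable {k : Type*} [Field k] {m n b : ℕ}

/-- The coefficient of the word `x` in the tensor of a diagram `d` without lower dots. Every line
contributes the tensor `-q • (true ⊗ false) + false ⊗ true`. Letters of `x` beyond the dots are
ignored. -/
def weight (q : k) (d : Diagram 0 m) (x : ℕ → Bool) : k :=
  ∏ a : Fin m, if x (d.mate a) = x a then 0 else if x a = true ∧ a < d.mate a then -q else 1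

theorem ne_of_weight_ne_zero {q : k} {d : Diagram 0 m} {x : ℕ → Bool} (h : weight q d x ≠ 0)
    (a : Fin m) : x (d.mate a) ≠ x a := by
  intro h'
  exact h (Finset.prod_eq_zero (Finset.mem_univ a) (if_pos h'))

/-- The word `x` with two letters inserted in the places `b` and `b + 1`. -/
def insertTwo (b : ℕ) (s t : Bool) (x : ℕ → Bool) : ℕ → Bool := fun a =>
  if a < b then x a else if a = b then s else if a = b + 1 then t else x (a - 2)

theorem insertTwo_skip (s t : Bool) (x : ℕ → Bool) (a : Fin (n + b)) :
    insertTwo b s t x (skip b n a) = x a := by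
  by_cases h : (a : ℕ) < b
  · have e : (skip b n a : ℕ) = a := by simp [skip, h]
    rw [insertTwo, e, if_pos h]
  · have e : (skip b n a : ℕ) = a + 2 := by simp [skip, h]
    rw [insertTwo, e, if_neg (by omega), if_neg (by omega), if_neg (by omega), Nat.add_sub_cancel]

theorem insertTwo_left (s t : Bool) (x : ℕ → Bool) : insertTwo b s t x b = s := by
  simp [insertTwo]

theorem insertTwo_right (s t : Bool) (x : ℕ → Bool) : insertTwo b s t x (b + 1) = t := by
  simp [insertTwo]

theorem skip_lt_skip {a a' : Fin (n + b)} : skip b n a < skip b n a' ↔ a < a' := by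
  simp only [skip, Fin.lt_def]
  split_ifs <;> omega

/-- The tensor of a diagram with a cup at the dots `b` and `b + 1` splits off the tensor of this
cup. -/
theorem weight_insertTwo (q : k) {d : Diagram 0 (n + 2 + b)} {e : Diagram 0 (n + b)}
    (h : d.mate ⟨b, by omega⟩ = ⟨b + 1, by omega⟩)
    (he : ∀ a, d.mate (skip b n a) = skip b n (e.mate a)) (s t : Bool) (x : ℕ → Bool) :
    weight q d (insertTwo b s t x) =
      (if s = t then 0 else if s = true then -q else 1) * weight q e x := by
  have h' : d.mate ⟨b + 1, by omega⟩ = ⟨b, by omega⟩ := by rw [← h, mate_mate]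
  rw [weight, prod_skip, weight]
  simp only [h, h', he, insertTwo_skip, insertTwo_left, insertTwo_right, skip_lt_skip]
  congr 1
  cases s <;> cases t <;> simp

/-- The tensor of a diagram is compatible with a cap that joins two different lines. -/
theorem weight_concat_capAt {q : k} (hq : q ≠ 0) (d : Diagram 0 (n + 2 + b)) {c c' : Fin (n + b)}
    (hc : d.mate ⟨b, by omega⟩ = skip b n c) (hc' : d.mate ⟨b + 1, by omega⟩ = skip b n c')
    (x : ℕ → Bool) :
    weight q (d.concat (capAt b n)) x =
      weight q d (insertTwo b true false x) - q⁻¹ * weight q d (insertTwo b false true x) := by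
  classical
  obtain ⟨-, h2, h3⟩ := mate_concat_capAt d hc hc'
  have h2' : (d.concat (capAt b n)).mate c' = c := by rw [← h2, mate_mate]
  have hd : d.mate (skip b n c) = ⟨b, by omega⟩ := by rw [← hc, mate_mate]
  have hd' : d.mate (skip b n c') = ⟨b + 1, by omega⟩ := by rw [← hc', mate_mate]
  have hcc : c' ≠ c := by rw [← h2]; exact mate_ne _ _
  have hmem : c' ∈ Finset.univ.erase c := Finset.mem_erase.2 ⟨hcc, Finset.mem_univ _⟩
  -- the lines not touched by the cap contribute the same factor to all three weights
  have hw : ∀ s t, weight q d (insertTwo b s t x) =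
      (if x c = s then 0 else if s = true ∧ ¬ (c : ℕ) < b then -q else 1) *
      (if x c' = t then 0 else if t = true ∧ ¬ (c' : ℕ) < b then -q else 1) *
      ((if s = x c then 0 else if x c = true ∧ (c : ℕ) < b then -q else 1) *
      ((if t = x c' then 0 else if x c' = true ∧ (c' : ℕ) < b then -q else 1) *
      ∏ a ∈ (Finset.univ.erase c).erase c',
        if x ((d.concat (capAt b n)).mate a) = x a then 0
        else if x a = true ∧ a < (d.concat (capAt b n)).mate a then -q else 1)) := by
    intro s t
    rw [weight, prod_skip, ← Finset.mul_prod_erase Finset.univ _ (Finset.mem_univ c),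
      ← Finset.mul_prod_erase _ _ hmem]
    have o1 : ∀ a : Fin (n + b), (⟨b, by omega⟩ : Fin (n + 2 + b)) < skip b n a ↔ ¬ (a : ℕ) < b := by
      intro a; simp only [skip, Fin.lt_def]; split_ifs <;> omega
    have o2 : ∀ a : Fin (n + b),
        (⟨b + 1, by omega⟩ : Fin (n + 2 + b)) < skip b n a ↔ ¬ (a : ℕ) < b := by
      intro a; simp only [skip, Fin.lt_def]; split_ifs <;> omega
    have o3 : ∀ a : Fin (n + b), skip b n a < (⟨b, by omega⟩ : Fin (n + 2 + b)) ↔ (a : ℕ) < b := by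
      intro a; simp only [skip, Fin.lt_def]; split_ifs <;> omega
    have o4 : ∀ a : Fin (n + b),
        skip b n a < (⟨b + 1, by omega⟩ : Fin (n + 2 + b)) ↔ (a : ℕ) < b := by
      intro a; simp only [skip, Fin.lt_def]; split_ifs <;> omega
    simp only [hc, hc', hd, hd', insertTwo_skip, insertTwo_left, insertTwo_right, o1, o2, o3, o4]
    congr 3
    refine Finset.prod_congr rfl fun a ha => ?_
    rw [Finset.mem_erase, Finset.mem_erase] at ha
    simp only [h3 a ha.2.1 ha.1, insertTwo_skip, skip_lt_skip]
  rw [hw, hw, weight, ← Finset.mul_prod_erase Finset.univ _ (Finset.mem_univ c),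
    ← Finset.mul_prod_erase _ _ hmem, h2, h2']
  generalize (∏ a ∈ (Finset.univ.erase c).erase c',
        if x ((d.concat (capAt b n)).mate a) = x a then 0
        else if x a = true ∧ a < (d.concat (capAt b n)).mate a then -q else 1) = P
  -- the possible positions of `c` and `c'`
  have p1 := d.mate_planar ⟨b, by omega⟩ ⟨b + 1, by omega⟩
  have p2 := d.mate_planar (skip b n c) (skip b n c')
  have p3 := d.mate_planar (skip b n c') ⟨b, by omega⟩
  have p4 := d.mate_planar (skip b n c) ⟨b + 1, by omega⟩
  rw [hc, hc'] at p1
  rw [hd, hd'] at p2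
  rw [hd', hc] at p3
  rw [hd, hc'] at p4
  rw [Ne, Fin.ext_iff] at hcc
  simp only [skip, Fin.lt_def] at p1 p2 p3 p4
  have hpos : ((c : ℕ) < b ∧ (c' : ℕ) < b ∧ ¬ c < c' ∧ c' < c) ∨
      ((c : ℕ) < b ∧ ¬ (c' : ℕ) < b ∧ c < c' ∧ ¬ c' < c) ∨
      (¬ (c : ℕ) < b ∧ ¬ (c' : ℕ) < b ∧ ¬ c < c' ∧ c' < c) := by
    simp only [Fin.lt_def]
    split_ifs at * <;> omega
  rcases hpos with ⟨o1, o2, o3, o4⟩ | ⟨o1, o2, o3, o4⟩ | ⟨o1, o2, o3, o4⟩ <;>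
    cases x c <;> cases x c' <;> simp [o1, o2, o3, o4] <;> field_simp

end Diagram

namespace TLCat

universe u

variable {k : Type u} [Field k] {δ : k} {m n b : ℕ}

open Diagram in
/-- The tensor of a morphism from the unit, evaluated at a word. -/
noncomputable def tensorCoeff (q : k) (x : ℕ → Bool) : ((⟨0⟩ : TLCat δ) ⟶ ⟨m⟩) →ₗ[k] k :=
  Finsupp.linearCombination k fun d : Diagram 0 m => weight q d x

theorem tensorCoeff_ofDiagram (q : k) (x : ℕ → Bool) (d : Diagram 0 m) :
    tensorCoeff q x (ofDiagram d : (⟨0⟩ : TLCat δ) ⟶ ⟨m⟩) = d.weight q x :=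
  (Finsupp.linearCombination_single k 1 d).trans (one_smul k _)

theorem exists_of_tensorCoeff_ne_zero {q : k} {x : ℕ → Bool} {u : (⟨0⟩ : TLCat δ) ⟶ ⟨m⟩}
    (h : tensorCoeff q x u ≠ 0) : ∃ d : Diagram 0 m, coeff d u ≠ 0 ∧ d.weight q x ≠ 0 := by
  change (Finsupp.linearCombination k fun d : Diagram 0 m => d.weight q x) u ≠ 0 at h
  rw [Finsupp.linearCombination_apply, Finsupp.sum] at h
  obtain ⟨d, -, hd⟩ := Finset.exists_ne_zero_of_sum_ne_zero h
  exact ⟨d, left_ne_zero_of_smul hd, right_ne_zero_of_smul hd⟩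

theorem cupAt_capAt (b n : ℕ) : (ofDiagram (Diagram.capAt b n).flip : (⟨n + b⟩ : TLCat δ) ⟶ _) ≫
    (ofDiagram (Diagram.capAt b n) : (⟨n + 2 + b⟩ : TLCat δ) ⟶ _) = δ • 𝟙 _ := by
  induction b with
  | zero => exact cup_cap n
  | succ b ih =>
    have := congrArg strand ih
    rwa [strand_comp, strand_smul, strand_id, strand_ofDiagram, strand_ofDiagram,
      ← Diagram.addStrand_flip] at this

/-- The tensor is compatible with caps, which act on words by `true ⊗ false ↦ 1` and
`false ⊗ true ↦ -q⁻¹`. A closed loop contributes `-q - q⁻¹ = δ`. -/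
theorem tensorCoeff_comp_capAt {q : k} (hq : q ≠ 0) (hδ : δ = -q - q⁻¹)
    (u : (⟨0⟩ : TLCat δ) ⟶ ⟨n + 2 + b⟩) (x : ℕ → Bool) :
    tensorCoeff q x (u ≫ (ofDiagram (Diagram.capAt b n) : (⟨n + 2 + b⟩ : TLCat δ) ⟶ ⟨n + b⟩)) =
      tensorCoeff q (Diagram.insertTwo b true false x) u -
        q⁻¹ * tensorCoeff q (Diagram.insertTwo b false true x) u := by
  induction u using hom_induction with
  | zero => rw [Limits.zero_comp, map_zero, map_zero, map_zero]; ring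
  | add f f' h h' => rw [Preadditive.add_comp, map_add, h, h', map_add, map_add]; ring
  | smul r d =>
    change Diagram 0 (n + 2 + b) at d
    rw [Linear.smul_comp, map_smul, map_smul, map_smul, tensorCoeff_ofDiagram,
      tensorCoeff_ofDiagram]
    suffices h : tensorCoeff q x ((ofDiagram d : (⟨0⟩ : TLCat δ) ⟶ ⟨n + 2 + b⟩) ≫
        (ofDiagram (Diagram.capAt b n) : (⟨n + 2 + b⟩ : TLCat δ) ⟶ ⟨n + b⟩)) =
        Diagram.weight q d (Diagram.insertTwo b true false x) -
        q⁻¹ * Diagram.weight q d (Diagram.insertTwo b false true x) by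
      rw [h, smul_eq_mul, smul_eq_mul, smul_eq_mul]; ring
    by_cases hb : d.mate ⟨b, by omega⟩ = ⟨b + 1, by omega⟩
    · obtain ⟨e, h1, h2, h3⟩ := d.exists_concat_capAt_flip hb
      rw [Diagram.weight_insertTwo q hb h1, Diagram.weight_insertTwo q hb h1]
      rw [h2, ← ofDiagram_comp_of_loops (Y := ⟨n + b⟩) h3, Category.assoc]
      have e1 := cupAt_capAt (δ := δ) b n
      refine (congrArg (fun f => tensorCoeff q x (ofDiagram e ≫ f)) e1).trans ?_
      rw [Linear.comp_smul, Category.comp_id, map_smul, tensorCoeff_ofDiagram, hδ]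
      simp; ring
    · have hne := d.mate_ne ⟨b, by omega⟩
      have hne' := d.mate_ne ⟨b + 1, by omega⟩
      have hb' : d.mate ⟨b + 1, by omega⟩ ≠ ⟨b, by omega⟩ := fun h =>
        hb (by rw [← h, Diagram.mate_mate])
      have key : ∀ y : Fin (n + 2 + b), y ≠ ⟨b, by omega⟩ → y ≠ ⟨b + 1, by omega⟩ →
          ∃ c, y = Diagram.skip b n c :=
        Diagram.skip_cases (fun h _ => absurd rfl h) (fun _ h => absurd rfl h)
          fun a _ _ => ⟨a, rfl⟩
      obtain ⟨c, hc⟩ := key _ hne hb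
      obtain ⟨c', hc'⟩ := key _ hb' hne'
      rw [ofDiagram_comp_of_loops (Diagram.mate_concat_capAt d hc hc').1, tensorCoeff_ofDiagram,
        Diagram.weight_concat_capAt hq d hc hc']

end TLCat

/-! ### Gaussian binomial coefficients at a root of unity -/

section GaussBinomial

variable {k : Type*} [Field k]

/-- The Gaussian binomial coefficients at the parameter `z`. -/
def gaussBinomial (z : k) : ℕ → ℕ → k
  | _, 0 => 1
  | 0, _ + 1 => 0
  | n + 1, r + 1 => gaussBinomial z n r + z ^ (r + 1) * gaussBinomial z n (r + 1)

theorem gaussBinomial_zero_right (z : k) (n : ℕ) : gaussBinomial z n 0 = 1 := by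
  cases n <;> rfl

theorem gaussBinomial_succ_succ (z : k) (n r : ℕ) : gaussBinomial z (n + 1) (r + 1) =
    gaussBinomial z n r + z ^ (r + 1) * gaussBinomial z n (r + 1) := rfl

theorem gaussBinomial_eq_zero (z : k) {n r : ℕ} (h : n < r) : gaussBinomial z n r = 0 := by
  induction n generalizing r with
  | zero =>
    obtain ⟨r, rfl⟩ := Nat.exists_eq_add_one.2 h
    rfl
  | succ n ih =>
    obtain ⟨r, rfl⟩ := Nat.exists_eq_add_one.2 (Nat.zero_lt_of_lt h)
    rw [gaussBinomial_succ_succ, ih (by omega), ih (by omega), mul_zero, add_zero]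

theorem gaussBinomial_self (z : k) (n : ℕ) : gaussBinomial z n n = 1 := by
  induction n with
  | zero => rfl
  | succ n ih =>
    rw [gaussBinomial_succ_succ, ih, gaussBinomial_eq_zero z n.lt_succ_self, mul_zero, add_zero]

theorem one_sub_pow_mul_gaussBinomial (z : k) (n r : ℕ) :
    (1 - z ^ (r + 1)) * gaussBinomial z (n + 1) (r + 1) =
      (1 - z ^ (n + 1)) * gaussBinomial z n r := by
  induction n generalizing r with
  | zero =>
    cases r with
    | zero => simp [gaussBinomial]
    | succ r => simp [gaussBinomial]
  | succ n ih =>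
    have h := ih r
    rw [gaussBinomial_succ_succ z (n + 1) r]
    cases r with
    | zero =>
      rw [gaussBinomial_zero_right] at h ⊢
      linear_combination z ^ (0 + 1) * h
    | succ r =>
      have h' := ih r
      have e := gaussBinomial_succ_succ z n r
      linear_combination z ^ (r + 1 + 1) * h + z * h' - z * (1 - z ^ (n + 1)) * e

variable {z : k} {r : ℕ}

theorem gaussBinomial_order_add (h : IsPrimitiveRoot z (r + 1)) (n : ℕ) {s : ℕ} (hs : s ≤ r) :
    gaussBinomial z (r + 1 + n) s = gaussBinomial z n s := by
  induction n generalizing s with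
  | zero =>
    cases s with
    | zero => rw [gaussBinomial_zero_right, gaussBinomial_zero_right]
    | succ s =>
      have h1 := one_sub_pow_mul_gaussBinomial z r s
      rw [h.pow_eq_one, sub_self, zero_mul] at h1
      refine (mul_eq_zero.1 h1).resolve_left fun h2 => ?_
      exact h.pow_ne_one_of_pos_of_lt (by omega) (by omega) (sub_eq_zero.1 h2).symm
  | succ n ih =>
    cases s with
    | zero => rw [gaussBinomial_zero_right, gaussBinomial_zero_right]
    | succ s =>
      rw [← add_assoc, gaussBinomial_succ_succ, ih (by omega), ih hs, gaussBinomial_succ_succ]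

theorem gaussBinomial_order_sub_one (h : IsPrimitiveRoot z (r + 1)) (n : ℕ) :
    gaussBinomial z n r = if r + 1 ∣ n + 1 then 1 else 0 := by
  induction n using Nat.strong_induction_on with
  | _ n ih =>
  rcases lt_trichotomy n r with hn | rfl | hn
  · rw [gaussBinomial_eq_zero z hn, if_neg (Nat.not_dvd_of_pos_of_lt (by omega) (by omega))]
  · rw [gaussBinomial_self, if_pos dvd_rfl]
  · obtain ⟨m, rfl⟩ := Nat.exists_eq_add_of_le (Nat.succ_le_of_lt hn)
    rw [Nat.succ_eq_add_one, gaussBinomial_order_add h m le_rfl, ih m (by omega), add_assoc]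
    simp only [Nat.dvd_add_right dvd_rfl]

/-- The Gaussian binomial coefficient `[n, l]` at a primitive `l`-th root of unity is `⌊n / l⌋`. -/
theorem gaussBinomial_order (h : IsPrimitiveRoot z (r + 1)) (n : ℕ) :
    gaussBinomial z n (r + 1) = ((n / (r + 1) : ℕ) : k) := by
  induction n with
  | zero => simp [gaussBinomial]
  | succ n ih =>
    rw [gaussBinomial_succ_succ, h.pow_eq_one, one_mul, ih, gaussBinomial_order_sub_one h,
      Nat.succ_div, add_comm]
    split_ifs <;> simp

end GaussBinomial

/-! ### Functions on words -/

section Words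

variable {k : Type*} [Field k] {q : k} {ψ : List Bool → k}

/-- The power of `q` whose exponent is the number of pairs of a letter `false` and a later letter
`true`. -/
def inversionWeight (q : k) : List Bool → k
  | [] => 1
  | true :: x => inversionWeight q x
  | false :: x => q ^ x.count true * inversionWeight q x

theorem inversionWeight_ne_zero (hq : q ≠ 0) (x : List Bool) : inversionWeight q x ≠ 0 := by
  induction x with
  | nil => exact one_ne_zero
  | cons b x ih =>
    cases b
    · exact mul_ne_zero (pow_ne_zero _ hq) ih
    · exact ih

/-- A function on words that is multiplied with `q` if two adjacent letters `true`, `false` are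
exchanged, is determined by one of its values on the rearrangements of a word. -/
theorem inversionWeight_mul_eq (hq : q ≠ 0)
    (h : ∀ x y, ψ (x ++ false :: true :: y) = q * ψ (x ++ true :: false :: y))
    {x y : List Bool} (hxy : x.Perm y) :
    inversionWeight q y * ψ x = inversionWeight q x * ψ y := by
  induction hxy generalizing ψ with
  | nil => rfl
  | @cons b x y hxy ih =>
    have := ih (ψ := fun w => ψ (b :: w)) fun x y => h (b :: x) y
    cases b
    · simp only [inversionWeight, hxy.count_eq, mul_assoc, this]
    · exact this
  | swap a b x =>
    have := h [] x
    simp only [List.nil_append] at this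
    cases a <;> cases b <;> simp [inversionWeight, this, pow_succ] <;> ring
  | @trans x y z _ _ ih1 ih2 =>
    refine mul_left_cancel₀ (inversionWeight_ne_zero hq y) ?_
    linear_combination inversionWeight q z * ih1 h + inversionWeight q x * ih2 h

/-- A sum over all words of length `n`: the word with letters `true` in the places `p₁, …, pᵣ` has
the weight `z ^ r * q ^ e`, where `e` is the number of pairs of a letter `false` and a later letter
`true`. -/
def wordSum (q : k) : ℕ → k → (List Bool → k) →ₗ[k] k
  | 0, _ => LinearMap.proj []
  | n + 1, z => z • wordSum q n z ∘ₗ LinearMap.funLeft k k (List.cons true) +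
      wordSum q n (z * q) ∘ₗ LinearMap.funLeft k k (List.cons false)

theorem wordSum_succ (n : ℕ) (z : k) (ψ : List Bool → k) : wordSum q (n + 1) z ψ =
    z * wordSum q n z (fun w => ψ (true :: w)) +
      wordSum q n (z * q) (fun w => ψ (false :: w)) := rfl

theorem wordSum_congr {n : ℕ} {z : k} {ψ ψ' : List Bool → k}
    (h : ∀ w, w.length = n → ψ w = ψ' w) : wordSum q n z ψ = wordSum q n z ψ' := by
  induction n generalizing z ψ ψ' with
  | zero => exact h [] rfl
  | succ n ih =>
    rw [wordSum_succ, wordSum_succ, ih fun w hw => h (true :: w) (by simp [hw]),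
      ih fun w hw => h (false :: w) (by simp [hw])]

/-- The sum over all words vanishes on functions that look like the tensor of a cup at two adjacent
letters. -/
theorem wordSum_eq_zero {n j : ℕ} (hj : j + 2 ≤ n) (z : k)
    (h : ∀ x y s t, x.length = j → x.length + 2 + y.length = n → ψ (x ++ s :: t :: y) =
      if s = t then 0 else if s = true then -q * ψ (x ++ false :: true :: y) else
        ψ (x ++ false :: true :: y)) :
    wordSum q n z ψ = 0 := by
  induction j generalizing n z ψ with
  | zero =>
    obtain ⟨n, rfl⟩ := Nat.exists_eq_add_of_le' hj
    have h' := fun y s t (hy : y.length = n) => h [] y s t rfl (by simp [hy]; omega)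
    simp only [List.nil_append] at h'
    simp only [wordSum_succ]
    have e0 : ∀ z, wordSum q n z (fun _ => (0 : k)) = 0 := fun z => map_zero (wordSum q n z)
    have e1 : ∀ z s, wordSum q n z (fun w => ψ (s :: s :: w)) = 0 := fun z s => by
      rw [wordSum_congr fun w hw => (h' w s s hw).trans (if_pos rfl), e0]
    have e2 : ∀ z, wordSum q n z (fun w => ψ (true :: false :: w)) =
        -q * wordSum q n z (fun w => ψ (false :: true :: w)) := fun z => by
      rw [wordSum_congr fun w hw => (h' w true false hw)]
      exact map_smul (wordSum q n z) (-q) _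
    rw [e1, e1, e2]
    ring
  | succ j ih =>
    obtain ⟨n, rfl⟩ := Nat.exists_eq_add_of_le' (Nat.zero_lt_of_lt hj)
    have key : ∀ b z, wordSum q n z (fun w => ψ (b :: w)) = 0 := fun b z =>
      ih (by omega) z fun x y s t hx hy => h (b :: x) y s t (by simp [hx]) (by simp; omega)
    rw [wordSum_succ, key, key, mul_zero, add_zero]

theorem wordSum_inversionWeight (n r : ℕ) (z C : k) :
    wordSum q n z (fun w => if w.count true = r then C * inversionWeight q w else 0) =
      C * z ^ r * gaussBinomial (q ^ 2) n r := by
  induction n generalizing r z C with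
  | zero =>
    cases r with
    | zero => simp [wordSum, inversionWeight, gaussBinomial]
    | succ r => simp [wordSum, gaussBinomial]
  | succ n ih =>
    rw [wordSum_succ]
    have e : (fun w : List Bool => if (false :: w).count true = r then
        C * inversionWeight q (false :: w) else 0) =
        fun w => if w.count true = r then C * q ^ r * inversionWeight q w else 0 := by
      funext w
      rw [List.count_cons_of_ne (by simp)]
      split_ifs with h
      · rw [inversionWeight, h]; ring
      · rfl
    rw [e, ih]
    cases r with
    | zero =>
      have : (fun w : List Bool => if (true :: w).count true = 0 then
          C * inversionWeight q (true :: w) else 0) = 0 := by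
        funext w; simp
      rw [this, map_zero, gaussBinomial_zero_right, gaussBinomial_zero_right]
      simp
    | succ r =>
      have : (fun w : List Bool => if (true :: w).count true = r + 1 then
          C * inversionWeight q (true :: w) else 0) =
          fun w => if w.count true = r then C * inversionWeight q w else 0 := by
        funext w; simp [inversionWeight]
      rw [this, ih, gaussBinomial_succ_succ]
      ring

end Words

/-- The letters of a word, continued by `false`. -/
def word (w : List Bool) : ℕ → Bool := fun a => w.getD a false

theorem sum_word (w : List Bool) :
    ∑ a : Fin w.length, (if word w a = true then 1 else 0) = w.count true := by
  induction w with
  | nil => rfl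
  | cons b w ih =>
    have e : ∀ a : Fin w.length, word (b :: w) (a.succ : Fin (w.length + 1)) = word w a := by
      intro a; simp [word]
    have e0 : word (b :: w) 0 = b := rfl
    rw [List.count_cons, ← ih]
    refine (Fin.sum_univ_succ _).trans ?_
    simp only [e, Fin.val_zero, e0]
    rw [add_comm]
    cases b <;> rfl

namespace Diagram

variable {k : Type*} [Field k] {q : k} {m n b : ℕ}

theorem insertTwo_word (x y : List Bool) (s t : Bool) :
    insertTwo x.length s t (word (x ++ y)) = word (x ++ s :: t :: y) := by
  funext a
  simp only [insertTwo, word, List.getD_eq_getElem?_getD, List.getElem?_append]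
  split_ifs with h1 h2 h3 h4
  · rfl
  · simp [h2]
  · simp [h3]
  · omega
  · rw [show a - x.length = a - 2 - x.length + 1 + 1 by omega]
    simp

/-- In a word with nonzero coefficient every line carries one letter `true`. -/
theorem count_of_weight_ne_zero {d : Diagram 0 m} {w : List Bool} (hw : w.length = m)
    (h : weight q d (word w) ≠ 0) : w.count true + w.count true = m := by
  subst hw
  have h1 := ne_of_weight_ne_zero h
  have h2 : ∑ a : Fin w.length, (if word w (d.mate a) = true then 1 else 0) = w.count true := by
    rw [← sum_word]
    exact Equiv.sum_comp (Function.Involutive.toPerm d.mate d.mate_mate)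
      fun a : Fin w.length => if word w a = true then 1 else 0
  nth_rewrite 1 [← h2]
  rw [← sum_word, ← Finset.sum_add_distrib]
  refine (Finset.sum_congr rfl fun a _ => ?_).trans (Fin.sum_const w.length 1) |>.trans (by simp)
  have := h1 a
  revert this
  cases word w (d.mate a) <;> cases word w a <;> simp

/-- The word with the letter `true` at the right ends of the lines of a diagram. -/
def closers (d : Diagram 0 m) : List Bool := List.ofFn fun a => decide (d.mate a < a)

theorem word_closers (d : Diagram 0 m) (a : Fin m) :
    word d.closers a = true ↔ d.mate a < a := by
  simp [word, closers]

theorem weight_closers (d : Diagram 0 m) : weight q d (word d.closers) = 1 := by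
  refine Finset.prod_eq_one fun a _ => ?_
  have h := d.word_closers a
  have h' := d.word_closers (d.mate a)
  rw [mate_mate] at h'
  have h0 := d.mate_ne a
  rw [if_neg, if_neg]
  · rw [h]; exact fun h1 => lt_asymm h1.1 h1.2
  · rw [Bool.eq_iff_iff, h, h']
    exact fun e => h0 (by by_contra; omega)

/-- The sum of the positions of the right ends of the lines, counted twice. -/
def closerSum (d : Diagram 0 m) : ℕ := ∑ a : Fin m, max (a : ℕ) (d.mate a)

/-- Among the diagrams with nonzero coefficient at the word of right ends of `d`, only `d` has the
smallest sum of right ends. -/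
theorem eq_of_weight_closers_ne_zero {d e : Diagram 0 m} (h : weight q e (word d.closers) ≠ 0)
    (hle : e.closerSum ≤ d.closerSum) : e = d := by
  set x : Fin m → Bool := fun a => word d.closers a with hx
  have h1 : ∀ a, x (e.mate a) ≠ x a := ne_of_weight_ne_zero h
  -- twice the sum of the positions of the letters `true`
  have hsum : ∀ f : Diagram 0 m, ∑ a, ((if x a = true then (a : ℕ) else 0) +
      if x (f.mate a) = true then (f.mate a : ℕ) else 0) =
      2 * ∑ a, if x a = true then (a : ℕ) else 0 := by
    intro f
    rw [Finset.sum_add_distrib, two_mul]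
    congr 1
    exact Equiv.sum_comp (Function.Involutive.toPerm f.mate f.mate_mate)
      fun a : Fin m => if x a = true then (a : ℕ) else 0
  have hd : d.closerSum = 2 * ∑ a, if x a = true then (a : ℕ) else 0 := by
    rw [← hsum d]
    refine Finset.sum_congr rfl fun a _ => ?_
    have h2 : x a = true ↔ d.mate a < a := d.word_closers a
    have h3 : x (d.mate a) = true ↔ a < d.mate a := by
      have := d.word_closers (d.mate a)
      rwa [mate_mate] at this
    have h0 := d.mate_ne a
    simp only [h2, h3]
    split_ifs <;> omega
  have hterm : ∀ a ∈ Finset.univ, ((if x a = true then (a : ℕ) else 0) +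
      if x (e.mate a) = true then (e.mate a : ℕ) else 0) ≤ max (a : ℕ) (e.mate a) := by
    intro a _
    have := h1 a
    split_ifs with h2 h3
    · exact absurd (h3.trans h2.symm) this
    all_goals omega
  have heq := (Finset.sum_eq_sum_iff_of_le hterm).1
    (le_antisymm (Finset.sum_le_sum hterm) (hle.trans_eq (hd.trans (hsum e).symm)))
  refine eq_of_closers fun a => ?_
  have h2 : x a = true ↔ d.mate a < a := d.word_closers a
  rw [← h2]
  have h3 := heq a (Finset.mem_univ a)
  have h4 := h1 a
  have h0 := e.mate_ne a
  split_ifs at h3 with h5 h6 h6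
  · exact absurd (h6.trans h5.symm) h4
  · exact iff_of_true (by omega) h5
  · exact iff_of_false (by omega) h5
  · rw [Bool.not_eq_true] at h5 h6
    exact absurd (h6.trans h5.symm) h4

/-- Only the nested cups have a nonzero coefficient at the word whose first half consists of
letters `true` and whose second half consists of letters `false`. -/
theorem eq_cups_of_weight_ne_zero {a : ℕ} {d : Diagram 0 (a + a)}
    (h : weight q d (word (List.replicate a true ++ List.replicate a false)) ≠ 0) : d = cups a := by
  have h1 := ne_of_weight_ne_zero h
  have hx : ∀ b : Fin (a + a), word (List.replicate a true ++ List.replicate a false) b =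
      decide ((b : ℕ) < a) := by
    intro b
    simp only [word, List.getD_eq_getElem?_getD, List.getElem?_append, List.length_replicate]
    by_cases hb : (b : ℕ) < a
    · simp [hb]
    · simp [hb, List.getElem?_replicate, apply_ite (fun o : Option Bool => o.getD false)]
  refine eq_of_closers fun b => ?_
  have h2 := h1 b
  rw [hx, hx, Ne, decide_eq_decide] at h2
  rw [mate_cups, Fin.lt_def, Fin.lt_def, Fin.val_rev]
  omega

end Diagram

namespace TLCat

universe u

variable {k : Type u} [Field k] {δ : k} {m n b : ℕ}

/-- The tensor of a morphism from the unit to `m` strands as a function on words, extended by zero to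
words that do not have length `m`. -/
noncomputable def wordCoeff (q : k) : ((⟨0⟩ : TLCat δ) ⟶ ⟨m⟩) →ₗ[k] (List Bool → k) :=
  LinearMap.pi fun w => if w.length = m then tensorCoeff q (word w) else 0

theorem wordCoeff_of_length (q : k) (u : (⟨0⟩ : TLCat δ) ⟶ ⟨m⟩) {w : List Bool}
    (hw : w.length = m) : wordCoeff q u w = tensorCoeff q (word w) u := by
  rw [wordCoeff, LinearMap.pi_apply, if_pos hw]

theorem wordCoeff_of_length_ne (q : k) (u : (⟨0⟩ : TLCat δ) ⟶ ⟨m⟩) {w : List Bool}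
    (hw : w.length ≠ m) : wordCoeff q u w = 0 := by
  rw [wordCoeff, LinearMap.pi_apply, if_neg hw, LinearMap.zero_apply]

/-- The tensor determines the morphism. -/
theorem exists_wordCoeff_ne_zero (q : k) {u : (⟨0⟩ : TLCat δ) ⟶ ⟨m⟩} (hu : u ≠ 0) :
    ∃ w, w.length = m ∧ wordCoeff q u w ≠ 0 := by
  have hs : (Finsupp.support (α := Diagram 0 m) u).Nonempty := by
    rw [Finset.nonempty_iff_ne_empty]
    exact fun h => hu (Finsupp.support_eq_empty.1 h)
  obtain ⟨d, hd, hmax⟩ := Finset.exists_max_image _ Diagram.closerSum hs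
  have hlen : d.closers.length = m := List.length_ofFn
  refine ⟨d.closers, hlen, ?_⟩
  rw [wordCoeff_of_length q u hlen]
  change (Finsupp.linearCombination k fun e : Diagram 0 m => e.weight q (word d.closers)) u ≠ 0
  rw [Finsupp.linearCombination_apply, Finsupp.sum, Finset.sum_eq_single_of_mem d hd,
    Diagram.weight_closers, smul_eq_mul, mul_one]
  · exact Finsupp.mem_support_iff.1 hd
  · intro e he hne
    rw [smul_eq_mul]
    refine mul_eq_zero_of_right _ ?_
    by_contra h
    exact hne (Diagram.eq_of_weight_closers_ne_zero h (hmax e he))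

/-- The tensor of a morphism that is annihilated by all caps is `q`-symmetric. -/
theorem KillsCaps.wordCoeff_eq {q : k} (hq : q ≠ 0) (hδ : δ = -q - q⁻¹)
    {u : (⟨0⟩ : TLCat δ) ⟶ ⟨m⟩} (hu : KillsCaps u) (x y : List Bool) :
    wordCoeff q u (x ++ false :: true :: y) = q * wordCoeff q u (x ++ true :: false :: y) := by
  by_cases h : m = y.length + 2 + x.length
  · subst h
    rw [wordCoeff_of_length, wordCoeff_of_length, ← Diagram.insertTwo_word,
      ← Diagram.insertTwo_word]
    · have := tensorCoeff_comp_capAt hq hδ u (word (x ++ y))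
      rw [hu _ _ (Diagram.capAt_hasCap _ _), map_zero, eq_comm, sub_eq_zero] at this
      rw [this, mul_inv_cancel_left₀ hq]
    all_goals simp; omega
  · rw [wordCoeff_of_length_ne, wordCoeff_of_length_ne, mul_zero]
    all_goals simp; omega

/-- The tensor of a morphism that is annihilated by all caps is supported on the words with as many
letters `true` as `false`, and is there a nonzero multiple of `inversionWeight`. -/
theorem KillsCaps.exists_wordCoeff_eq {q : k} (hq : q ≠ 0) (hδ : δ = -q - q⁻¹)
    {u : (⟨0⟩ : TLCat δ) ⟶ ⟨m⟩} (hu : KillsCaps u) (h0 : u ≠ 0) :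
    ∃ (a : ℕ) (C : k), m = a + a ∧ C ≠ 0 ∧ ∀ w : List Bool, w.length = m →
      wordCoeff q u w = if w.count true = a then C * inversionWeight q w else 0 := by
  have hcount : ∀ w : List Bool, w.length = m → wordCoeff q u w ≠ 0 →
      w.count true + w.count true = m := by
    intro w hw h
    rw [wordCoeff_of_length q u hw] at h
    obtain ⟨d, -, hd⟩ := exists_of_tensorCoeff_ne_zero h
    exact Diagram.count_of_weight_ne_zero hw hd
  obtain ⟨w, hw, hne⟩ := exists_wordCoeff_ne_zero q h0
  refine ⟨w.count true, wordCoeff q u w / inversionWeight q w, (hcount w hw hne).symm,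
    div_ne_zero hne (inversionWeight_ne_zero hq w), fun w' hw' => ?_⟩
  split_ifs with h
  · have hperm : w'.Perm w := by
      rw [List.perm_iff_count]
      have e := List.count_true_add_count_false w
      have e' := List.count_true_add_count_false w'
      rintro (_ | _)
      · omega
      · exact h
    have := inversionWeight_mul_eq hq (hu.wordCoeff_eq hq hδ) hperm
    have := inversionWeight_ne_zero hq w
    field_simp
    linear_combination ‹inversionWeight q w * _ = _›
  · by_contra h'
    have := hcount w hw hne
    have := hcount w' hw' h'
    omega

/-- If two adjacent dots are joined, the tensor of a diagram is that of a cup at these dots. -/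
theorem wordCoeff_ofDiagram_of_mate (q : k) (d : Diagram 0 m) {c : ℕ} (hc : c + 1 < m)
    (h : d.mate ⟨c, by omega⟩ = ⟨c + 1, hc⟩) (x y : List Bool) (hx : x.length = c)
    (hy : x.length + 2 + y.length = m) (s t : Bool) :
    wordCoeff q (ofDiagram d : (⟨0⟩ : TLCat δ) ⟶ ⟨m⟩) (x ++ s :: t :: y) =
      if s = t then 0 else
      if s = true then
        -q * wordCoeff q (ofDiagram d : (⟨0⟩ : TLCat δ) ⟶ ⟨m⟩) (x ++ false :: true :: y)
      else wordCoeff q (ofDiagram d : (⟨0⟩ : TLCat δ) ⟶ ⟨m⟩) (x ++ false :: true :: y) := by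
  obtain rfl : m = y.length + 2 + x.length := by omega
  subst hx
  obtain ⟨e, h1, -, -⟩ := d.exists_concat_capAt_flip h
  have key : ∀ s t, wordCoeff q (ofDiagram d : (⟨0⟩ : TLCat δ) ⟶ ⟨y.length + 2 + x.length⟩)
      (x ++ s :: t :: y) = (if s = t then 0 else if s = true then -q else 1) *
        e.weight q (word (x ++ y)) := by
    intro s t
    rw [wordCoeff_of_length q _ (by simp; omega), tensorCoeff_ofDiagram, ← Diagram.insertTwo_word,
      Diagram.weight_insertTwo q h h1]
  rw [key, key]
  cases s <;> cases t <;> simp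

/-- The sum of the coefficients at the words that begin with `A` letters `true` vanishes for every
diagram with more than `2 * A` dots, since two adjacent of the remaining dots are joined. -/
theorem wordSum_wordCoeff_eq_zero (q : k) {A n : ℕ} (hA : A < n)
    (u : (⟨0⟩ : TLCat δ) ⟶ ⟨A + n⟩) :
    wordSum q n 1 (fun w => wordCoeff q u (List.replicate A true ++ w)) = 0 := by
  induction u using hom_induction with
  | zero =>
    simp only [map_zero, Pi.zero_apply]
    exact map_zero (wordSum q n 1)
  | add f f' h h' =>
    simp only [map_add, Pi.add_apply]
    exact (map_add (wordSum q n 1) _ _).trans (by rw [h, h', add_zero])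
  | smul r d =>
    change Diagram 0 (A + n) at d
    simp only [map_smul, Pi.smul_apply]
    refine (map_smul (wordSum q n 1) r _).trans ?_
    obtain ⟨c, hc, h1, h2⟩ := d.exists_mate_eq_succ (A := A) (by omega)
    rw [wordSum_eq_zero (j := c - A) (by omega), smul_zero]
    intro x y s t hx hy
    simp only [← List.append_assoc]
    exact wordCoeff_ofDiagram_of_mate q d hc h2 _ y (by simp; omega) (by simp; omega) s t

theorem inversionWeight_replicate_append (q : k) (A : ℕ) (w : List Bool) :
    inversionWeight q (List.replicate A true ++ w) = inversionWeight q w := by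
  induction A with
  | zero => rfl
  | succ A ih => exact ih

/-- A nonzero morphism from the unit to `m` strands that is annihilated by all caps exists only if
`m` is smaller than twice the order of `q ^ 2`, and then the nested cups occur in it. -/
theorem KillsCaps.exists_coeff_cups_ne_zero [CharZero k] {q : k} (hq : q ≠ 0) (hδ : δ = -q - q⁻¹)
    {r : ℕ} (hr : IsPrimitiveRoot (q ^ 2) (r + 1)) {u : (⟨0⟩ : TLCat δ) ⟶ ⟨m⟩}
    (hu : KillsCaps u) (h0 : u ≠ 0) :
    ∃ (a : ℕ) (ha : m = a + a), a ≤ r ∧ coeff (Y := ⟨m⟩) (ha ▸ Diagram.cups a) u ≠ 0 := by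
  obtain ⟨a, C, rfl, hC, h⟩ := hu.exists_wordCoeff_eq hq hδ h0
  refine ⟨a, rfl, ?_, ?_⟩
  · by_contra! hra
    -- the sum over the words that begin with `A` letters `true` vanishes on every diagram, but on
    -- `u` it is a multiple of a Gaussian binomial coefficient that does not vanish
    obtain ⟨A, rfl⟩ : ∃ A, a = A + (r + 1) := ⟨a - (r + 1), by omega⟩
    obtain ⟨n, hn⟩ : ∃ n, n = A + (r + 1) + (r + 1) := ⟨_, rfl⟩
    have key : ∀ (m : ℕ) (u : (⟨0⟩ : TLCat δ) ⟶ ⟨m⟩), m = A + n → (∀ w : List Bool, w.length = m →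
        wordCoeff q u w = if w.count true = A + (r + 1) then C * inversionWeight q w else 0) →
        False := by
      rintro m u rfl h
      have h1 := wordSum_wordCoeff_eq_zero q (by omega) u
      rw [wordSum_congr (ψ' := fun w =>
        if w.count true = r + 1 then C * inversionWeight q w else 0), wordSum_inversionWeight,
        one_pow, mul_one, gaussBinomial_order hr] at h1
      · refine mul_ne_zero hC (Nat.cast_ne_zero.2 ?_) h1
        exact (Nat.div_pos (by omega) (by omega)).ne'
      · intro w hw
        rw [h _ (by simp [hw]), inversionWeight_replicate_append]
        simp
    exact key _ u (by omega) h
  · have h1 := h (List.replicate a true ++ List.replicate a false) (by simp)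
    rw [if_pos (by simp [List.count_replicate]), wordCoeff_of_length q u (by simp)] at h1
    have h2 := h1.trans_ne (mul_ne_zero hC (inversionWeight_ne_zero hq _))
    obtain ⟨d, hd, hd'⟩ := exists_of_tensorCoeff_ne_zero h2
    rwa [Diagram.eq_cups_of_weight_ne_zero hd'] at hd

end TLCat

/-! ### Nonzero ideals contain a Jones–Wenzl idempotent -/

namespace TLCat

universe u

variable {k : Type u} [Field k] {δ : k} {m n : ℕ}

/-- Bending a morphism upwards turns the vertical diagram, and no other diagram, into the nested
cups. -/
theorem coeff_cups_bend (v : (⟨n⟩ : TLCat δ) ⟶ ⟨n⟩) :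
    coeff (X := ⟨0⟩) (Y := ⟨n + n⟩) (Diagram.cups n)
      (η_ (⟨n⟩ : TLCat δ) ⟨n⟩ ≫ (⟨n⟩ : TLCat δ) ◁ v) = coeff (.vertical rfl) v := by
  classical
  induction v using hom_induction with
  | zero =>
    rw [MonoidalPreadditive.whiskerLeft_zero, Limits.comp_zero, map_zero, map_zero]
  | add f f' h h' =>
    rw [MonoidalPreadditive.whiskerLeft_add, Preadditive.comp_add, map_add, map_add, h, h']
  | smul r d =>
    change Diagram n n at d
    rw [MonoidalLinear.whiskerLeft_smul, Linear.comp_smul, map_smul, map_smul]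
    congr 1
    have e : (⟨n⟩ : TLCat δ) ◁ (ofDiagram d : (⟨n⟩ : TLCat δ) ⟶ ⟨n⟩) =
        ofDiagram ((Diagram.vertical rfl).juxtapose d) :=
      (tensor_single _ _ _ _).trans (by rw [mul_one]; rfl)
    by_cases hd : d = .vertical rfl
    · subst hd
      rw [ofDiagram_vertical, MonoidalCategory.whiskerLeft_id, Category.comp_id,
        ← ofDiagram_vertical, coeff_ofDiagram, if_pos rfl]
      exact (coeff_ofDiagram (X := (⟨0⟩ : TLCat δ)) (Y := ⟨n + n⟩) _ _).trans (if_pos rfl)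
    · rw [coeff_ofDiagram, if_neg hd, e]
      refine (congrArg _ (ofDiagram_comp (X := (⟨0⟩ : TLCat δ)) (Y := ⟨n + n⟩) (Z := ⟨n + n⟩)
        (Diagram.cups n) ((Diagram.vertical rfl).juxtapose d))).trans ?_
      rw [map_smul, coeff_ofDiagram, if_neg, smul_zero]
      intro h
      -- a cup of `d` survives on the right half, where the nested cups have none
      obtain ⟨a, b, hab⟩ : d.HasCup := by
        by_contra h'
        exact hd (Diagram.eq_vertical_of_not_hasCup h')
      have h1 : ((Diagram.vertical rfl).juxtapose d : Diagram (n + n) (n + n)).partner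
          (.inr (Fin.natAdd n a)) = .inr (Fin.natAdd n b) := by
        have hdot : ∀ c : Fin n, juxtaposeDots n n n n (.inr (.inr c)) = .inr (Fin.natAdd n c) :=
          fun c => by simp [juxtaposeDots, -Fin.natAdd_eq_addNat]
        rw [← hdot, ← hdot]
        change juxtaposeDots n n n n (Sum.map _ _ ((juxtaposeDots n n n n).symm _)) = _
        rw [Equiv.symm_apply_apply, Sum.map_inr, hab]
      have h2 : ((Diagram.cups n).concat ((Diagram.vertical rfl).juxtapose d)).partner
          (.inr (Fin.natAdd n a)) = .inr (Fin.natAdd n b) := by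
        refine (eq_concatPartner ?_ ?_).symm
        · exact fun h' => Diagram.partner_ne _ _ (h1.trans (congrArg Sum.inr (Sum.inr_injective h')))
        · have := connected_upper (Diagram.cups n) ((Diagram.vertical rfl).juxtapose d)
            (.inr (Fin.natAdd n a))
          rwa [h1] at this
      have h3 := (congrArg (fun D : Diagram 0 (n + n) => D.partner (.inr (Fin.natAdd n a))) h)
      have h4 := Sum.inr_injective (h2.symm.trans h3)
      have := congrArg Fin.val h4
      simp only [Fin.val_natAdd, Fin.val_rev] at this
      omega

theorem jonesWenzl_succ_mem {I : LeftTensorIdeal (TLCat δ)} (h : jonesWenzl δ n ∈ I.mor _ _) :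
    jonesWenzl δ (n + 1) ∈ I.mor _ _ := by
  have h1 := strand_mem h
  cases n with
  | zero => rwa [jonesWenzl, strand_id] at h1
  | succ n =>
    rw [jonesWenzl]
    refine sub_mem h1 (smul_mem ?_ _)
    exact I.comp_mem_left _ _ h1

/-- A nonzero morphism from the unit to the smallest possible number of strands in a nonzero ideal
is annihilated by all caps. -/
theorem exists_killsCaps_mem {I : LeftTensorIdeal (TLCat δ)} {X Y : TLCat δ} {f : X ⟶ Y}
    (hf : f ∈ I.mor X Y) (h0 : f ≠ 0) :
    ∃ (m : ℕ) (u : (⟨0⟩ : TLCat δ) ⟶ ⟨m⟩), u ∈ I.mor _ _ ∧ u ≠ 0 ∧ KillsCaps u := by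
  classical
  have hex : ∃ (m : ℕ) (u : (⟨0⟩ : TLCat δ) ⟶ ⟨m⟩), u ∈ I.mor _ _ ∧ u ≠ 0 :=
    ⟨_, I.exists_unit_hom (A := X) f hf h0⟩
  obtain ⟨u, hu, hu0⟩ := Nat.find_spec hex
  have hmin := fun j => Nat.find_min hex (m := j)
  refine ⟨_, u, hu, hu0, fun j d hd => ?_⟩
  generalize Nat.find hex = m at *
  obtain ⟨c, hc, h⟩ := hd.exists_adjacent
  obtain ⟨n, rfl⟩ : ∃ n, m = n + 2 + c := ⟨m - 2 - c, by omega⟩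
  obtain ⟨d', -, rfl, h2⟩ := Diagram.exists_capAt_concat d h
  rw [← ofDiagram_comp_of_loops (Y := ⟨n + c⟩) h2, ← Category.assoc]
  have h3 := I.comp_mem_left u (ofDiagram (Diagram.capAt c n) : _ ⟶ (⟨n + c⟩ : TLCat δ)) hu
  have h4 : u ≫ (ofDiagram (Diagram.capAt c n) : _ ⟶ (⟨n + c⟩ : TLCat δ)) = 0 := by
    by_contra h5
    exact hmin (n + c) (by omega) ⟨_, h3, h5⟩
  rw [h4, Limits.zero_comp]

/-- The trace ratio is `-[n + 1] / [n]` in terms of quantum integers. For `n = 0` both sides vanish,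
the right one as a division by zero. -/
theorem traceRatio_eq {q : k} (hq : q ≠ 0) (hδ : δ = -q - q⁻¹)
    (h : ∀ m, 0 < m → m ≤ n → (q ^ 2) ^ m ≠ 1) :
    traceRatio δ n = -((q ^ 2) ^ (n + 1) - 1) / (q * ((q ^ 2) ^ n - 1)) := by
  induction n with
  | zero => simp [traceRatio]
  | succ n ih =>
    have h1 := sub_ne_zero.2 (h (n + 1) (by omega) le_rfl)
    rw [traceRatio, ih fun m h1 h2 => h m h1 (by omega), inv_div, hδ]
    field_simp
    ring

section Order

variable {q : k}

theorem traceRatio_ne_zero (hq : q ≠ 0) (hδ : δ = -q - q⁻¹)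
    (hr : IsPrimitiveRoot (q ^ 2) (n + 2)) (m : ℕ) (h0 : 0 < m) (hm : m ≤ n) : traceRatio δ m ≠ 0 := by
  have h : ∀ i, 0 < i → i ≤ n + 1 → (q ^ 2) ^ i ≠ 1 := fun i hi hi' =>
    hr.pow_ne_one_of_pos_of_lt hi.ne' (by omega)
  rw [traceRatio_eq hq hδ fun i hi hi' => h i hi (by omega)]
  exact div_ne_zero (neg_ne_zero.2 (sub_ne_zero.2 (h _ (by omega) (by omega))))
    (mul_ne_zero hq (sub_ne_zero.2 (h _ h0 (by omega))))

theorem traceRatio_eq_zero (hq : q ≠ 0) (hδ : δ = -q - q⁻¹)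
    (hr : IsPrimitiveRoot (q ^ 2) (n + 2)) : traceRatio δ (n + 1) = 0 := by
  rw [traceRatio_eq hq hδ fun i hi hi' => hr.pow_ne_one_of_pos_of_lt hi.ne' (by omega),
    hr.pow_eq_one]
  simp

/-- A nonzero ideal contains a morphism from the unit in which nested cups occur and which is
annihilated by all caps. Bent to an endomorphism of `a` strands, it has a vertical part, so its
composite with the Jones–Wenzl idempotent on `a` strands is a nonzero multiple of the latter. -/
theorem jonesWenzl_mem_of_ne_zero [CharZero k] (hq : q ≠ 0) (hδ : δ = -q - q⁻¹)
    (hr : IsPrimitiveRoot (q ^ 2) (n + 2))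
    {I : LeftTensorIdeal (TLCat δ)} {X Y : TLCat δ} {f : X ⟶ Y} (hf : f ∈ I.mor X Y) (h0 : f ≠ 0) : jonesWenzl δ (n + 1) ∈ I.mor _ _ := by
  obtain ⟨m, u, hu, hu0, hk⟩ := exists_killsCaps_mem hf h0
  obtain ⟨a, rfl, ha, hc⟩ := hk.exists_coeff_cups_ne_zero hq hδ hr hu0
  obtain ⟨v, hv, e⟩ := I.exists_of_unit_hom (X := ⟨a⟩) (A := ⟨a⟩) (Y := ⟨a⟩) u hu
  have hv0 : coeff (.vertical rfl) v ≠ 0 := by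
    rw [← coeff_cups_bend v, ← e]
    exact hc
  have hp : jonesWenzl δ a ∈ I.mor _ _ := by
    have hka : KillsCaps (jonesWenzl δ a) := by
      cases a with
      | zero => exact (jonesWenzl_aux 0 fun m h h' => absurd h (by omega)).1.1
      | succ a =>
        exact (jonesWenzl_aux a fun m h h' =>
          traceRatio_ne_zero hq hδ hr m h (by omega)).2.1.1
    have h1 := I.comp_mem_right (jonesWenzl δ a) v hv
    rw [hka.comp_eq] at h1
    have := smul_mem h1 (coeff (.vertical rfl) v)⁻¹
    rwa [smul_smul, inv_mul_cancel₀ hv0, one_smul] at this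
  clear hc e hv hv0 hu0 hk hu
  obtain ⟨c, hc⟩ := Nat.exists_eq_add_of_le ha
  rw [hc]
  clear hc
  induction c with
  | zero => exact hp
  | succ c ih => exact jonesWenzl_succ_mem ih

theorem jonesWenzl_succ_mem_negligibleIdeal (hq : q ≠ 0) (hδ : δ = -q - q⁻¹)
    (hr : IsPrimitiveRoot (q ^ 2) (n + 2)) :
    jonesWenzl δ (n + 1) ∈ (negligibleIdeal (TLCat δ)).mor _ _ := by
  obtain ⟨-, ⟨h1, -⟩, h2⟩ := jonesWenzl_aux n (traceRatio_ne_zero hq hδ hr)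
  refine jonesWenzl_mem_negligibleIdeal h1 ?_
  rw [h2, traceRatio_eq_zero hq hδ hr, zero_smul]

theorem isProper_iff [CharZero k] (hq : q ≠ 0) (hδ : δ = -q - q⁻¹)
    (hr : IsPrimitiveRoot (q ^ 2) (n + 2))
    (I : LeftTensorIdeal (TLCat δ)) :
    I.IsProper ↔ I = negligibleIdeal (TLCat δ) := by
  constructor
  · rintro ⟨⟨X, Y, f, hf, h0⟩, X₀, Y₀, f₀, hf₀⟩
    ext X' Y' : 3
    exact le_antisymm (le_negligibleIdeal hf₀ X' Y') (negligibleIdeal_le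
      (traceRatio_ne_zero hq hδ hr) (jonesWenzl_mem_of_ne_zero hq hδ hr hf h0) X' Y')
  · rintro rfl
    exact ⟨⟨_, _, _, jonesWenzl_succ_mem_negligibleIdeal hq hδ hr, jonesWenzl_ne_zero _⟩,
      _, _, _, unit_notMem_negligibleIdeal unit_id_ne_zero⟩

end Order

end TLCat

end TemperleyLieb

open TemperleyLieb TLCat in
theorem mainTheorem12 {k : Type*} [Field k] [IsAlgClosed k] [CharZero k]
    (q : kˣ) (l : ℕ) (hl : 1 < l) (hq : orderOf (q ^ 2) = l) :
    ∃ J : LeftTensorIdeal (TLCat (-(q : k) - ((q⁻¹ : kˣ) : k))),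
      (∀ I : LeftTensorIdeal (TLCat (-(q : k) - ((q⁻¹ : kˣ) : k))), I.IsProper ↔ I = J) ∧
      (∀ (X Y : TLCat (-(q : k) - ((q⁻¹ : kˣ) : k))) (f : X ⟶ Y),
        f ∈ J.mor X Y ↔ IsNegligible f) ∧
      (∀ [BraidedCategory (TLCat (-(q : k) - ((q⁻¹ : kˣ) : k)))]
        (X Y : TLCat (-(q : k) - ((q⁻¹ : kˣ) : k))) (f : X ⟶ Y),
        f ∈ J.mor X Y ↔ IsBraidedNegligible f) ∧
      ∃ (f : (⟨l - 1⟩ : TLCat (-(q : k) - ((q⁻¹ : kˣ) : k))) ⟶ ⟨l - 1⟩) (α : k),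
        α ≠ 0 ∧ f ≫ f = α • f ∧ IsJonesWenzl (α⁻¹ • f) ∧
        J.IsGeneratedBy f ∧
        IsAnnihilatedByCupsAndCaps f ∧
        ∀ g : (⟨l - 1⟩ : TLCat (-(q : k) - ((q⁻¹ : kˣ) : k))) ⟶ ⟨l - 1⟩, f ≫ g = g ≫ f := by
  obtain ⟨n, rfl⟩ := Nat.exists_eq_add_of_le' (show 2 ≤ l from hl)
  have hq0 : (q : k) ≠ 0 := q.ne_zero
  have hδ : -(q : k) - ((q⁻¹ : kˣ) : k) = -(q : k) - (q : k)⁻¹ := by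
    rw [Units.val_inv_eq_inv_val]
  have hr : IsPrimitiveRoot ((q : k) ^ 2) (n + 2) := by
    have := IsPrimitiveRoot.orderOf (q ^ 2)
    rw [hq, ← IsPrimitiveRoot.coe_units_iff, Units.val_pow_eq_pow_val] at this
    exact this
  have hn := traceRatio_ne_zero hq0 hδ hr
  obtain ⟨-, ⟨h1, h2⟩, -⟩ := jonesWenzl_aux n hn
  have hidem : jonesWenzl (-(q : k) - ((q⁻¹ : kˣ) : k)) (n + 1) ≫ jonesWenzl _ (n + 1) =
      jonesWenzl _ (n + 1) := by
    rw [h1.comp_eq, coeff_jonesWenzl, one_smul]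
  have hann : IsAnnihilatedByCupsAndCaps (jonesWenzl (-(q : k) - ((q⁻¹ : kˣ) : k)) (n + 1)) := by
    intro d hd
    rw [Diagram.hasCap_iff_hasCup, or_self] at hd
    exact ⟨h1 _ d (Diagram.hasCap_iff_hasCup.2 hd), h2 _ d hd⟩
  refine ⟨negligibleIdeal _, isProper_iff hq0 hδ hr,
    fun X Y f => mem_negligibleIdeal_iff_isNegligible f,
    fun X Y f => mem_negligibleIdeal_iff_isBraidedNegligible f,
    jonesWenzl _ (n + 1), 1, one_ne_zero, ?_, ?_, ⟨?_, ?_⟩, hann, ?_⟩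
  · rw [one_smul]
    exact hidem
  · rw [inv_one, one_smul]
    exact ⟨jonesWenzl_ne_zero _, hidem, hann⟩
  · exact jonesWenzl_succ_mem_negligibleIdeal hq0 hδ hr
  · exact fun I hI => negligibleIdeal_le hn hI
  · exact fun g => (h1.comp_eq g).trans (h2.comp_eq g).symm
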